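/- For a compact (Hausdorff) group $G$ let $\widehat G$ be the set of equivalence classes of continuous irreducible unitary representations of $G$, and let $d_\pi$ be the dimension of $\pi\in\widehat G$. A \emph{central weight} on $\widehat G$ is a function $\omega:\widehat G\to(\delta,\infty)$, for some $\delta>0$, such that $\omega(\sigma)\le\omega(\pi)\,\omega(\pi')$ whenever $\sigma,\pi,\pi'\in\widehat G$ and $\sigma$ occurs in the decomposition of $\pi\otimes\pi'$. For such an $\omega$, the \emph{Beurling--Fourier algebra} $A(G,\omega)$ is the Banach algebra, under pointwise operations, of all $f\in C(G)$ with $$\|f\|_{A(G,\omega)}=\sum_{\pi\in\widehat G} d_\pi\,\omega(\pi)\,\|\widehat f(\pi)\|_1<\infty,\qquad \widehat f(\pi)=\int_G f(t)\,\overline{\pi}(t)\,dt,$$ where $dt$ is the normalized Haar measure, $\overline\pi$ is the conjugate representation of $\pi$ and $\|\cdot\|_1$ is the trace-class norm on $M_{d_\pi}(\mathbb C)$. A Banach algebra $A$ is \emph{Arens regular} if the first and second Arens products on $A^{**}$ coincide. \textbf{Theorem.} Let $\{G_i\}_{i\in I}$ be an infinite family of non-trivial compact groups and, for each $i\in I$,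 let $\omega_i$ be a central weight on $\widehat{G_i}$. Let $G=\prod_{i\in I}G_i$. (Recall that every element of $\widehat G$ is the class of $(x_i)_{i\in I}\mapsto\bigotimes_{i\in F}\pi_i(x_i)$ for a unique finite set $F\subseteq I$ and unique non-trivial $\pi_i\in\widehat{G_i}$ $(i\in F)$.) Let $\omega=\prod_{i\in I}\omega_i$ be the function on $\widehat G$ whose value at this class is $\prod_{i\in F}\omega_i(\pi_i)$. Suppose that $\omega$ is bounded away from zero, that is, $\inf_{\widehat G}\omega>0$. Then $A(G,\omega)$ is a Banach algebra that is not Arens regular. -/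

import Mathlib

open MeasureTheory
open scoped ENNReal Matrix TensorProduct

universe u v

noncomputable section

namespace BeurlingFourier

/-! ### Arens regularity -/

/-- The Arens adjoint of a bounded bilinear map `m : X × Y → Z`: the bounded bilinear map
`Z* × X → Y*` given by `(φ, x) ↦ (y ↦ φ (m x y))`. -/
def arensAdjoint {X Y Z : Type*} [NormedAddCommGroup X] [NormedSpace ℂ X]
    [NormedAddCommGroup Y] [NormedSpace ℂ Y] [NormedAddCommGroup Z] [NormedSpace ℂ Z]
    (m : X →L[ℂ] Y →L[ℂ] Z) : StrongDual ℂ Z →L[ℂ] X →L[ℂ] StrongDual ℂ Y :=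
  ((ContinuousLinearMap.compL ℂ X (Y →L[ℂ] Z) (Y →L[ℂ] ℂ)).flip m).comp
    (ContinuousLinearMap.compL ℂ Y Z ℂ)

theorem arensAdjoint_apply {X Y Z : Type*} [NormedAddCommGroup X] [NormedSpace ℂ X]
    [NormedAddCommGroup Y] [NormedSpace ℂ Y] [NormedAddCommGroup Z] [NormedSpace ℂ Z]
    (m : X →L[ℂ] Y →L[ℂ] Z) (φ : StrongDual ℂ Z) (x : X) (y : Y) :
    arensAdjoint m φ x y = φ (m x y) := rfl

section Arens

variable (A : Type*) [NormedRing A] [NormedAlgebra ℂ A]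

/-- The first Arens product on `A**`, the third Arens adjoint of the multiplication `m` of `A`:
`(F □ E) φ = F (f ↦ E (g ↦ φ (f * g)))`. If `F = w*-lim f_α` and `E = w*-lim g_β`, then
`F □ E = w*-lim_α w*-lim_β f_α g_β`. -/
def firstArensProduct (F E : StrongDual ℂ (StrongDual ℂ A)) : StrongDual ℂ (StrongDual ℂ A) :=
  arensAdjoint (arensAdjoint (arensAdjoint (ContinuousLinearMap.mul ℂ A))) F E

/-- The second Arens product on `A**`: `(F ◇ E) φ = E (g ↦ F (f ↦ φ (f * g)))`.
If `F = w*-lim f_α` and `E = w*-lim g_β`, then `F ◇ E = w*-lim_β w*-lim_α f_α g_β`. -/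
def secondArensProduct (F E : StrongDual ℂ (StrongDual ℂ A)) : StrongDual ℂ (StrongDual ℂ A) :=
  arensAdjoint (arensAdjoint (arensAdjoint (ContinuousLinearMap.mul ℂ A).flip)) E F

/-- `A` is Arens regular if the two Arens products on `A**` coincide. -/
def IsArensRegular : Prop :=
  ∀ F E : StrongDual ℂ (StrongDual ℂ A), firstArensProduct A F E = secondArensProduct A F E

end Arens

/-! ### The dual of a compact group -/

/-- The linear representation on column vectors given by a homomorphism into the unitary matrices. -/
def matRep {G : Type u} [Group G] {n : ℕ} (U : G →* Matrix.unitaryGroup (Fin n) ℂ) :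
    Representation ℂ G (Fin n → ℂ) :=
  ((Matrix.toLinAlgEquiv' (R := ℂ) (n := Fin n)).toAlgHom.toMonoidHom.comp
    (Matrix.unitaryGroup (Fin n) ℂ).subtype).comp U

theorem matRep_apply {G : Type u} [Group G] {n : ℕ} (U : G →* Matrix.unitaryGroup (Fin n) ℂ)
    (g : G) (v : Fin n → ℂ) : matRep U g v = (U g).1 *ᵥ v := rfl

/-- A continuous irreducible unitary representation of `G` on the Hilbert space `ℂ ^ dim`, given
by its matrices. For compact `G` every continuous irreducible unitary representation has finite
dimension, hence is unitarily equivalent to one of this form. -/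
structure Irrep (G : Type u) [Group G] [TopologicalSpace G] where
  /-- the dimension of the representation -/
  dim : ℕ
  /-- the matrices of the representation -/
  toHom : G →* Matrix.unitaryGroup (Fin dim) ℂ
  continuous_toHom : Continuous toHom
  irreducible : (matRep toHom).IsIrreducible

section Dual

variable {G : Type u} [Group G] [TopologicalSpace G]

/-- The matrix of `π` at `g`. -/
def Irrep.mat (π : Irrep G) (g : G) : Matrix (Fin π.dim) (Fin π.dim) ℂ := (π.toHom g).1

/-- The underlying linear representation. -/
def Irrep.rep (π : Irrep G) : Representation ℂ G (Fin π.dim → ℂ) := matRep π.toHom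

variable (G) in
/-- Equivalence of irreducible representations. (By Schur's lemma, linear equivalence of
irreducible unitary representations is the same as unitary equivalence.) -/
def irrepSetoid : Setoid (Irrep G) where
  r π ρ := Nonempty (Representation.Equiv π.rep ρ.rep)
  iseqv :=
    { refl := fun _ => ⟨Representation.Equiv.refl _⟩
      symm := fun ⟨e⟩ => ⟨e.symm⟩
      trans := fun ⟨e⟩ ⟨f⟩ => ⟨e.trans f⟩ }

variable (G) in
/-- The dual `Ĝ` of a compact group: equivalence classes of continuous irreducible unitary
representations. -/
def UnitaryDual : Type u := Quotient (irrepSetoid G)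

/-- A fixed representative of a class in `Ĝ`. -/
def UnitaryDual.repr (π : UnitaryDual G) : Irrep G := Quotient.out π

/-- `σ` is in the support of the representation `ρ`: it is equivalent to a subrepresentation. -/
def UnitaryDual.InSupport {V : Type*} [AddCommGroup V] [Module ℂ V]
    (σ : UnitaryDual G) (ρ : Representation ℂ G V) : Prop :=
  ∃ T : Representation.IntertwiningMap σ.repr.rep ρ, Function.Injective T

/-- A central weight on `Ĝ`: a function bounded below by a positive constant, with
`ω σ ≤ ω π * ω π'` whenever `σ` occurs in `π ⊗ π'`. -/
structure IsCentralWeight (ω : UnitaryDual G → ℝ) : Prop where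
  exists_lt : ∃ δ : ℝ, 0 < δ ∧ ∀ π, δ < ω π
  le_mul : ∀ σ π π' : UnitaryDual G, σ.InSupport (π.repr.rep.tprod π'.repr.rep) →
    ω σ ≤ ω π * ω π'

end Dual

/-! ### The Beurling-Fourier algebra of a compact group -/

/-- The trace-class norm `tr |M|`, the sum of the singular values of `M`. -/
def traceNorm {n : ℕ} (M : Matrix (Fin n) (Fin n) ℂ) : ℝ :=
  ∑ i, Real.sqrt ((Matrix.isHermitian_conjTranspose_mul_self M).eigenvalues i)

section Algebra

variable {G : Type u} [Group G] [TopologicalSpace G] [IsTopologicalGroup G] [CompactSpace G]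

/-- Integration with respect to the Haar measure of `G` of total mass one. -/
def haarIntegral (f : G → ℂ) : ℂ :=
  letI : MeasurableSpace G := borel G
  haveI : BorelSpace G := ⟨rfl⟩
  ∫ t, f t ∂(Measure.haarMeasure (⊤ : TopologicalSpace.PositiveCompacts G))

/-- The Fourier coefficient `∫ f(t) π̄(t) dt` of `f` at `π`, where `π̄` is the conjugate
representation. -/
def fourierCoeff (f : C(G, ℂ)) (π : UnitaryDual G) :
    Matrix (Fin π.repr.dim) (Fin π.repr.dim) ℂ :=
  Matrix.of fun i j => haarIntegral fun t => f t * star (π.repr.mat t i j)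

/-- The weighted Fourier norm `∑_π d_π ω(π) ‖f̂(π)‖₁`, with values in `[0, ∞]`. -/
def fourierNorm (ω : UnitaryDual G → ℝ) (f : C(G, ℂ)) : ℝ≥0∞ :=
  ∑' π : UnitaryDual G,
    ENNReal.ofReal ((π.repr.dim : ℝ) * ω π * traceNorm (fourierCoeff f π))

/-- The normed algebra `A`, together with the homomorphism `ι`, is (isometrically isomorphic to)
the Beurling-Fourier algebra `A(G, ω)`, the algebra under pointwise operations of all continuous
functions `f` with `‖f‖ = ∑_π d_π ω(π) ‖f̂(π)‖₁ < ∞`. -/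
structure IsBeurlingFourierAlgebra (ω : UnitaryDual G → ℝ) {A : Type*} [NormedCommRing A]
    [NormedAlgebra ℂ A] (ι : A →ₐ[ℂ] C(G, ℂ)) : Prop where
  injective : Function.Injective ι
  range_eq : Set.range ι = {f : C(G, ℂ) | fourierNorm ω f < ∞}
  norm_eq : ∀ a : A, ENNReal.ofReal ‖a‖ = fourierNorm ω (ι a)

end Algebra

/-! ### Products -/

section Product

variable {I : Type v} {G : I → Type u} [∀ i, Group (G i)] [∀ i, TopologicalSpace (G i)]

/-- The representation `x ↦ ⨂_{i ∈ F} π_i(x_i)` of `∏ i, G i`, for a finite set `F` of indices. -/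
def outerTensor (F : Finset I) (π : ∀ i : F, Irrep (G i)) :
    Representation ℂ (∀ i, G i) (⨂[ℂ] i : F, (Fin (π i).dim → ℂ)) where
  toFun x := PiTensorProduct.map fun i => (π i).rep (x i)
  map_one' := by simp
  map_mul' x y := by simp [Module.End.mul_eq_comp, PiTensorProduct.map_comp]

/-- `σ` is the class of `⨂_{i ∈ F} π_i`, where all the `π_i` are non-trivial. -/
def IsOuterTensor (σ : UnitaryDual (∀ i, G i)) (F : Finset I)
    (π : ∀ i : F, UnitaryDual (G i)) : Prop :=
  (∀ i, ¬ (π i).repr.rep.IsTrivial) ∧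
    Nonempty (Representation.Equiv σ.repr.rep (outerTensor F fun i => (π i).repr))

open Classical in
/-- The product `∏ i, w i` of functions on the duals of the `G i`, as a function on the dual of
`∏ i, G i`: its value at the class of `⨂_{i ∈ F} π_i`, with `F` finite and all `π_i` non-trivial,
is `∏_{i ∈ F} w i (π_i)`. For compact groups every class is of this form, for exactly one `F` and
one family `π`, so that the choice is no choice and the last line never applies. -/
def productWeight (w : ∀ i, UnitaryDual (G i) → ℝ) (σ : UnitaryDual (∀ i, G i)) : ℝ :=
  if h : ∃ p : (Σ F : Finset I, ∀ i : F, UnitaryDual (G i)), IsOuterTensor σ p.1 p.2 then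
    ∏ i : h.choose.1, w i (h.choose.2 i)
  else 0

end Product

end BeurlingFourier

end

/-! Failure of Arens regularity comes from multiplicativity of the weight across independent
factors. A diagonal matrix coefficient of a class `π` has norm at most `ω π` in `A(G, ω)`. Choose a
non-trivial class in every factor and two disjoint infinite sequences of indices. The coefficients
at an index of the first and an index of the second sequence depend on different variables, so their
product is a diagonal coefficient of the outer tensor product of the two classes, and the weight of
that class is the product of the two weights. Thus the normalized coefficients `f n`, `g m` lie in
the unit ball, and each `f n * g m` is again a normalized coefficient, of a class that determines
`(n, m)`. By Schur orthogonality the functional that sums `d ω ⟨·, u⟩` over the coefficients `u`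
with `n < m` takes the value `1` on `f n * g m` if `n < m` and `0` otherwise. It is bounded because
each term is dominated by a separate term of the series for the norm. The iterated limits in `n` and
`m` are then `1` and `0`, and the Arens products differ on weak* cluster points
(`not_isArensRegular_of_ite`, `IsBeurlingFourierAlgebra.not_isArensRegular_of_diagCoeff_mul`).

That `A(G, ω)` is a Banach algebra needs three facts. The product weight is central
(`isCentralWeight_productWeight`): if `κ` occurs in `ρ ⊗ ρ'`, then the component of `κ` on each
factor occurs in the tensor product of the components of `ρ` and `ρ'`, so the inequality can be
checked factor by factor. The norm is submultiplicative (`fourierNorm_mul_le`): a function of finite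
norm is an absolutely convergent sum of coefficient functions `⟨η, U ξ⟩`, which multiply by
tensoring, and such a function has unweighted Fourier norm at most `‖ξ‖ ‖η‖` by Bessel's inequality
for the isotypic projections. A function of finite norm is the sum of its Fourier series
(`hasSum_fourierPiece`), which rests on the Peter–Weyl theorem in the form
`eq_zero_of_fourierCoeff_eq_zero`. Completeness follows from countable subadditivity of the norm. -/

noncomputable section

namespace BeurlingFourier

/-! ### Normalized Haar integration on a compact group -/

section Haar

variable {G : Type u} [Group G] [TopologicalSpace G] [IsTopologicalGroup G] [CompactSpace G]

theorem haarIntegral_eq [m : MeasurableSpace G] [hm : BorelSpace G] (f : G → ℂ) :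
    haarIntegral f = ∫ t, f t ∂(Measure.haarMeasure (⊤ : TopologicalSpace.PositiveCompacts G)) := by
  obtain rfl : m = borel G := hm.measurable_eq
  rfl

instance isProbabilityMeasure_haarMeasure_top [MeasurableSpace G] [BorelSpace G] :
    IsProbabilityMeasure (Measure.haarMeasure (⊤ : TopologicalSpace.PositiveCompacts G)) :=
  ⟨by simpa using Measure.haarMeasure_self (K₀ := (⊤ : TopologicalSpace.PositiveCompacts G))⟩

theorem integrable_haarMeasure_top [MeasurableSpace G] [BorelSpace G] {f : G → ℂ}
    (hf : Continuous f) :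
    Integrable f (Measure.haarMeasure (⊤ : TopologicalSpace.PositiveCompacts G)) :=
  hf.integrable_of_hasCompactSupport (HasCompactSupport.of_compactSpace f)

theorem haarIntegral_const (c : ℂ) : haarIntegral (fun _ : G => c) = c := by
  borelize G
  simp [haarIntegral_eq]

theorem haarIntegral_add {f g : G → ℂ} (hf : Continuous f) (hg : Continuous g) :
    haarIntegral (fun t => f t + g t) = haarIntegral f + haarIntegral g := by
  borelize G
  simpa [haarIntegral_eq] using
    integral_add (integrable_haarMeasure_top hf) (integrable_haarMeasure_top hg)

theorem haarIntegral_sub {f g : G → ℂ} (hf : Continuous f) (hg : Continuous g) :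
    haarIntegral (fun t => f t - g t) = haarIntegral f - haarIntegral g := by
  borelize G
  simpa [haarIntegral_eq] using
    integral_sub (integrable_haarMeasure_top hf) (integrable_haarMeasure_top hg)

theorem haarIntegral_sum {ι : Type*} (s : Finset ι) {f : ι → G → ℂ}
    (hf : ∀ i ∈ s, Continuous (f i)) :
    haarIntegral (fun t => ∑ i ∈ s, f i t) = ∑ i ∈ s, haarIntegral (f i) := by
  borelize G
  simp only [haarIntegral_eq]
  exact integral_finsetSum s fun i hi => integrable_haarMeasure_top (hf i hi)

theorem haarIntegral_const_mul (c : ℂ) (f : G → ℂ) :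
    haarIntegral (fun t => c * f t) = c * haarIntegral f := by
  borelize G
  simpa [haarIntegral_eq] using integral_const_mul c f

theorem haarIntegral_mul_const (c : ℂ) (f : G → ℂ) :
    haarIntegral (fun t => f t * c) = haarIntegral f * c := by
  borelize G
  simpa [haarIntegral_eq] using integral_mul_const c f

theorem haarIntegral_star (f : G → ℂ) :
    haarIntegral (fun t => star (f t)) = star (haarIntegral f) := by
  borelize G
  simpa [haarIntegral_eq] using integral_conj (f := f)

theorem norm_haarIntegral_le {f : G → ℂ} {C : ℝ} (h : ∀ t, ‖f t‖ ≤ C) :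
    ‖haarIntegral f‖ ≤ C := by
  borelize G
  simpa [haarIntegral_eq] using norm_integral_le_of_norm_le_const
    (μ := Measure.haarMeasure (⊤ : TopologicalSpace.PositiveCompacts G)) (ae_of_all _ h)

theorem haarIntegral_mul_left (s : G) (f : G → ℂ) :
    haarIntegral (fun t => f (s * t)) = haarIntegral f := by
  borelize G
  simp only [haarIntegral_eq]
  exact integral_mul_left_eq_self f s

/-- Fubini for continuous functions of compact support, which asks for no countability of `G`. -/
theorem haarIntegral_swap {f : G → G → ℂ} (hf : Continuous f.uncurry) :
    haarIntegral (fun s => haarIntegral (f s)) =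
      haarIntegral (fun t => haarIntegral fun s => f s t) := by
  borelize G
  simp only [haarIntegral_eq]
  exact integral_integral_swap_of_hasCompactSupport hf (HasCompactSupport.of_compactSpace _)

/-- Unimodularity from left invariance alone: integrating `f (s⁻¹ * t)` first over `t` gives the
integral of `f`, first over `s` the integral of `f t⁻¹`. -/
theorem haarIntegral_inv {f : G → ℂ} (hf : Continuous f) :
    haarIntegral (fun t => f t⁻¹) = haarIntegral f := by
  have h := haarIntegral_swap (G := G) (f := fun s t => f (s⁻¹ * t))
    (by simp only [Function.uncurry_def]; fun_prop)
  have h1 : ∀ s : G, haarIntegral (fun t => f (s⁻¹ * t)) = haarIntegral f :=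
    fun s => haarIntegral_mul_left s⁻¹ f
  have h2 : ∀ t : G, haarIntegral (fun s => f (s⁻¹ * t)) = haarIntegral fun s => f s⁻¹ := by
    intro t
    rw [← haarIntegral_mul_left t]
    simp
  simp only [h1, h2, haarIntegral_const] at h
  exact h.symm

end Haar

/-! ### The trace norm and its duality with the operator norm -/

section TraceNorm

variable {n : ℕ}

theorem traceNorm_nonneg (M : Matrix (Fin n) (Fin n) ℂ) : 0 ≤ traceNorm M :=
  Finset.sum_nonneg fun _ _ => Real.sqrt_nonneg _

/-- The images of the right singular vectors, their inner products. -/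
theorem inner_toLpLin_eigenvectorBasis (M : Matrix (Fin n) (Fin n) ℂ) (k l : Fin n) :
    inner ℂ (WithLp.toLp 2 (M *ᵥ
        ((Matrix.isHermitian_conjTranspose_mul_self M).eigenvectorBasis k).ofLp))
      (WithLp.toLp 2 (M *ᵥ
        ((Matrix.isHermitian_conjTranspose_mul_self M).eigenvectorBasis l).ofLp)) =
      if k = l then ((Matrix.isHermitian_conjTranspose_mul_self M).eigenvalues l : ℂ) else 0 := by
  set H := Matrix.isHermitian_conjTranspose_mul_self M
  have h1 := H.mulVec_eigenvectorBasis l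
  have h2 := orthonormal_iff_ite.mp H.eigenvectorBasis.orthonormal k l
  rw [EuclideanSpace.inner_eq_star_dotProduct] at h2 ⊢
  rw [Matrix.star_mulVec, dotProduct_comm, ← Matrix.dotProduct_mulVec, Matrix.mulVec_mulVec, h1,
    dotProduct_smul, dotProduct_comm, h2]
  simp

/-- The singular value decomposition, as a decomposition into matrices of rank one. -/
theorem exists_rankOne_decomposition (M : Matrix (Fin n) (Fin n) ℂ) :
    ∃ x y : Fin n → EuclideanSpace ℂ (Fin n),
      (∀ i j, M i j = ∑ k, x k i * star (y k j)) ∧ ∑ k, ‖x k‖ * ‖y k‖ = traceNorm M := by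
  set H := Matrix.isHermitian_conjTranspose_mul_self M
  -- With `v k` an orthonormal eigenbasis of `Mᴴ M`, expand the `j`-th unit vector in it and apply
  -- `M`. The norm of `M (v k)` is the `k`-th singular value.
  refine ⟨fun k => WithLp.toLp 2 (M *ᵥ (H.eigenvectorBasis k).ofLp), H.eigenvectorBasis,
    fun i j => ?_, ?_⟩
  · have h := H.eigenvectorBasis.sum_repr (EuclideanSpace.single j (1 : ℂ))
    have h' := congrArg (fun v : EuclideanSpace ℂ (Fin n) => (M *ᵥ v.ofLp) i) h
    simp only [H.eigenvectorBasis.repr_apply_apply, EuclideanSpace.inner_single_right,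
      WithLp.ofLp_sum, Matrix.mulVec_sum, WithLp.ofLp_smul, Matrix.mulVec_smul] at h'
    simp only [PiLp.ofLp_single, Matrix.mulVec_single_one] at h'
    simp only [Finset.sum_apply, Pi.smul_apply, smul_eq_mul, one_mul, Matrix.col_apply] at h'
    rw [← h']
    exact Finset.sum_congr rfl fun k _ => mul_comm _ _
  · refine Finset.sum_congr rfl fun k _ => ?_
    rw [H.eigenvectorBasis.orthonormal.1 k, mul_one, @norm_eq_sqrt_re_inner ℂ]
    rw [inner_toLpLin_eigenvectorBasis]
    simp

/-- A matrix of operator norm at most one, as a functional on matrices. -/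
def IsContractive (C : Matrix (Fin n) (Fin n) ℂ) : Prop :=
  ∀ x y : EuclideanSpace ℂ (Fin n), ‖∑ i, ∑ j, x i * star (y j) * C i j‖ ≤ ‖x‖ * ‖y‖

theorem IsContractive.norm_sum_rankOne_le {C : Matrix (Fin n) (Fin n) ℂ} (hC : IsContractive C)
    {ι : Type*} (s : Finset ι) (x y : ι → EuclideanSpace ℂ (Fin n)) :
    ‖∑ i, ∑ j, (∑ k ∈ s, x k i * star (y k j)) * C i j‖ ≤ ∑ k ∈ s, ‖x k‖ * ‖y k‖ := by
  have : ∑ i, ∑ j, (∑ k ∈ s, x k i * star (y k j)) * C i j =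
      ∑ k ∈ s, ∑ i, ∑ j, x k i * star (y k j) * C i j := by
    simp only [Finset.sum_mul]
    rw [Finset.sum_comm (s := s)]
    exact Finset.sum_congr rfl fun i _ => Finset.sum_comm
  rw [this]
  exact (norm_sum_le _ _).trans (Finset.sum_le_sum fun k _ => hC _ _)

theorem IsContractive.norm_le_traceNorm {C : Matrix (Fin n) (Fin n) ℂ} (hC : IsContractive C)
    (M : Matrix (Fin n) (Fin n) ℂ) : ‖∑ i, ∑ j, M i j * C i j‖ ≤ traceNorm M := by
  obtain ⟨x, y, h, h'⟩ := exists_rankOne_decomposition M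
  simp only [h, ← h']
  exact hC.norm_sum_rankOne_le _ x y

/-- The supremum in trace duality is attained at the partial isometry of the polar decomposition,
conjugated to fit the bilinear pairing: it is built from the normalized left singular vectors `u k`
and the right ones, and Bessel's inequality makes it contractive. -/
theorem exists_isContractive (M : Matrix (Fin n) (Fin n) ℂ) :
    ∃ C, IsContractive C ∧ ∑ i, ∑ j, M i j * C i j = traceNorm M := by
  set H := Matrix.isHermitian_conjTranspose_mul_self M
  set x : Fin n → EuclideanSpace ℂ (Fin n) :=
    fun k => WithLp.toLp 2 (M *ᵥ (H.eigenvectorBasis k).ofLp) with hx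
  have hxx : ∀ k l, inner ℂ (x k) (x l) = if k = l then (H.eigenvalues l : ℂ) else 0 :=
    inner_toLpLin_eigenvectorBasis M
  have hpos : ∀ k, 0 ≤ H.eigenvalues k := by
    intro k
    have h := inner_self_nonneg (𝕜 := ℂ) (x := x k)
    rw [hxx] at h
    simpa using h
  -- Since the inverse of `0` is `0`, the vector `u k` vanishes when the singular value does. The
  -- others are orthonormal.
  set u : Fin n → EuclideanSpace ℂ (Fin n) :=
    fun k => ((Real.sqrt (H.eigenvalues k))⁻¹ : ℂ) • x k with hu
  have hu_orth : Orthonormal ℂ fun k : {k // H.eigenvalues k ≠ 0} => u k := by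
    rw [orthonormal_iff_ite]
    intro k l
    simp only [hu, inner_smul_left, inner_smul_right, hxx, Subtype.ext_iff]
    split_ifs with h
    · rw [h]
      have h1 : ((Real.sqrt (H.eigenvalues l) : ℝ) : ℂ) ≠ 0 := by
        simpa [Real.sqrt_eq_zero (hpos _)] using l.2
      have h2 : (H.eigenvalues l : ℂ) = Real.sqrt (H.eigenvalues l) * Real.sqrt (H.eigenvalues l) := by
        rw [← Complex.ofReal_mul, Real.mul_self_sqrt (hpos _)]
      rw [h2]
      simp only [map_inv₀, Complex.conj_ofReal]
      field_simp
    · simp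
  have hu_zero : ∀ k, H.eigenvalues k = 0 → u k = 0 := fun k hk => by simp [hu, hk]
  have hbessel : ∀ z : EuclideanSpace ℂ (Fin n), ∑ k, ‖inner ℂ (u k) z‖ ^ 2 ≤ ‖z‖ ^ 2 := by
    intro z
    refine le_trans (le_of_eq ?_) (hu_orth.sum_inner_products_le z (s := Finset.univ))
    rw [← Finset.sum_subtype (p := fun k => H.eigenvalues k ≠ 0)
      (Finset.univ.filter fun k => H.eigenvalues k ≠ 0) (by simp)
      (fun k => ‖inner ℂ (u k) z‖ ^ 2), Finset.sum_filter_of_ne]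
    intro k _ hk h0
    exact hk (by simp [hu_zero k h0])
  refine ⟨Matrix.of fun i j => ∑ k, star (u k i) * H.eigenvectorBasis k j, fun z y => ?_, ?_⟩
  · have : ∑ i, ∑ j, z i * star (y j) *
        (Matrix.of fun i j => ∑ k, star (u k i) * H.eigenvectorBasis k j) i j =
        ∑ k, inner ℂ (u k) z * inner ℂ y (H.eigenvectorBasis k) := by
      simp only [Matrix.of_apply, PiLp.inner_apply, RCLike.inner_apply, Finset.sum_mul_sum,
        starRingEnd_apply]
      simp only [Finset.mul_sum]
      symm
      rw [Finset.sum_comm]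
      refine Finset.sum_congr rfl fun i _ => ?_
      rw [Finset.sum_comm]
      exact Finset.sum_congr rfl fun j _ => Finset.sum_congr rfl fun k _ => by ring
    rw [this]
    calc _ ≤ ∑ k, ‖inner ℂ (u k) z‖ * ‖inner ℂ y (H.eigenvectorBasis k)‖ := by
          refine (norm_sum_le _ _).trans (le_of_eq ?_)
          simp
      _ ≤ Real.sqrt (∑ k, ‖inner ℂ (u k) z‖ ^ 2) *
            Real.sqrt (∑ k, ‖inner ℂ y (H.eigenvectorBasis k)‖ ^ 2) :=
          Real.sum_mul_le_sqrt_mul_sqrt _ _ _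
      _ ≤ ‖z‖ * ‖y‖ := by
          refine mul_le_mul (Real.sqrt_le_iff.mpr ⟨norm_nonneg _, hbessel z⟩) (le_of_eq ?_)
            (Real.sqrt_nonneg _) (norm_nonneg _)
          rw [H.eigenvectorBasis.sum_sq_norm_inner_left, Real.sqrt_sq (norm_nonneg _)]
  · have : ∑ i, ∑ j, M i j *
        (Matrix.of fun i j => ∑ k, star (u k i) * H.eigenvectorBasis k j) i j =
        ∑ k, inner ℂ (u k) (x k) := by
      simp only [hx, Matrix.of_apply, PiLp.inner_apply, RCLike.inner_apply, Matrix.mulVec,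
        dotProduct, Finset.sum_mul, Finset.mul_sum, starRingEnd_apply]
      symm
      rw [Finset.sum_comm]
      refine Finset.sum_congr rfl fun i _ => ?_
      rw [Finset.sum_comm]
      exact Finset.sum_congr rfl fun j _ => Finset.sum_congr rfl fun k _ => by ring
    rw [this, traceNorm, Complex.ofReal_sum]
    refine Finset.sum_congr rfl fun k _ => ?_
    simp only [hu, inner_smul_left, hxx, if_true]
    rw [map_inv₀, Complex.conj_ofReal, ← Complex.ofReal_inv, ← Complex.ofReal_mul, inv_mul_eq_div,
      Real.div_sqrt]

/-- Pair `M` with a contractive matrix that norms it. Together with the singular value decomposition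
this identifies the trace norm as the projective tensor norm. -/
theorem traceNorm_le_of_decomposition {M : Matrix (Fin n) (Fin n) ℂ} {ι : Type*} (s : Finset ι)
    (x y : ι → EuclideanSpace ℂ (Fin n)) (h : ∀ i j, M i j = ∑ k ∈ s, x k i * star (y k j)) :
    traceNorm M ≤ ∑ k ∈ s, ‖x k‖ * ‖y k‖ := by
  obtain ⟨C, hC, hM⟩ := exists_isContractive M
  have := hC.norm_sum_rankOne_le s x y
  simp only [← h, hM] at this
  rwa [Complex.norm_real, Real.norm_of_nonneg (traceNorm_nonneg M)] at this

theorem traceNorm_smul (c : ℂ) (M : Matrix (Fin n) (Fin n) ℂ) :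
    traceNorm (c • M) = ‖c‖ * traceNorm M := by
  have key : ∀ (c : ℂ) (M : Matrix (Fin n) (Fin n) ℂ), traceNorm (c • M) ≤ ‖c‖ * traceNorm M := by
    intro c M
    obtain ⟨x, y, h, h'⟩ := exists_rankOne_decomposition M
    refine (traceNorm_le_of_decomposition Finset.univ (fun k => c • x k) y fun i j => ?_).trans ?_
    · simp [h, Finset.mul_sum, mul_assoc]
    · simp [← h', norm_smul, Finset.mul_sum, mul_assoc]
  refine le_antisymm (key c M) ?_
  by_cases hc : c = 0
  · simpa [hc] using traceNorm_nonneg (0 : Matrix (Fin n) (Fin n) ℂ)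
  · have := key c⁻¹ (c • M)
    rw [smul_smul, inv_mul_cancel₀ hc, one_smul, norm_inv] at this
    rwa [← le_inv_mul_iff₀ (norm_pos_iff.mpr hc)]

theorem traceNorm_zero : traceNorm (0 : Matrix (Fin n) (Fin n) ℂ) = 0 := by
  simpa using traceNorm_smul 0 (0 : Matrix (Fin n) (Fin n) ℂ)

/-- Countable subadditivity of the trace norm. -/
theorem ofReal_traceNorm_le_tsum {ι : Type*} {M : Matrix (Fin n) (Fin n) ℂ}
    {N : ι → Matrix (Fin n) (Fin n) ℂ} (h : ∀ i j, HasSum (fun k => N k i j) (M i j)) :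
    ENNReal.ofReal (traceNorm M) ≤ ∑' k, ENNReal.ofReal (traceNorm (N k)) := by
  obtain ⟨C, hC, hM⟩ := exists_isContractive M
  have h1 : HasSum (fun k => ∑ i, ∑ j, N k i j * C i j) (traceNorm M : ℂ) := by
    rw [← hM]
    exact hasSum_sum fun i _ => hasSum_sum fun j _ => (h i j).mul_right _
  rcases eq_or_ne (∑' k, ENNReal.ofReal (traceNorm (N k))) ⊤ with htop | htop
  · simp [htop]
  have h2 : Summable fun k => traceNorm (N k) := by
    have := ENNReal.summable_toReal htop
    simpa [traceNorm_nonneg] using this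
  rw [← ENNReal.ofReal_tsum_of_nonneg (fun _ => traceNorm_nonneg _) h2]
  refine ENNReal.ofReal_le_ofReal ?_
  have h3 := tsum_of_norm_bounded h2.hasSum fun k => hC.norm_le_traceNorm (N k)
  rw [h1.tsum_eq, Complex.norm_real, Real.norm_of_nonneg (traceNorm_nonneg M)] at h3
  exact h3

end TraceNorm

/-! ### Entries of unitary matrix representations -/

section UnitaryMatrices

variable {G : Type u} [Group G] {n : Type*} [Fintype n] [DecidableEq n]

theorem coe_map_inv (U : G →* Matrix.unitaryGroup n ℂ) (g : G) :
    (U g⁻¹).1 = (U g).1ᴴ := by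
  rw [map_inv]
  rfl

theorem coe_map_inv_apply (U : G →* Matrix.unitaryGroup n ℂ) (g : G) (i j : n) :
    (U g⁻¹).1 i j = star ((U g).1 j i) := by
  rw [coe_map_inv, Matrix.conjTranspose_apply]

theorem coe_map_mul (U : G →* Matrix.unitaryGroup n ℂ) (g h : G) :
    (U (g * h)).1 = (U g).1 * (U h).1 := by
  rw [map_mul]
  rfl

theorem coe_map_mul_apply (U : G →* Matrix.unitaryGroup n ℂ) (g h : G) (i j : n) :
    (U (g * h)).1 i j = ∑ k, (U g).1 i k * (U h).1 k j := by
  rw [coe_map_mul, Matrix.mul_apply]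

theorem continuous_coe_apply [TopologicalSpace G] {U : G →* Matrix.unitaryGroup n ℂ}
    (hU : Continuous U) (i j : n) : Continuous fun g => (U g).1 i j :=
  (continuous_subtype_val.comp hU).matrix_elem i j

theorem sum_star_mul_coe_map (U : G →* Matrix.unitaryGroup n ℂ) (g : G) (j : n) :
    ∑ i, (U g).1 i j * star ((U g).1 i j) = 1 := by
  have h := congrFun (congrFun (Matrix.mem_unitaryGroup_iff'.mp (U g).2) j) j
  rw [Matrix.mul_apply, Matrix.one_apply_eq] at h
  rw [← h]
  exact Finset.sum_congr rfl fun i _ => mul_comm _ _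

end UnitaryMatrices

/-! ### Schur's lemma and the orthogonality relations -/

section Schur

variable {G : Type u} [Group G] [TopologicalSpace G]

theorem Irrep.continuous_mat_apply (π : Irrep G) (i j : Fin π.dim) :
    Continuous fun g => π.mat g i j :=
  continuous_coe_apply π.continuous_toHom i j

theorem Irrep.rep_apply (π : Irrep G) (g : G) (v : Fin π.dim → ℂ) : π.rep g v = π.mat g *ᵥ v := rfl

instance Irrep.isIrreducible_rep (π : Irrep G) : π.rep.IsIrreducible := π.irreducible

/-- The zero space has a single subrepresentation, so it is not irreducible. The instance makes `0 :
Fin π.dim` available as a base index. -/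
instance Irrep.neZero_dim (π : Irrep G) : NeZero π.dim := by
  refine ⟨fun h => ?_⟩
  have : IsEmpty (Fin π.dim) := by rw [h]; infer_instance
  obtain ⟨a, b, hab⟩ := exists_pair_ne (Subrepresentation π.rep)
  refine hab (SetLike.ext fun x => ?_)
  rw [Subsingleton.elim x 0]
  exact ⟨fun _ => b.toSubmodule.zero_mem, fun _ => a.toSubmodule.zero_mem⟩

/-- A matrix intertwining with a representation, as an intertwining map. -/
def intertwiningOfMatrix (π : Irrep G) {n : Type*} [Fintype n] {ρ : Representation ℂ G (n → ℂ)}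
    (X : Matrix n (Fin π.dim) ℂ) (h : ∀ g v, X *ᵥ (π.mat g *ᵥ v) = ρ g (X *ᵥ v)) :
    Representation.IntertwiningMap π.rep ρ where
  toLinearMap := X.mulVecLin
  isIntertwining' g := LinearMap.ext fun v => h g v

theorem Irrep.nonempty_equiv_of_intertwining (π ρ : Irrep G)
    (X : Matrix (Fin ρ.dim) (Fin π.dim) ℂ) (h : ∀ g, X * π.mat g = ρ.mat g * X) (hX : X ≠ 0) :
    Nonempty (Representation.Equiv π.rep ρ.rep) := by
  let T : Representation.IntertwiningMap π.rep ρ.rep := intertwiningOfMatrix π X fun g v => by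
    rw [Matrix.mulVec_mulVec, h, Irrep.rep_apply, Matrix.mulVec_mulVec]
  rcases Representation.IsIrreducible.bijective_or_eq_zero T with hT | hT
  · exact ⟨T.ofBijective hT⟩
  · refine absurd ?_ hX
    ext i j
    have := congrFun (congrArg (fun f : Representation.IntertwiningMap π.rep ρ.rep =>
      (f (Pi.single j 1) : Fin ρ.dim → ℂ)) hT) i
    have h2 : T (Pi.single j 1) = X *ᵥ Pi.single j 1 := rfl
    simp only [h2] at this
    simpa using this

theorem Irrep.eq_smul_one_of_commute (π : Irrep G) (X : Matrix (Fin π.dim) (Fin π.dim) ℂ)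
    (h : ∀ g, X * π.mat g = π.mat g * X) : ∃ c : ℂ, X = c • 1 := by
  let T : Representation.IntertwiningMap π.rep π.rep := intertwiningOfMatrix π X fun g v => by
    rw [Matrix.mulVec_mulVec, h, Irrep.rep_apply, Matrix.mulVec_mulVec]
  obtain ⟨c, hc⟩ := (Representation.IsIrreducible.algebraMap_intertwiningMap_bijective_of_isAlgClosed
    (ρ := π.rep)).2 T
  refine ⟨c, ?_⟩
  ext i j
  have := congrFun (congrArg (fun f : Representation.IntertwiningMap π.rep π.rep =>
      (f (Pi.single j 1) : Fin π.dim → ℂ)) hc) i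
  have h2 : T (Pi.single j 1) = X *ᵥ Pi.single j 1 := rfl
  simp only [h2] at this
  simpa [Matrix.one_apply, Pi.single_apply] using this.symm

theorem UnitaryDual.nonempty_equiv_iff {π ρ : UnitaryDual G} :
    Nonempty (Representation.Equiv π.repr.rep ρ.repr.rep) ↔ π = ρ :=
  Quotient.out_equiv_out (s := irrepSetoid G) (x := π) (y := ρ)

theorem Irrep.exists_matrix_of_intertwining {π : Irrep G} {n : Type*} [Fintype n] [DecidableEq n]
    {ρ : Representation ℂ G (n → ℂ)} (T : Representation.IntertwiningMap π.rep ρ) :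
    ∃ X : Matrix n (Fin π.dim) ℂ, (∀ v, T v = X *ᵥ v) := by
  refine ⟨LinearMap.toMatrix' T.toLinearMap, fun v => ?_⟩
  rw [LinearMap.toMatrix'_mulVec]
  rfl

open scoped ComplexOrder in
/-- Equivalent irreducible unitary representations are unitarily equivalent. -/
theorem Irrep.exists_unitary_of_equiv {π ρ : Irrep G}
    (h : Nonempty (Representation.Equiv π.rep ρ.rep)) :
    ∃ A : Matrix (Fin ρ.dim) (Fin π.dim) ℂ, Aᴴ * A = 1 ∧ A * Aᴴ = 1 ∧
      ∀ g, ρ.mat g = A * π.mat g * Aᴴ := by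
  obtain ⟨e⟩ := h
  obtain ⟨X, hX⟩ := Irrep.exists_matrix_of_intertwining e.toIntertwiningMap
  have hcomm : ∀ g, X * π.mat g = ρ.mat g * X := by
    intro g
    refine Matrix.ext_of_mulVec_single fun j => ?_
    rw [← Matrix.mulVec_mulVec, ← Matrix.mulVec_mulVec, ← hX, ← hX, ← Irrep.rep_apply,
      ← Irrep.rep_apply]
    exact Representation.IntertwiningMap.isIntertwining _ _ e.toIntertwiningMap g _
  have hcomm' : ∀ g, Xᴴ * ρ.mat g = π.mat g * Xᴴ := by
    intro g
    have h1 := congrArg Matrix.conjTranspose (hcomm g⁻¹)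
    rw [Matrix.conjTranspose_mul, Matrix.conjTranspose_mul, Irrep.mat, Irrep.mat, coe_map_inv,
      coe_map_inv, Matrix.conjTranspose_conjTranspose, Matrix.conjTranspose_conjTranspose] at h1
    exact h1.symm
  obtain ⟨c, hc⟩ := π.eq_smul_one_of_commute (Xᴴ * X) fun g => by
    rw [Matrix.mul_assoc, hcomm, ← Matrix.mul_assoc, hcomm', Matrix.mul_assoc]
  obtain ⟨c', hc'⟩ := ρ.eq_smul_one_of_commute (X * Xᴴ) fun g => by
    rw [Matrix.mul_assoc, hcomm', ← Matrix.mul_assoc, hcomm, Matrix.mul_assoc]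
  have hX0 : X ≠ 0 := by
    rintro rfl
    have h1 : e (Pi.single 0 1) = 0 := (hX _).trans (Matrix.zero_mulVec _)
    have h2 := e.toLinearEquiv.map_eq_zero_iff.mp h1
    simpa using congrFun h2 0
  have hcc : c' = c := by
    have h1 : (c' • (1 : Matrix (Fin ρ.dim) (Fin ρ.dim) ℂ)) * X =
        X * (c • (1 : Matrix (Fin π.dim) (Fin π.dim) ℂ)) := by
      rw [← hc, ← hc', Matrix.mul_assoc]
    rw [Matrix.smul_mul, Matrix.mul_smul, Matrix.one_mul, Matrix.mul_one] at h1
    exact smul_left_injective ℂ hX0 h1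
  -- Reading `Xᴴ X = c` at the entry `(0, 0)` shows that `c` is a squared column norm, so `X / √c`
  -- is the desired unitary matrix.
  have hpos : c = ((∑ i, ‖X i 0‖ ^ 2 : ℝ) : ℂ) := by
    have h1 := congrFun (congrFun hc 0) 0
    simp only [Matrix.mul_apply, Matrix.conjTranspose_apply, Matrix.smul_apply,
      Matrix.one_apply_eq, smul_eq_mul, mul_one] at h1
    rw [← h1, Complex.ofReal_sum]
    refine Finset.sum_congr rfl fun i _ => ?_
    rw [← Complex.normSq_eq_norm_sq, Complex.normSq_eq_conj_mul_self]
    rfl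
  set r : ℝ := ∑ i, ‖X i 0‖ ^ 2 with hr
  have hr0 : 0 ≤ r := Finset.sum_nonneg fun _ _ => sq_nonneg _
  have hc0 : c ≠ 0 := by
    rintro rfl
    rw [zero_smul] at hc
    exact hX0 (Matrix.conjTranspose_mul_self_eq_zero.mp hc)
  have hscale : star ((√r : ℝ) : ℂ)⁻¹ * ((√r : ℝ) : ℂ)⁻¹ * c = 1 := by
    have hr1 : (√r : ℂ) * √r = c := by
      rw [← Complex.ofReal_mul, Real.mul_self_sqrt hr0, hpos]
    have hr2 : (√r : ℂ) ≠ 0 := by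
      intro h0
      rw [h0, zero_mul] at hr1
      exact hc0 hr1.symm
    rw [star_inv₀, Complex.star_def, Complex.conj_ofReal, ← hr1]
    field_simp
  have h1 : (((√r : ℝ) : ℂ)⁻¹ • X)ᴴ * (((√r : ℝ) : ℂ)⁻¹ • X) = 1 := by
    rw [Matrix.conjTranspose_smul, Matrix.smul_mul, Matrix.mul_smul, hc, smul_smul, smul_smul,
      hscale, one_smul]
  have h2 : (((√r : ℝ) : ℂ)⁻¹ • X) * (((√r : ℝ) : ℂ)⁻¹ • X)ᴴ = 1 := by
    rw [Matrix.conjTranspose_smul, Matrix.smul_mul, Matrix.mul_smul, hc', smul_smul, smul_smul,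
      hcc, mul_comm _ (star _), hscale, one_smul]
  refine ⟨((√r : ℝ) : ℂ)⁻¹ • X, h1, h2, fun g => ?_⟩
  rw [Matrix.smul_mul, hcomm, ← Matrix.mul_smul, Matrix.mul_assoc, h2, Matrix.mul_one]

variable [IsTopologicalGroup G] [CompactSpace G]
variable {n : Type*} [Fintype n] [DecidableEq n]

/-- The Fourier coefficients of the coefficient functions of a unitary representation. -/
def coeffMatrix (U : G →* Matrix.unitaryGroup n ℂ) (σ : Irrep G) (i j : Fin σ.dim) :
    Matrix n n ℂ :=
  Matrix.of fun k l => haarIntegral fun t => (U t).1 k l * star (σ.mat t i j)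

variable {U : G →* Matrix.unitaryGroup n ℂ} (hU : Continuous U) (σ τ : Irrep G)

include hU in
-- Translation invariance of the integral. For fixed `j` and `l`, the matrix with entry `coeffMatrix
-- U σ m j p l` in row `p` and column `m` therefore intertwines `σ` with `U`; Schur's lemma is
-- applied to this matrix.
theorem sum_mul_coeffMatrix (i j : Fin σ.dim) (k l : n) (s : G) :
    ∑ p, (U s).1 k p * coeffMatrix U σ i j p l = ∑ m, σ.mat s m i * coeffMatrix U σ m j k l := by
  have hc := continuous_coe_apply hU
  have hc' := σ.continuous_mat_apply
  simp only [coeffMatrix, Matrix.of_apply, ← haarIntegral_const_mul]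
  rw [← haarIntegral_sum _ fun p _ => by fun_prop, ← haarIntegral_sum _ fun p _ => by fun_prop,
    ← haarIntegral_mul_left s⁻¹]
  congr 1
  funext t
  have h1 : (U t).1 k l = ∑ p, (U s).1 k p * (U (s⁻¹ * t)).1 p l := by
    rw [← coe_map_mul_apply, mul_inv_cancel_left]
  have h2 : star (σ.mat (s⁻¹ * t) i j) = ∑ m, σ.mat s m i * star (σ.mat t m j) := by
    simp only [Irrep.mat, coe_map_mul_apply, coe_map_inv_apply, star_sum, star_mul, star_star]
    exact Finset.sum_congr rfl fun _ _ => mul_comm _ _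
  simp only [← mul_assoc]
  rw [← Finset.sum_mul, ← h1, h2, Finset.mul_sum]
  exact Finset.sum_congr rfl fun _ _ => by ring

include hU in
theorem star_coeffMatrix (i j : Fin σ.dim) (k l : n) :
    star (coeffMatrix U σ i j k l) = coeffMatrix U σ j i l k := by
  have hc := continuous_coe_apply hU
  have hc' := σ.continuous_mat_apply
  simp only [coeffMatrix, Matrix.of_apply]
  rw [← haarIntegral_star, ← haarIntegral_inv (by fun_prop)]
  congr 1
  funext t
  simp only [Irrep.mat, coe_map_inv_apply, star_mul, star_star]
  ring

theorem coeffMatrix_of_not_equiv (h : ¬ Nonempty (Representation.Equiv σ.rep τ.rep))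
    (i j : Fin σ.dim) (k l : Fin τ.dim) : coeffMatrix τ.toHom σ i j k l = 0 := by
  by_contra hne
  refine h (σ.nonempty_equiv_of_intertwining τ
    (Matrix.of fun p m => coeffMatrix τ.toHom σ m j p l) (fun g => ?_) fun h0 => ?_)
  · ext p m
    simp only [Matrix.mul_apply, Matrix.of_apply]
    refine Eq.trans ?_ (sum_mul_coeffMatrix τ.continuous_toHom σ m j p l g).symm
    exact Finset.sum_congr rfl fun _ _ => mul_comm _ _
  · exact hne (congrFun (congrFun h0 k) i)

/-- By Schur's lemma the intertwining matrix for `j`, `l` is a scalar `c j l`. The adjoint symmetry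
annihilates `c j l` for `j ≠ l` and makes `c j j` independent of `j`; unit columns of `σ` give
`σ.dim * c j j = 1`. -/
theorem coeffMatrix_self (i j k l : Fin σ.dim) :
    coeffMatrix σ.toHom σ i j k l = if k = i ∧ l = j then (σ.dim : ℂ)⁻¹ else 0 := by
  have hcont := σ.continuous_toHom
  have key : ∀ j l, ∃ c : ℂ, ∀ k i, coeffMatrix σ.toHom σ i j k l = if k = i then c else 0 := by
    intro j l
    obtain ⟨c, hc⟩ := σ.eq_smul_one_of_commute
      (Matrix.of fun p m => coeffMatrix σ.toHom σ m j p l) (fun g => by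
        ext p m
        simp only [Matrix.mul_apply, Matrix.of_apply]
        refine Eq.trans ?_ (sum_mul_coeffMatrix hcont σ m j p l g).symm
        exact Finset.sum_congr rfl fun _ _ => mul_comm _ _)
    refine ⟨c, fun k i => ?_⟩
    have := congrFun (congrFun hc k) i
    simpa [Matrix.one_apply] using this
  choose c hc using key
  have hsymm : ∀ i j k l, coeffMatrix σ.toHom σ i j k l = star (coeffMatrix σ.toHom σ j i l k) :=
    fun i j k l => (star_coeffMatrix hcont σ j i l k).symm
  have hoff : ∀ j l, j ≠ l → c j l = 0 := by
    intro j l hjl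
    have h1 := hsymm j j j l
    rw [hc, hc, if_pos rfl, if_neg hjl.symm, star_zero] at h1
    exact h1
  have hdiag : ∀ i j, c i i = c j j := by
    intro i j
    have h1 := hsymm i j i j
    have h2 := star_coeffMatrix hcont σ i i i i
    rw [hc, hc, if_pos rfl, if_pos rfl] at h1
    rw [hc, if_pos rfl] at h2
    rw [h1, h2]
  have hsum : ∀ j, (σ.dim : ℂ) * c j j = 1 := by
    intro j
    have h1 : ∑ k, coeffMatrix σ.toHom σ k j k j = 1 := by
      have hc' := σ.continuous_mat_apply
      have hc'' := continuous_coe_apply hcont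
      simp only [coeffMatrix, Matrix.of_apply]
      rw [← haarIntegral_sum _ fun p _ => by fun_prop]
      simp only [Irrep.mat, sum_star_mul_coe_map, haarIntegral_const]
    simpa [hc] using h1
  rw [hc]
  by_cases hki : k = i
  · by_cases hlj : l = j
    · subst hlj
      simp only [hki, if_true, and_self]
      exact (inv_eq_of_mul_eq_one_right (hsum l)).symm
    · simp [hlj, hoff j l (Ne.symm hlj)]
  · simp [hki]

include hU in
-- Integrate `sum_mul_coeffMatrix` against a conjugate entry of `τ`. Products of coefficient
-- matrices of any `U` are thereby reduced to orthogonality between `σ` and `τ`.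
theorem sum_coeffMatrix_mul_coeffMatrix (a b : Fin τ.dim) (i j : Fin σ.dim) (k l : n) :
    ∑ p, coeffMatrix U τ a b k p * coeffMatrix U σ i j p l =
      ∑ m, coeffMatrix σ.toHom τ a b m i * coeffMatrix U σ m j k l := by
  have hc := continuous_coe_apply hU
  have hc' := σ.continuous_mat_apply
  have hc'' := τ.continuous_mat_apply
  have hc3 := continuous_coe_apply σ.continuous_toHom
  have h1 : ∀ p, coeffMatrix U τ a b k p * coeffMatrix U σ i j p l =
      haarIntegral fun t => (U t).1 k p * coeffMatrix U σ i j p l * star (τ.mat t a b) := by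
    intro p
    rw [coeffMatrix, Matrix.of_apply, ← haarIntegral_mul_const]
    congr 1; funext t; ring
  have h2 : ∀ m, coeffMatrix σ.toHom τ a b m i * coeffMatrix U σ m j k l =
      haarIntegral fun t => σ.mat t m i * coeffMatrix U σ m j k l * star (τ.mat t a b) := by
    intro m
    rw [coeffMatrix, Matrix.of_apply, ← haarIntegral_mul_const]
    congr 1; funext t; simp only [Irrep.mat]; ring
  simp only [h1, h2]
  rw [← haarIntegral_sum _ fun p _ => by fun_prop, ← haarIntegral_sum _ fun p _ => by fun_prop]
  congr 1
  funext t
  rw [← Finset.sum_mul, ← Finset.sum_mul, sum_mul_coeffMatrix hU]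

end Schur

/-! ### Fourier norms of coefficient functions -/

section Coefficients

variable {G : Type u} [Group G] [TopologicalSpace G] [IsTopologicalGroup G] [CompactSpace G]
variable {n : Type*} [Fintype n] [DecidableEq n]
  {U : G →* Matrix.unitaryGroup n ℂ} (hU : Continuous U)

include hU in
theorem conjTranspose_coeffMatrix (σ : Irrep G) (i j : Fin σ.dim) :
    (coeffMatrix U σ i j)ᴴ = coeffMatrix U σ j i := by
  ext k l
  exact star_coeffMatrix hU σ i j l k

include hU in
-- After multiplication by `σ.dim` these are the relations of matrix units.
theorem coeffMatrix_mul_coeffMatrix (σ : Irrep G) (a b i j : Fin σ.dim) :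
    coeffMatrix U σ a b * coeffMatrix U σ i j =
      if i = b then (σ.dim : ℂ)⁻¹ • coeffMatrix U σ a j else 0 := by
  ext k l
  rw [Matrix.mul_apply, sum_coeffMatrix_mul_coeffMatrix hU]
  simp only [coeffMatrix_self, ite_and, ite_mul, zero_mul]
  rw [Finset.sum_ite_eq' Finset.univ a, if_pos (Finset.mem_univ _)]
  split_ifs <;> simp

include hU in
theorem coeffMatrix_mul_coeffMatrix_of_ne {π ρ : UnitaryDual G} (h : π ≠ ρ)
    (a b : Fin π.repr.dim) (i j : Fin ρ.repr.dim) :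
    coeffMatrix U π.repr a b * coeffMatrix U ρ.repr i j = 0 := by
  ext k l
  rw [Matrix.mul_apply, sum_coeffMatrix_mul_coeffMatrix hU]
  simp [coeffMatrix_of_not_equiv _ _ (mt UnitaryDual.nonempty_equiv_iff.mp h)]

include hU in
/-- The isotypic projections satisfy Bessel's inequality. -/
theorem sum_norm_coeffMatrix_sq_le (S : Finset (UnitaryDual G)) (x : EuclideanSpace ℂ n) :
    ∑ π ∈ S, (π.repr.dim : ℝ) ^ 2 *
      ∑ i, ‖Matrix.toEuclideanCLM (𝕜 := ℂ) (coeffMatrix U π.repr 0 i) x‖ ^ 2 ≤ ‖x‖ ^ 2 := by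
  -- `P π` is the orthogonal projection onto the `π`-isotypic part of `U`; these projections are
  -- mutually orthogonal.
  set P : UnitaryDual G → Matrix n n ℂ :=
    fun π => (π.repr.dim : ℂ) • ∑ i, coeffMatrix U π.repr i i with hP
  have hd : ∀ π : UnitaryDual G, (π.repr.dim : ℂ) ≠ 0 := fun π =>
    Nat.cast_ne_zero.mpr (NeZero.ne _)
  have hPstar : ∀ π, (P π)ᴴ = P π := fun π => by
    simp [hP, Matrix.conjTranspose_sum, conjTranspose_coeffMatrix hU]
  have hPmul : ∀ π, P π * P π = P π := fun π => by
    simp only [hP, Matrix.smul_mul, Matrix.mul_smul, Finset.sum_mul, Finset.mul_sum,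
      coeffMatrix_mul_coeffMatrix hU, Finset.sum_ite_eq, Finset.mem_univ, if_true]
    simp [Finset.smul_sum, hd]
  have hPne : ∀ π ρ, π ≠ ρ → P π * P ρ = 0 := fun π ρ h => by
    simp [hP, Finset.sum_mul, Finset.mul_sum, coeffMatrix_mul_coeffMatrix_of_ne hU h]
  set Q := ∑ π ∈ S, P π with hQ
  have hQstar : star Q = Q := by
    simp [hQ, Matrix.star_eq_conjTranspose, hPstar]
  have hQmul : Q * Q = Q := by
    rw [hQ, Finset.sum_mul]
    refine Finset.sum_congr rfl fun π hπ => ?_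
    rw [Finset.mul_sum, Finset.sum_eq_single π (fun ρ _ h => hPne π ρ h.symm) (fun h => (h hπ).elim),
      hPmul]
  set T := Matrix.toEuclideanCLM (𝕜 := ℂ) (n := n) with hT
  have hadj : ∀ (M : Matrix n n ℂ) (y z), inner ℂ (T M y) z = inner ℂ y (T Mᴴ z) := by
    intro M y z
    rw [← Matrix.star_eq_conjTranspose, map_star, ContinuousLinearMap.star_eq_adjoint,
      ContinuousLinearMap.adjoint_inner_right]
  have hnorm : ((‖T Q x‖ ^ 2 : ℝ) : ℂ) = inner ℂ x (T Q x) := by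
    have h := inner_self_eq_norm_sq_to_K (𝕜 := ℂ) (T Q x)
    rw [hadj, ← Matrix.star_eq_conjTranspose, hQstar, ← mul_apply_eq_comp, ← map_mul,
      hQmul] at h
    rw [h]
    simp
  have hle : ‖T Q x‖ ≤ ‖x‖ := by
    have h := norm_inner_le_norm (𝕜 := ℂ) x (T Q x)
    rw [← hnorm, Complex.norm_real, Real.norm_of_nonneg (sq_nonneg _), sq] at h
    by_contra hlt
    push Not at hlt
    nlinarith [norm_nonneg x]
  -- Write `C i j` for `coeffMatrix U π.repr i j`. From `(C 0 i)ᴴ * C 0 i = d⁻¹ • C i i` the inner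
  -- sum times `d ^ 2` equals `⟪x, P π x⟫`.
  have hsum : ((∑ π ∈ S, (π.repr.dim : ℝ) ^ 2 *
      ∑ i, ‖T (coeffMatrix U π.repr 0 i) x‖ ^ 2 : ℝ) : ℂ) = inner ℂ x (T Q x) := by
    rw [hQ, map_sum, sum_apply, inner_sum, Complex.ofReal_sum]
    refine Finset.sum_congr rfl fun π _ => ?_
    rw [hP, map_smul, map_sum, smul_apply, sum_apply,
      inner_smul_right, inner_sum, Complex.ofReal_mul, Complex.ofReal_sum, Finset.mul_sum,
      Finset.mul_sum]
    refine Finset.sum_congr rfl fun i _ => ?_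
    have h := inner_self_eq_norm_sq_to_K (𝕜 := ℂ) (T (coeffMatrix U π.repr 0 i) x)
    rw [hadj, conjTranspose_coeffMatrix hU, ← mul_apply_eq_comp, ← map_mul,
      coeffMatrix_mul_coeffMatrix hU, if_pos rfl, map_smul, smul_apply,
      inner_smul_right] at h
    have h' : ((‖T (coeffMatrix U π.repr 0 i) x‖ ^ 2 : ℝ) : ℂ) =
        (π.repr.dim : ℂ)⁻¹ * inner ℂ x (T (coeffMatrix U π.repr i i) x) := by
      rw [h]; simp
    rw [h']
    push_cast
    field_simp [hd π]
  have : ∑ π ∈ S, (π.repr.dim : ℝ) ^ 2 * ∑ i, ‖T (coeffMatrix U π.repr 0 i) x‖ ^ 2 =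
      ‖T Q x‖ ^ 2 := by
    have := hsum.trans hnorm.symm
    exact_mod_cast this
  rw [this]
  gcongr

/-- The function `t ↦ ⟪η, U t ξ⟫`. -/
def coeffFun (hU : Continuous U) (ξ η : EuclideanSpace ℂ n) : C(G, ℂ) where
  toFun t := ∑ k, ∑ l, star (η k) * (U t).1 k l * ξ l
  continuous_toFun := by
    have := continuous_coe_apply hU
    fun_prop

theorem fourierCoeff_coeffFun (ξ η : EuclideanSpace ℂ n) (π : UnitaryDual G)
    (i j : Fin π.repr.dim) :
    fourierCoeff (coeffFun hU ξ η) π i j =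
      inner ℂ η (Matrix.toEuclideanCLM (𝕜 := ℂ) (coeffMatrix U π.repr i j) ξ) := by
  have hc := continuous_coe_apply hU
  have hc' := π.repr.continuous_mat_apply
  have h : ∀ k l, star (η k) * coeffMatrix U π.repr i j k l * ξ l = haarIntegral fun t =>
      star (η k) * (U t).1 k l * ξ l * star (π.repr.mat t i j) := by
    intro k l
    rw [coeffMatrix, Matrix.of_apply, ← haarIntegral_const_mul, ← haarIntegral_mul_const]
    congr 1; funext t; ring
  have hR : inner ℂ η (Matrix.toEuclideanCLM (𝕜 := ℂ) (coeffMatrix U π.repr i j) ξ) =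
      ∑ k, ∑ l, star (η k) * coeffMatrix U π.repr i j k l * ξ l := by
    simp only [PiLp.inner_apply, RCLike.inner_apply, Matrix.ofLp_toEuclideanCLM, Matrix.mulVec,
      dotProduct, Finset.sum_mul, starRingEnd_apply]
    exact Finset.sum_congr rfl fun _ _ => Finset.sum_congr rfl fun _ _ => by ring
  rw [hR]
  simp only [h, fourierCoeff, coeffFun, ContinuousMap.coe_mk, Matrix.of_apply, Finset.sum_mul]
  rw [haarIntegral_sum _ fun k _ => by fun_prop]
  exact Finset.sum_congr rfl fun k _ => haarIntegral_sum _ fun l _ => by fun_prop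

/-- The matrix-unit relations turn `⟪η, C i j ξ⟫` into `d * ⟪C 0 i η, C 0 j ξ⟫`. Expanding this
inner product in coordinates writes the Fourier coefficient as a sum of matrices of rank one, and
Cauchy–Schwarz over the coordinates bounds its trace norm. -/
theorem dim_mul_traceNorm_coeffFun_le (ξ η : EuclideanSpace ℂ n) (π : UnitaryDual G) :
    π.repr.dim * traceNorm (fourierCoeff (coeffFun hU ξ η) π) ≤
      √((π.repr.dim : ℝ) ^ 2 *
        ∑ i, ‖Matrix.toEuclideanCLM (𝕜 := ℂ) (coeffMatrix U π.repr 0 i) η‖ ^ 2) *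
      √((π.repr.dim : ℝ) ^ 2 *
        ∑ i, ‖Matrix.toEuclideanCLM (𝕜 := ℂ) (coeffMatrix U π.repr 0 i) ξ‖ ^ 2) := by
  set d := π.repr.dim with hd
  have hd0 : (d : ℂ) ≠ 0 := Nat.cast_ne_zero.mpr (NeZero.ne _)
  set A := fun i j => Matrix.toEuclideanCLM (𝕜 := ℂ) (coeffMatrix U π.repr i j) with hA
  set x : n → EuclideanSpace ℂ (Fin d) := fun p => WithLp.toLp 2 fun i => star (A 0 i η p)
  set y : n → EuclideanSpace ℂ (Fin d) := fun p => WithLp.toLp 2 fun i => star (A 0 i ξ p)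
  have hdecomp : ∀ i j, fourierCoeff (coeffFun hU ξ η) π i j =
      ∑ p, ((d : ℂ) • x p) i * star (y p j) := by
    intro i j
    have h1 : coeffMatrix U π.repr i j =
        (d : ℂ) • ((coeffMatrix U π.repr 0 i)ᴴ * coeffMatrix U π.repr 0 j) := by
      rw [conjTranspose_coeffMatrix hU, coeffMatrix_mul_coeffMatrix hU, if_pos rfl, smul_smul,
        mul_inv_cancel₀ hd0, one_smul]
    rw [fourierCoeff_coeffFun, h1, map_smul, map_mul, smul_apply,
      inner_smul_right, mul_apply_eq_comp, ← Matrix.star_eq_conjTranspose, map_star,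
      ContinuousLinearMap.star_eq_adjoint, ContinuousLinearMap.adjoint_inner_right]
    simp only [PiLp.inner_apply, RCLike.inner_apply, Finset.mul_sum, PiLp.smul_apply, smul_eq_mul,
      x, y, star_star, starRingEnd_apply, hA]
    exact Finset.sum_congr rfl fun _ _ => by ring
  have hx : ∀ z : EuclideanSpace ℂ n,
      ∑ p, ‖(WithLp.toLp 2 fun i => star (A 0 i z p) : EuclideanSpace ℂ (Fin d))‖ ^ 2 =
        ∑ i, ‖A 0 i z‖ ^ 2 := by
    intro z
    simp only [EuclideanSpace.norm_sq_eq, norm_star]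
    exact Finset.sum_comm
  have h2 : ∑ p, ‖x p‖ * ‖y p‖ ≤ √(∑ i, ‖A 0 i η‖ ^ 2) * √(∑ i, ‖A 0 i ξ‖ ^ 2) := by
    rw [← hx, ← hx]
    exact Real.sum_mul_le_sqrt_mul_sqrt _ _ _
  rw [Real.sqrt_mul (sq_nonneg _), Real.sqrt_mul (sq_nonneg _), Real.sqrt_sq (Nat.cast_nonneg _)]
  calc (d : ℝ) * traceNorm (fourierCoeff (coeffFun hU ξ η) π)
      ≤ d * ∑ p, ‖(d : ℂ) • x p‖ * ‖y p‖ := by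
        gcongr
        exact traceNorm_le_of_decomposition Finset.univ _ y hdecomp
    _ = d * d * ∑ p, ‖x p‖ * ‖y p‖ := by
        simp [norm_smul, Finset.mul_sum, mul_assoc]
    _ ≤ d * d * (√(∑ i, ‖A 0 i η‖ ^ 2) * √(∑ i, ‖A 0 i ξ‖ ^ 2)) := by gcongr
    _ = _ := by ring

/-- Cauchy–Schwarz over the classes, then Bessel's inequality for `ξ` and for `η`. -/
theorem sum_dim_mul_traceNorm_coeffFun_le (ξ η : EuclideanSpace ℂ n)
    (S : Finset (UnitaryDual G)) :
    ∑ π ∈ S, π.repr.dim * traceNorm (fourierCoeff (coeffFun hU ξ η) π) ≤ ‖ξ‖ * ‖η‖ := by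
  refine (Finset.sum_le_sum fun π _ => dim_mul_traceNorm_coeffFun_le hU ξ η π).trans ?_
  refine (Real.sum_sqrt_mul_sqrt_le S (fun π => ?_) (fun π => ?_)).trans ?_
  · positivity
  · positivity
  · rw [mul_comm ‖ξ‖]
    refine mul_le_mul ?_ ?_ (Real.sqrt_nonneg _) (norm_nonneg _) <;>
    exact Real.sqrt_le_iff.mpr ⟨norm_nonneg _, sum_norm_coeffMatrix_sq_le hU S _⟩

theorem fourierNorm_coeffFun_le (ω : UnitaryDual G → ℝ) (ξ η : EuclideanSpace ℂ n) {K : ℝ}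
    (hK0 : 0 ≤ K) (hK : ∀ π, fourierCoeff (coeffFun hU ξ η) π ≠ 0 → ω π ≤ K) :
    fourierNorm ω (coeffFun hU ξ η) ≤ ENNReal.ofReal (K * (‖ξ‖ * ‖η‖)) := by
  refine ENNReal.summable.tsum_le_of_sum_le fun S => ?_
  have h1 : ∀ π : UnitaryDual G,
      (π.repr.dim : ℝ) * ω π * traceNorm (fourierCoeff (coeffFun hU ξ η) π) ≤
        K * (π.repr.dim * traceNorm (fourierCoeff (coeffFun hU ξ η) π)) := by
    intro π
    by_cases h : fourierCoeff (coeffFun hU ξ η) π = 0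
    · simp [h, traceNorm_zero]
    · have := traceNorm_nonneg (fourierCoeff (coeffFun hU ξ η) π)
      have := hK π h
      calc _ = ω π * (π.repr.dim * traceNorm (fourierCoeff (coeffFun hU ξ η) π)) := by ring
        _ ≤ _ := by gcongr
  calc _ ≤ ∑ π ∈ S, ENNReal.ofReal
        (K * (π.repr.dim * traceNorm (fourierCoeff (coeffFun hU ξ η) π))) :=
        Finset.sum_le_sum fun π _ => ENNReal.ofReal_le_ofReal (h1 π)
    _ = ENNReal.ofReal (∑ π ∈ S,
        K * (π.repr.dim * traceNorm (fourierCoeff (coeffFun hU ξ η) π))) :=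
        (ENNReal.ofReal_sum_of_nonneg fun π _ => mul_nonneg hK0
          (mul_nonneg (Nat.cast_nonneg _) (traceNorm_nonneg _))).symm
    _ ≤ _ := by
        rw [← Finset.mul_sum]
        gcongr
        exact sum_dim_mul_traceNorm_coeffFun_le hU ξ η S

/-- A class that contributes to a coefficient function occurs in the representation. -/
theorem exists_intertwining_of_fourierCoeff_ne_zero {ξ η : EuclideanSpace ℂ n} {π : UnitaryDual G}
    (h : fourierCoeff (coeffFun hU ξ η) π ≠ 0) :
    ∃ X : Matrix n (Fin π.repr.dim) ℂ, X ≠ 0 ∧ ∀ g, X * π.repr.mat g = (U g).1 * X := by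
  have : ∃ i j k l, coeffMatrix U π.repr i j k l ≠ 0 := by
    by_contra! h0
    refine h (Matrix.ext fun i j => ?_)
    have : coeffMatrix U π.repr i j = 0 := Matrix.ext (h0 i j)
    rw [fourierCoeff_coeffFun, this]
    simp
  obtain ⟨i, j, k, l, hne⟩ := this
  refine ⟨Matrix.of fun p m => coeffMatrix U π.repr m j p l,
    fun h0 => hne (congrFun (congrFun h0 k) i), fun g => ?_⟩
  ext p m
  simp only [Matrix.mul_apply, Matrix.of_apply]
  refine Eq.trans ?_ (sum_mul_coeffMatrix hU π.repr m j p l g).symm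
  exact Finset.sum_congr rfl fun _ _ => mul_comm _ _

end Coefficients

/-! ### Compactness of integral operators -/

section CompactOperator

variable {X H : Type*} [TopologicalSpace X] [CompactSpace X] [NormedAddCommGroup H]
  [InnerProductSpace ℂ H]

/-- The operator `u ↦ (x ↦ ⟪κ x, u⟫)`. -/
def innerOperator (κ : C(X, H)) : H →L[ℂ] C(X, ℂ) :=
  LinearMap.mkContinuous
    { toFun := fun u => ⟨fun x => inner ℂ (κ x) u, by fun_prop⟩
      map_add' := fun u v => by ext x; simp
      map_smul' := fun c u => by ext x; simp } ‖κ‖ fun u => by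
    refine (ContinuousMap.norm_le _ (by positivity)).mpr fun x => ?_
    exact (norm_inner_le_norm _ _).trans (by gcongr; exact κ.norm_coe_le_norm x)

/-- Arzelà–Ascoli: the image of the unit ball is bounded by `‖κ‖` and inherits the modulus of
continuity of `κ`. -/
theorem isCompactOperator_innerOperator (κ : C(X, H)) : IsCompactOperator (innerOperator κ) := by
  refine (isCompactOperator_iff_isCompact_closure_image_closedBall (𝕜₁ := ℂ)
    (innerOperator κ).toLinearMap one_pos).mpr ?_
  set A := (innerOperator κ).toLinearMap '' Metric.closedBall 0 1 with hA
  set e := ContinuousMap.isometryEquivBoundedOfCompact X ℂ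
  have h : IsCompact (closure (e '' A)) := by
    refine BoundedContinuousFunction.arzela_ascoli (Metric.closedBall 0 ‖κ‖)
      (isCompact_closedBall _ _) _ ?_ ?_
    · rintro _ x ⟨_, ⟨u, hu, rfl⟩, rfl⟩
      rw [mem_closedBall_zero_iff] at hu ⊢
      refine (norm_inner_le_norm (𝕜 := ℂ) (κ x) u).trans ?_
      calc ‖κ x‖ * ‖u‖ ≤ ‖κ‖ * 1 := by gcongr; exact κ.norm_coe_le_norm x
        _ = ‖κ‖ := mul_one _
    · intro x
      rw [Metric.equicontinuousAt_iff_right]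
      intro ε hε
      filter_upwards [Metric.tendsto_nhds.mp (κ.continuous.continuousAt (x := x)) ε hε] with y hy
      rintro ⟨_, _, ⟨u, hu, rfl⟩, rfl⟩
      rw [mem_closedBall_zero_iff] at hu
      have h1 : inner ℂ (κ x) u - inner ℂ (κ y) u = inner ℂ (κ x - κ y) u :=
        (inner_sub_left _ _ _).symm
      calc dist (inner ℂ (κ x) u) (inner ℂ (κ y) u) = ‖inner ℂ (κ x - κ y) u‖ := by
            rw [dist_eq_norm, h1]
        _ ≤ ‖κ x - κ y‖ * ‖u‖ := norm_inner_le_norm _ _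
        _ ≤ ‖κ x - κ y‖ * 1 := by gcongr
        _ < ε := by rwa [mul_one, ← dist_eq_norm, dist_comm]
  refine e.toHomeomorph.isCompact_image.mp ?_
  rw [e.toHomeomorph.image_closure]
  exact h

end CompactOperator

/-! ### Irreducible subspaces of finite-dimensional invariant subspaces -/

section FiniteDimensional

variable {G : Type u} [Group G] [TopologicalSpace G] {H : Type*} [NormedAddCommGroup H]
  [InnerProductSpace ℂ H]

/-- A finite-dimensional invariant subspace of a continuous unitary representation contains an
irreducible one. -/
theorem exists_irrep_of_invariant (ρ : Representation ℂ G H) (hiso : ∀ g v, ‖ρ g v‖ = ‖v‖)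
    (hcont : ∀ v, Continuous fun g => ρ g v) (V : Submodule ℂ H) [FiniteDimensional ℂ V]
    (hV : V ≠ ⊥) (hinv : ∀ g, ∀ v ∈ V, ρ g v ∈ V) :
    ∃ (π : Irrep G) (e : Fin π.dim → H), (∀ j, e j ∈ V) ∧ Orthonormal ℂ e ∧
      ∀ g j, ρ g (e j) = ∑ i, π.mat g i j • e i := by
  -- A nonzero invariant subspace of least dimension is irreducible.
  obtain ⟨W, ⟨hW0, hWV, hWinv⟩, hmin⟩ := (measure fun W : Submodule ℂ H => Module.finrank ℂ W).wf.has_min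
    {W | W ≠ ⊥ ∧ W ≤ V ∧ ∀ g, ∀ v ∈ W, ρ g v ∈ W} ⟨V, hV, le_rfl, hinv⟩
  have : FiniteDimensional ℂ W := Submodule.finiteDimensional_of_le hWV
  set d := Module.finrank ℂ W
  set b := stdOrthonormalBasis ℂ W
  set e : Fin d → H := fun i => (b i : H) with he
  have heorth : Orthonormal ℂ e := b.orthonormal.comp_linearIsometry W.subtypeₗᵢ
  set M : G → Matrix (Fin d) (Fin d) ℂ := fun g => Matrix.of fun i j => inner ℂ (e i) (ρ g (e j))
    with hM
  have hMe : ∀ g j, ρ g (e j) = ∑ i, M g i j • e i := by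
    intro g j
    have h := b.sum_repr ⟨ρ g (e j), hWinv g _ (b j).2⟩
    have h' := congrArg (W.subtype) h
    rw [map_sum] at h'
    simp only [map_smul, b.repr_apply_apply] at h'
    exact h'.symm
  have hmul : ∀ g h, M (g * h) = M g * M h := by
    intro g h
    ext i j
    have h1 : M (g * h) i j = inner ℂ (e i) (ρ (g * h) (e j)) := rfl
    rw [h1, map_mul, Module.End.mul_apply, hMe h j, map_sum, inner_sum, Matrix.mul_apply]
    refine Finset.sum_congr rfl fun k _ => ?_
    rw [map_smul, inner_smul_right, mul_comm]
    rfl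
  have hinner : ∀ g u v, inner ℂ (ρ g u) (ρ g v) = inner ℂ u v := fun g =>
    (LinearMap.norm_map_iff_inner_map_map (ρ g)).mp (hiso g)
  have hunit : ∀ g, M g ∈ Matrix.unitaryGroup (Fin d) ℂ := by
    intro g
    rw [Matrix.mem_unitaryGroup_iff']
    ext i j
    rw [Matrix.mul_apply, Matrix.one_apply, ← orthonormal_iff_ite.mp heorth i j, ← hinner g,
      hMe g i, hMe g j, heorth.inner_sum]
    rfl
  set U : G →* Matrix.unitaryGroup (Fin d) ℂ :=
    MonoidHom.mk' (fun g => ⟨M g, hunit g⟩) fun g h => Subtype.ext (hmul g h) with hU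
  have hUc : Continuous U := by
    refine Continuous.subtype_mk (continuous_matrix fun i j => ?_) _
    exact continuous_const.inner (hcont (e j))
  set φ : (Fin d → ℂ) →ₗ[ℂ] H := Fintype.linearCombination ℂ e with hφ
  have hφinj : Function.Injective φ := heorth.linearIndependent.fintypeLinearCombination_injective
  have hφρ : ∀ g v, φ (M g *ᵥ v) = ρ g (φ v) := by
    intro g v
    simp only [hφ, Fintype.linearCombination_apply, map_sum, map_smul, hMe, Matrix.mulVec,
      dotProduct, Finset.sum_smul, Finset.smul_sum, smul_smul]
    rw [Finset.sum_comm]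
    simp only [mul_comm]
  have hφW : ∀ v, φ v ∈ W := fun v => by
    rw [hφ, Fintype.linearCombination_apply]
    exact Submodule.sum_mem _ fun i _ => W.smul_mem _ (b i).2
  have hd : 0 < d := Module.finrank_pos_iff.mpr (Submodule.nontrivial_iff_ne_bot.mpr hW0)
  have hirr : (matRep U).IsIrreducible := by
    refine { exists_pair_ne := ⟨⊥, ⊤, fun h => ?_⟩, eq_bot_or_eq_top := fun a => ?_ }
    · have h1 : (Pi.single ⟨0, hd⟩ 1 : Fin d → ℂ) ∈ (⊥ : Subrepresentation (matRep U)) := by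
        rw [h]; trivial
      have h2 : (Pi.single ⟨0, hd⟩ 1 : Fin d → ℂ) = 0 := h1
      simpa using congrFun h2 ⟨0, hd⟩
    · rw [or_iff_not_imp_left]
      intro ha
      have hmem : a.toSubmodule.map φ ∈ {W | W ≠ ⊥ ∧ W ≤ V ∧ ∀ g, ∀ v ∈ W, ρ g v ∈ W} := by
        refine ⟨fun h0 => ha ?_, ?_, ?_⟩
        · refine Subrepresentation.toSubmodule_injective (Submodule.map_injective_of_injective hφinj ?_)
          rw [h0]
          exact Submodule.map_bot φ |>.symm
        · rintro _ ⟨v, _, rfl⟩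
          exact hWV (hφW v)
        · rintro g _ ⟨v, hv, rfl⟩
          exact ⟨_, a.apply_mem_toSubmodule g hv, hφρ g v⟩
      have hle : a.toSubmodule.map φ ≤ W := by
        rintro _ ⟨v, _, rfl⟩
        exact hφW v
      have heq := Submodule.eq_of_le_of_finrank_le hle (not_lt.mp (hmin _ hmem))
      refine Subrepresentation.toSubmodule_injective (eq_top_iff.mpr fun v _ => ?_)
      have h1 : φ v ∈ a.toSubmodule.map φ := by rw [heq]; exact hφW v
      obtain ⟨w, hw, hwv⟩ := h1
      rwa [← hφinj hwv]
  exact ⟨⟨d, U, hUc, hirr⟩, e, fun j => hWV (b j).2, heorth, hMe⟩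

end FiniteDimensional

/-! ### The Peter–Weyl theorem -/

section PeterWeyl

variable {G : Type u} [Group G] [TopologicalSpace G] [IsTopologicalGroup G] [CompactSpace G]
  [MeasurableSpace G] [BorelSpace G]

variable (G) in
/-- The Hilbert space of square integrable functions. -/
abbrev L2 : Type u := Lp ℂ 2 (Measure.haarMeasure (⊤ : TopologicalSpace.PositiveCompacts G))

/-- Translations act continuously on `L^p` only for finite `p`, and the library instance takes this
as a `Fact`. -/
instance : Fact ((2 : ℝ≥0∞) ≠ ∞) := ⟨by norm_num⟩

variable (G) in
/-- The left regular representation. -/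
def leftRegular : Representation ℂ G (L2 G) where
  -- `DomMulAct` acts by precomposition and so reverses products; the inverse restores the order.
  toFun g := DistribSMul.toLinearMap ℂ (L2 G) (DomMulAct.mk g⁻¹)
  map_one' := by ext u : 1; simp
  map_mul' g h := by
    ext u : 1
    simp [mul_smul]

theorem leftRegular_apply (g : G) (u : L2 G) : leftRegular G g u = DomMulAct.mk g⁻¹ • u := rfl

theorem norm_leftRegular (g : G) (u : L2 G) : ‖leftRegular G g u‖ = ‖u‖ :=
  DomMulAct.norm_smul_Lp _ _

theorem continuous_leftRegular (u : L2 G) : Continuous fun g => leftRegular G g u := by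
  simp only [leftRegular_apply]
  fun_prop

/-- The class of a continuous function in `L²`. -/
def contToL2 : C(G, ℂ) →L[ℂ] L2 G :=
  ContinuousMap.toLp 2 _ ℂ

theorem leftRegular_contToL2 (g : G) (f : C(G, ℂ)) :
    leftRegular G g (contToL2 f) = contToL2 ⟨fun t => f (g⁻¹ * t), by fun_prop⟩ := rfl

theorem inner_contToL2 (f g : C(G, ℂ)) :
    inner ℂ (contToL2 f) (contToL2 g) = haarIntegral fun t => star (f t) * g t := by
  rw [haarIntegral_eq, contToL2, ContinuousMap.inner_toLp]
  congr 1; funext t; exact mul_comm _ _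

theorem contToL2_injective : Function.Injective (contToL2 (G := G)) :=
  ContinuousMap.toLp_injective _

/-- Convolution with `f`, as an operator from `L²` to the continuous functions. -/
def convolution (f : C(G, ℂ)) : L2 G →L[ℂ] C(G, ℂ) :=
  innerOperator ⟨fun x => leftRegular G x (contToL2 f), continuous_leftRegular _⟩

theorem convolution_apply (f : C(G, ℂ)) (u : L2 G) (x : G) :
    convolution f u x = inner ℂ (leftRegular G x (contToL2 f)) u := rfl

theorem inner_leftRegular (g : G) (u v : L2 G) :
    inner ℂ (leftRegular G g u) (leftRegular G g v) = inner ℂ u v :=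
  (LinearMap.norm_map_iff_inner_map_map (leftRegular G g)).mp (norm_leftRegular g) u v

theorem convolution_apply' (f : C(G, ℂ)) (u : L2 G) (x : G) :
    convolution f u x = inner ℂ (contToL2 f) (leftRegular G x⁻¹ u) := by
  rw [convolution_apply, ← inner_leftRegular x⁻¹, ← Module.End.mul_apply, ← map_mul]
  simp

/-- This is what makes the eigenspaces of the convolution operator invariant under translations. -/
theorem leftRegular_convolution (f : C(G, ℂ)) (u : L2 G) (g : G) :
    leftRegular G g (contToL2 (convolution f u)) =
      contToL2 (convolution f (leftRegular G g u)) := by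
  rw [leftRegular_contToL2]
  congr 1
  ext x
  rw [ContinuousMap.coe_mk, convolution_apply', convolution_apply', ← Module.End.mul_apply,
    ← map_mul]
  simp

variable [T2Space G]

theorem denseRange_contToL2 : DenseRange (contToL2 (G := G)) :=
  ContinuousMap.toLp_denseRange ℂ _ ℂ ENNReal.ofNat_ne_top

/-- The kernel `star (f (x⁻¹ * y))` is Hermitian, so Fubini gives the symmetry on continuous
functions, which are dense. -/
theorem isSymmetric_convolution {f : C(G, ℂ)} (hf : ∀ x, f x⁻¹ = star (f x)) :
    (contToL2.comp (convolution f)).IsSymmetric := by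
  intro u v
  refine denseRange_contToL2.induction_on₂ (p := fun u v =>
    inner ℂ (contToL2 (convolution f u)) v = inner ℂ u (contToL2 (convolution f v))) ?_ ?_ u v
  · exact isClosed_eq (by fun_prop) (by fun_prop)
  intro a b
  have hconv : ∀ (c : C(G, ℂ)) x, convolution f (contToL2 c) x =
      haarIntegral fun y => star (f (x⁻¹ * y)) * c y := by
    intro c x
    rw [convolution_apply, leftRegular_contToL2, inner_contToL2]
    rfl
  rw [inner_contToL2, inner_contToL2]
  simp only [hconv]
  have h1 : ∀ x, star (haarIntegral fun y => star (f (x⁻¹ * y)) * a y) * b x =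
      haarIntegral fun y => f (x⁻¹ * y) * star (a y) * b x := by
    intro x
    rw [← haarIntegral_star, ← haarIntegral_mul_const]
    simp
  have h2 : ∀ y, star (a y) * haarIntegral (fun x => star (f (y⁻¹ * x)) * b x) =
      haarIntegral fun x => f (x⁻¹ * y) * star (a y) * b x := by
    intro y
    rw [← haarIntegral_const_mul]
    congr 1; funext x
    rw [← hf]
    simp only [mul_inv_rev, inv_inv]
    ring
  simp only [h1, h2]
  refine haarIntegral_swap ?_
  simp only [Function.uncurry_def]
  fun_prop

/-- Convolution with `f` is a compact symmetric operator commuting with translations. An eigenspace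
for `μ ≠ 0` would be finite-dimensional and contain an irreducible invariant subspace. Convolution
maps a basis of it to combinations of conjugated matrix coefficients, to which `f` is orthogonal; so
`f` is orthogonal to the basis vectors, their convolutions vanish, and `μ = 0`. Hence the operator
is zero, and its value on `f` at the unit is the squared `L²` norm of `f`. -/
theorem eq_zero_of_haarIntegral_mul_irrep_of_selfAdjoint {f : C(G, ℂ)}
    (hf : ∀ x, f x⁻¹ = star (f x))
    (h : ∀ (π : Irrep G) (i j : Fin π.dim), haarIntegral (fun t => f t * π.mat t i j) = 0) :
    f = 0 := by
  set T := contToL2.comp (convolution f) with hT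
  have hcomp : IsCompactOperator T := (isCompactOperator_innerOperator _).clm_comp contToL2
  have hsymm : T.IsSymmetric := isSymmetric_convolution hf
  have hzero : T = 0 := by
    rw [← ContinuousLinearMap.eq_zero_of_forall_hasEigenvalue_eq_zero hcomp hsymm]
    intro μ hμ
    by_contra hμ0
    have := ContinuousLinearMap.finite_dimensional_eigenspace hcomp μ hμ0
    obtain ⟨π, e, heV, heo, heρ⟩ := exists_irrep_of_invariant (leftRegular G) norm_leftRegular
      continuous_leftRegular (Module.End.eigenspace T.toLinearMap μ) hμ (fun g v hv => by
        rw [Module.End.mem_eigenspace_iff] at hv ⊢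
        rw [← map_smul, ← hv]
        exact (leftRegular_convolution f v g).symm)
    have heT : ∀ j, contToL2 (convolution f (e j)) = μ • e j := fun j =>
      Module.End.mem_eigenspace_iff.mp (heV j)
    have hconv : ∀ j x, convolution f (e j) x =
        ∑ i, inner ℂ (contToL2 f) (e i) * star (π.mat x j i) := by
      intro j x
      rw [convolution_apply', heρ, inner_sum]
      refine Finset.sum_congr rfl fun i _ => ?_
      rw [inner_smul_right, Irrep.mat, coe_map_inv_apply, mul_comm]
      rfl
    have horth : ∀ j, inner ℂ (contToL2 f) (e j) = 0 := by
      intro j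
      have h1 : inner ℂ (contToL2 f) (contToL2 (convolution f (e j))) = 0 := by
        rw [inner_contToL2]
        simp only [hconv, Finset.mul_sum]
        have hc := π.continuous_mat_apply
        rw [haarIntegral_sum _ fun i _ => by fun_prop]
        refine Finset.sum_eq_zero fun i _ => ?_
        have h2 : (fun t => star (f t) * (inner ℂ (contToL2 f) (e i) * star (π.mat t j i))) =
            fun t => inner ℂ (contToL2 f) (e i) * star (f t * π.mat t j i) := by
          funext t; rw [star_mul]; ring
        rw [h2, haarIntegral_const_mul, haarIntegral_star, h, star_zero, mul_zero]
      rw [heT, inner_smul_right] at h1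
      exact (mul_eq_zero.mp h1).resolve_left hμ0
    have h0 : convolution f (e 0) = 0 := by
      ext x
      simp [hconv, horth]
    have h1 := heT 0
    rw [h0, map_zero] at h1
    exact heo.ne_zero 0 ((smul_eq_zero.mp h1.symm).resolve_left hμ0)
  have h1 : contToL2 (convolution f (contToL2 f)) = 0 := congrArg (fun S => S (contToL2 f)) hzero
  have h2 : convolution f (contToL2 f) = 0 := contToL2_injective (h1.trans (map_zero _).symm)
  have h3 := congrArg (fun k : C(G, ℂ) => k 1) h2
  simp only [convolution_apply, map_one, Module.End.one_apply, ContinuousMap.zero_apply] at h3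
  exact contToL2_injective ((inner_self_eq_zero.mp h3).trans (map_zero _).symm)

end PeterWeyl

section PeterWeyl

variable {G : Type u} [Group G] [TopologicalSpace G] [IsTopologicalGroup G] [CompactSpace G]
  [T2Space G]

/-- With `g x = star (f x⁻¹)`, both `f + g` and `I • (f - g)` are self-adjoint for convolution and
satisfy the same orthogonality. -/
theorem eq_zero_of_haarIntegral_mul_irrep {f : C(G, ℂ)}
    (h : ∀ (π : Irrep G) (i j : Fin π.dim), haarIntegral (fun t => f t * π.mat t i j) = 0) :
    f = 0 := by
  borelize G
  set g : C(G, ℂ) := ⟨fun x => star (f x⁻¹), by fun_prop⟩ with hg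
  have hgx : ∀ x, g x = star (f x⁻¹) := fun _ => rfl
  have h' : ∀ (π : Irrep G) (i j : Fin π.dim), haarIntegral (fun t => g t * π.mat t i j) = 0 := by
    intro π i j
    have hc := π.continuous_mat_apply
    rw [← haarIntegral_inv (by fun_prop), ← star_eq_zero, ← haarIntegral_star, ← h π j i]
    congr 1; funext t
    rw [hgx, inv_inv, Irrep.mat, coe_map_inv_apply, star_mul, star_star, star_star, mul_comm]
    rfl
  have h1 : f + g = 0 := by
    refine eq_zero_of_haarIntegral_mul_irrep_of_selfAdjoint (fun x => ?_) fun π i j => ?_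
    · simp [hgx, add_comm]
    · have hc := π.continuous_mat_apply
      simp only [ContinuousMap.add_apply, add_mul]
      rw [haarIntegral_add (by fun_prop) (by fun_prop), h, h', add_zero]
  have h2 : Complex.I • (f - g) = 0 := by
    refine eq_zero_of_haarIntegral_mul_irrep_of_selfAdjoint (fun x => ?_) fun π i j => ?_
    · simp [hgx]
      ring
    · have hc := π.continuous_mat_apply
      simp only [ContinuousMap.smul_apply, ContinuousMap.sub_apply, smul_eq_mul, mul_assoc, sub_mul]
      rw [haarIntegral_const_mul, haarIntegral_sub (by fun_prop) (by fun_prop), h, h', sub_zero,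
        mul_zero]
  have h3 := (smul_eq_zero.mp h2).resolve_left Complex.I_ne_zero
  have h4 : (2 : ℂ) • f = 0 := by
    rw [two_smul]
    calc f + f = (f + g) + (f - g) := by abel
      _ = 0 := by rw [h1, h3, add_zero]
  exact (smul_eq_zero.mp h4).resolve_left two_ne_zero

/-- Uniqueness of Fourier coefficients. -/
theorem eq_zero_of_fourierCoeff_eq_zero {f : C(G, ℂ)} (h : ∀ π, fourierCoeff f π = 0) : f = 0 := by
  -- Fourier coefficients involve conjugated entries, so the criterion is applied to `star f`.
  -- Unitary equivalence passes from the chosen representative to any other.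
  have hs : (star f : C(G, ℂ)) = 0 := by
    refine eq_zero_of_haarIntegral_mul_irrep fun ρ i j => ?_
    set π : UnitaryDual G := Quotient.mk (irrepSetoid G) ρ
    obtain ⟨A, -, -, hA⟩ := Irrep.exists_unitary_of_equiv (π := π.repr) (ρ := ρ)
      (Quotient.mk_out (s := irrepSetoid G) ρ)
    have hc := π.repr.continuous_mat_apply
    have hz : ∀ k l, haarIntegral (fun t => star (f t) * π.repr.mat t k l) = 0 := by
      intro k l
      rw [← star_eq_zero, ← haarIntegral_star]
      refine Eq.trans ?_ (congrFun (congrFun (h π) k) l)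
      simp only [star_mul, star_star, fourierCoeff, Matrix.of_apply]
      congr 1; funext t; exact mul_comm _ _
    simp only [hA, Matrix.mul_apply, Finset.sum_mul, Finset.mul_sum]
    rw [haarIntegral_sum _ fun k _ => by fun_prop]
    refine Finset.sum_eq_zero fun k _ => ?_
    rw [haarIntegral_sum _ fun k _ => by fun_prop]
    refine Finset.sum_eq_zero fun l _ => ?_
    have h2 : (fun t => (star f) t * (A i l * π.repr.mat t l k * Aᴴ k j)) =
        fun t => (A i l * Aᴴ k j) * (star (f t) * π.repr.mat t l k) := by
      funext t
      rw [ContinuousMap.star_apply]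
      ring
    rw [h2, haarIntegral_const_mul, hz, mul_zero]
  rw [← star_star f, hs, star_zero]

end PeterWeyl

/-! ### Fourier series of functions of finite norm -/

section Expansion

variable {G : Type u} [Group G] [TopologicalSpace G]

section Unitary

variable {n : Type*} [Fintype n] [DecidableEq n] {U : G →* Matrix.unitaryGroup n ℂ}
  (hU : Continuous U)

theorem coeffFun_apply (ξ η : EuclideanSpace ℂ n) (t : G) :
    coeffFun hU ξ η t = ∑ k, ∑ l, star (η k) * (U t).1 k l * ξ l := rfl

theorem norm_coeffFun_apply_le (ξ η : EuclideanSpace ℂ n) (t : G) :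
    ‖coeffFun hU ξ η t‖ ≤ ‖ξ‖ * ‖η‖ := by
  set T := Matrix.toEuclideanCLM (𝕜 := ℂ) (U t).1
  have h1 : coeffFun hU ξ η t = inner ℂ η (T ξ) := by
    simp only [coeffFun_apply, T, PiLp.inner_apply, RCLike.inner_apply, Matrix.ofLp_toEuclideanCLM,
      Matrix.mulVec, dotProduct, Finset.sum_mul, starRingEnd_apply]
    exact Finset.sum_congr rfl fun _ _ => Finset.sum_congr rfl fun _ _ => by ring
  have h2 : ‖T ξ‖ = ‖ξ‖ := by
    have h3 : star T * T = 1 := by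
      rw [← map_star, ← map_mul, Matrix.UnitaryGroup.star_mul_self, map_one]
    have h4 : inner ℂ (T ξ) (T ξ) = inner ℂ ξ ξ := by
      rw [← ContinuousLinearMap.adjoint_inner_right, ← ContinuousLinearMap.star_eq_adjoint,
        ← mul_apply_eq_comp, h3]
      rfl
    rw [@norm_eq_sqrt_re_inner ℂ, @norm_eq_sqrt_re_inner ℂ _ _ _ _ ξ, h4]
  rw [h1, mul_comm, ← h2]
  exact norm_inner_le_norm _ _

end Unitary

theorem Irrep.isContractive_mat (π : Irrep G) (t : G) : IsContractive (π.mat t) := by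
  intro x y
  have h := norm_coeffFun_apply_le π.continuous_toHom (WithLp.toLp 2 fun j => star (y j))
    (WithLp.toLp 2 fun i => star (x i)) t
  have hx : ∀ z : EuclideanSpace ℂ (Fin π.dim),
      ‖(WithLp.toLp 2 fun i => star (z i) : EuclideanSpace ℂ (Fin π.dim))‖ = ‖z‖ := by
    intro z
    simp [EuclideanSpace.norm_eq]
  rw [hx, hx, mul_comm] at h
  refine le_trans (le_of_eq ?_) h
  congr 1
  refine Finset.sum_congr rfl fun i _ => Finset.sum_congr rfl fun j _ => ?_
  simp only [star_star, Irrep.mat]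
  ring

theorem Irrep.norm_mat_apply_le (π : Irrep G) (t : G) (i j : Fin π.dim) : ‖π.mat t i j‖ ≤ 1 := by
  have h := π.isContractive_mat t (EuclideanSpace.single i 1) (EuclideanSpace.single j 1)
  simpa [Pi.single_apply, apply_ite] using h

variable [IsTopologicalGroup G] [CompactSpace G]

/-- An entry of a Fourier coefficient, as a functional. -/
def fourierCoeffCLM (π : UnitaryDual G) (i j : Fin π.repr.dim) : C(G, ℂ) →L[ℂ] ℂ :=
  LinearMap.mkContinuous
    { toFun := fun f => fourierCoeff f π i j
      map_add' := fun f g => by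
        have := π.repr.continuous_mat_apply
        simp only [fourierCoeff, Matrix.of_apply, ContinuousMap.add_apply, add_mul]
        exact haarIntegral_add (by fun_prop) (by fun_prop)
      map_smul' := fun c f => by
        simp only [fourierCoeff, Matrix.of_apply, ContinuousMap.smul_apply, smul_eq_mul, mul_assoc,
          haarIntegral_const_mul, RingHom.id_apply] } 1 fun f => by
    refine norm_haarIntegral_le fun t => ?_
    rw [norm_mul, norm_star, one_mul]
    calc _ ≤ ‖f‖ * 1 := by
          gcongr
          exacts [f.norm_coe_le_norm t, π.repr.norm_mat_apply_le t i j]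
      _ = ‖f‖ := mul_one _

theorem fourierCoeffCLM_apply (π : UnitaryDual G) (i j : Fin π.repr.dim) (f : C(G, ℂ)) :
    fourierCoeffCLM π i j f = fourierCoeff f π i j := rfl

theorem fourierCoeff_smul (c : ℂ) (f : C(G, ℂ)) (π : UnitaryDual G) :
    fourierCoeff (c • f) π = c • fourierCoeff f π := by
  ext i j
  exact map_smul (fourierCoeffCLM π i j) c f

theorem fourierCoeff_sub (f g : C(G, ℂ)) (π : UnitaryDual G) :
    fourierCoeff (f - g) π = fourierCoeff f π - fourierCoeff g π := by
  ext i j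
  exact map_sub (fourierCoeffCLM π i j) f g

theorem fourierNorm_smul (ω : UnitaryDual G → ℝ) (c : ℂ) (f : C(G, ℂ)) :
    fourierNorm ω (c • f) = ENNReal.ofReal ‖c‖ * fourierNorm ω f := by
  rw [fourierNorm, fourierNorm, ← ENNReal.tsum_mul_left]
  refine tsum_congr fun π => ?_
  rw [fourierCoeff_smul, traceNorm_smul, ← ENNReal.ofReal_mul (norm_nonneg _)]
  congr 1
  ring

/-- Countable subadditivity of the Fourier norm along uniformly convergent series. -/
theorem fourierNorm_le_tsum {ω : UnitaryDual G → ℝ} (hω : ∀ π, 0 ≤ ω π) {ι : Type*}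
    {F : ι → C(G, ℂ)} {f : C(G, ℂ)} (h : HasSum F f) :
    fourierNorm ω f ≤ ∑' k, fourierNorm ω (F k) := by
  simp only [fourierNorm]
  rw [ENNReal.tsum_comm]
  refine ENNReal.tsum_le_tsum fun π => ?_
  have h0 : 0 ≤ π.repr.dim * ω π := mul_nonneg (Nat.cast_nonneg _) (hω π)
  simp only [ENNReal.ofReal_mul h0]
  rw [ENNReal.tsum_mul_left]
  gcongr
  exact ofReal_traceNorm_le_tsum fun i j => (fourierCoeffCLM π i j).hasSum h

theorem fourierNorm_sum_le {ω : UnitaryDual G → ℝ} (hω : ∀ π, 0 ≤ ω π) {ι : Type*} [Fintype ι]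
    (F : ι → C(G, ℂ)) : fourierNorm ω (∑ k, F k) ≤ ∑ k, fourierNorm ω (F k) :=
  (fourierNorm_le_tsum hω (hasSum_fintype F)).trans_eq (tsum_fintype _)

theorem fourierNorm_add_le {ω : UnitaryDual G → ℝ} (hω : ∀ π, 0 ≤ ω π) (f g : C(G, ℂ)) :
    fourierNorm ω (f + g) ≤ fourierNorm ω f + fourierNorm ω g := by
  simpa using fourierNorm_sum_le hω ![f, g]

/-- The component of `f` in the span of the matrix coefficients of `π`. -/
def fourierPiece (f : C(G, ℂ)) (π : UnitaryDual G) : C(G, ℂ) where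
  toFun t := π.repr.dim * ∑ i, ∑ j, fourierCoeff f π i j * π.repr.mat t i j
  continuous_toFun := by
    have := π.repr.continuous_mat_apply
    fun_prop

theorem fourierPiece_apply (f : C(G, ℂ)) (π : UnitaryDual G) (t : G) :
    fourierPiece f π t = π.repr.dim * ∑ i, ∑ j, fourierCoeff f π i j * π.repr.mat t i j := rfl

/-- Trace duality: at each point the piece pairs the Fourier coefficient with a unitary matrix. -/
theorem norm_fourierPiece_le (f : C(G, ℂ)) (π : UnitaryDual G) :
    ‖fourierPiece f π‖ ≤ π.repr.dim * traceNorm (fourierCoeff f π) := by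
  refine (ContinuousMap.norm_le _ (mul_nonneg (Nat.cast_nonneg _) (traceNorm_nonneg _))).mpr
    fun t => ?_
  rw [fourierPiece_apply, norm_mul, Complex.norm_natCast]
  gcongr
  exact (π.repr.isContractive_mat t).norm_le_traceNorm _

/-- The singular value decomposition of the Fourier coefficient. It lets estimates for coefficient
functions pass to pieces with no loss of norm. -/
theorem fourierPiece_eq_sum (f : C(G, ℂ)) (π : UnitaryDual G) :
    ∃ ξ η : Fin π.repr.dim → EuclideanSpace ℂ (Fin π.repr.dim),
      fourierPiece f π =
        ∑ k, (π.repr.dim : ℂ) • coeffFun π.repr.continuous_toHom (ξ k) (η k) ∧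
      ∑ k, ‖ξ k‖ * ‖η k‖ = traceNorm (fourierCoeff f π) := by
  obtain ⟨x, y, h, h'⟩ := exists_rankOne_decomposition (fourierCoeff f π)
  refine ⟨fun k => WithLp.toLp 2 fun j => star (y k j), fun k => WithLp.toLp 2 fun i => star (x k i),
    ?_, ?_⟩
  · ext t
    simp only [fourierPiece_apply, h, ContinuousMap.coe_sum, Finset.sum_apply,
      ContinuousMap.smul_apply, smul_eq_mul, coeffFun_apply, star_star, ← Finset.mul_sum]
    congr 1
    symm
    rw [Finset.sum_comm]
    refine Finset.sum_congr rfl fun i _ => ?_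
    rw [Finset.sum_comm]
    refine Finset.sum_congr rfl fun j _ => ?_
    rw [Finset.sum_mul]
    refine Finset.sum_congr rfl fun k _ => ?_
    simp only [Irrep.mat]
    ring
  · rw [← h']
    refine Finset.sum_congr rfl fun k _ => ?_
    simp [EuclideanSpace.norm_eq, mul_comm]

theorem fourierCoeff_fourierPiece (f : C(G, ℂ)) (π : UnitaryDual G) :
    fourierCoeff (fourierPiece f π) π = fourierCoeff f π := by
  have hd : (π.repr.dim : ℂ) ≠ 0 := Nat.cast_ne_zero.mpr (NeZero.ne _)
  have hc := π.repr.continuous_mat_apply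
  ext k l
  have h1 : ∀ t, fourierPiece f π t * star (π.repr.mat t k l) = ∑ i, ∑ j,
      π.repr.dim * fourierCoeff f π i j * (π.repr.mat t i j * star (π.repr.mat t k l)) := by
    intro t
    simp only [fourierPiece_apply, Finset.mul_sum, Finset.sum_mul]
    exact Finset.sum_congr rfl fun _ _ => Finset.sum_congr rfl fun _ _ => by ring
  have h2 : ∀ i j, haarIntegral (fun t => π.repr.mat t i j * star (π.repr.mat t k l)) =
      if i = k ∧ j = l then (π.repr.dim : ℂ)⁻¹ else 0 := fun i j => coeffMatrix_self π.repr k l i j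
  rw [fourierCoeff, Matrix.of_apply]
  simp only [h1]
  rw [haarIntegral_sum _ fun i _ => by fun_prop]
  simp only [ite_and] at h2
  rw [Finset.sum_eq_single k, haarIntegral_sum _ fun i _ => by fun_prop, Finset.sum_eq_single l]
  · rw [haarIntegral_const_mul, h2, if_pos rfl, if_pos rfl]
    field_simp
  · intro j _ hj
    rw [haarIntegral_const_mul, h2, if_pos rfl, if_neg hj, mul_zero]
  · simp
  · intro i _ hi
    rw [haarIntegral_sum _ fun i _ => by fun_prop]
    refine Finset.sum_eq_zero fun j _ => ?_
    rw [haarIntegral_const_mul, h2, if_neg hi, mul_zero]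
  · simp

theorem fourierCoeff_fourierPiece_of_ne (f : C(G, ℂ)) {π ρ : UnitaryDual G} (h : π ≠ ρ) :
    fourierCoeff (fourierPiece f π) ρ = 0 := by
  have hc := π.repr.continuous_mat_apply
  have hc' := ρ.repr.continuous_mat_apply
  ext k l
  have h1 : ∀ t, fourierPiece f π t * star (ρ.repr.mat t k l) = ∑ i, ∑ j,
      π.repr.dim * fourierCoeff f π i j * (π.repr.mat t i j * star (ρ.repr.mat t k l)) := by
    intro t
    simp only [fourierPiece_apply, Finset.mul_sum, Finset.sum_mul]
    exact Finset.sum_congr rfl fun _ _ => Finset.sum_congr rfl fun _ _ => by ring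
  have h2 : ∀ i j, haarIntegral (fun t => π.repr.mat t i j * star (ρ.repr.mat t k l)) = 0 :=
    fun i j => coeffMatrix_of_not_equiv ρ.repr π.repr
      (mt UnitaryDual.nonempty_equiv_iff.mp h.symm) k l i j
  rw [fourierCoeff, Matrix.of_apply]
  simp only [h1]
  rw [haarIntegral_sum _ fun i _ => by fun_prop]
  refine Finset.sum_eq_zero fun i _ => ?_
  rw [haarIntegral_sum _ fun i _ => by fun_prop]
  refine Finset.sum_eq_zero fun j _ => ?_
  rw [haarIntegral_const_mul, h2, mul_zero]

variable {ω : UnitaryDual G → ℝ} {δ : ℝ} (hδ : 0 < δ) (hω : ∀ π, δ ≤ ω π)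

include hδ hω

theorem summable_dim_mul_traceNorm {f : C(G, ℂ)} (hf : fourierNorm ω f < ∞) :
    Summable fun π : UnitaryDual G => π.repr.dim * ω π * traceNorm (fourierCoeff f π) := by
  have h := ENNReal.summable_toReal hf.ne
  refine h.congr fun π => ENNReal.toReal_ofReal ?_
  exact mul_nonneg (mul_nonneg (Nat.cast_nonneg _) (hδ.le.trans (hω π))) (traceNorm_nonneg _)

theorem norm_fourierPiece_le_weight (f : C(G, ℂ)) (π : UnitaryDual G) :
    ‖fourierPiece f π‖ ≤ δ⁻¹ * (π.repr.dim * ω π * traceNorm (fourierCoeff f π)) := by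
  refine (norm_fourierPiece_le f π).trans ?_
  rw [le_inv_mul_iff₀ hδ]
  have h1 := hω π
  have h2 : 0 ≤ π.repr.dim * traceNorm (fourierCoeff f π) :=
    mul_nonneg (Nat.cast_nonneg _) (traceNorm_nonneg _)
  nlinarith

theorem summable_norm_fourierPiece {f : C(G, ℂ)} (hf : fourierNorm ω f < ∞) :
    Summable fun π => ‖fourierPiece f π‖ :=
  Summable.of_nonneg_of_le (fun _ => norm_nonneg _) (norm_fourierPiece_le_weight hδ hω f)
    ((summable_dim_mul_traceNorm hδ hω hf).mul_left _)

variable [T2Space G]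

/-- As the weight is bounded below, the series converges absolutely in the uniform norm. By
orthogonality its sum has the Fourier coefficients of `f`, and these determine a continuous
function. -/
theorem hasSum_fourierPiece {f : C(G, ℂ)} (hf : fourierNorm ω f < ∞) :
    HasSum (fourierPiece f) f := by
  have hs : Summable (fourierPiece f) := (summable_norm_fourierPiece hδ hω hf).of_norm
  have : (∑' π, fourierPiece f π) - f = 0 := by
    refine eq_zero_of_fourierCoeff_eq_zero fun ρ => ?_
    rw [fourierCoeff_sub, sub_eq_zero]
    ext i j
    rw [← fourierCoeffCLM_apply, ((fourierCoeffCLM ρ i j).hasSum hs.hasSum).tsum_eq.symm,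
      tsum_eq_single ρ]
    · rw [fourierCoeffCLM_apply, fourierCoeff_fourierPiece]
    · intro π h
      rw [fourierCoeffCLM_apply, fourierCoeff_fourierPiece_of_ne f h]
      rfl
  have h := hs.hasSum
  rwa [sub_eq_zero.mp this] at h

theorem ofReal_norm_le_fourierNorm (f : C(G, ℂ)) :
    ENNReal.ofReal (δ * ‖f‖) ≤ fourierNorm ω f := by
  rcases eq_or_ne (fourierNorm ω f) ∞ with h | h
  · simp [h]
  have hf : fourierNorm ω f < ∞ := h.lt_top
  have h1 := (hasSum_fourierPiece hδ hω hf).tsum_eq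
  have h2 := summable_dim_mul_traceNorm hδ hω hf
  have h3 : ‖f‖ ≤ δ⁻¹ * ∑' π : UnitaryDual G, π.repr.dim * ω π * traceNorm (fourierCoeff f π) := by
    rw [← tsum_mul_left]
    conv_lhs => rw [← h1]
    exact tsum_of_norm_bounded (h2.mul_left _).hasSum (norm_fourierPiece_le_weight hδ hω f)
  rw [le_inv_mul_iff₀ hδ] at h3
  refine (ENNReal.ofReal_le_ofReal h3).trans ?_
  rw [ENNReal.ofReal_tsum_of_nonneg (fun π => mul_nonneg (mul_nonneg (Nat.cast_nonneg _)
    (hδ.le.trans (hω π))) (traceNorm_nonneg _)) h2]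
  rfl

end Expansion

/-! ### Products of coefficient functions and tensor products -/

section Kronecker

variable {G : Type u} [Group G]
  {n m : Type*} [Fintype n] [DecidableEq n] [Fintype m] [DecidableEq m]

/-- The tensor product of two unitary matrix representations. -/
def kroneckerHom (U : G →* Matrix.unitaryGroup n ℂ) (V : G →* Matrix.unitaryGroup m ℂ) :
    G →* Matrix.unitaryGroup (n × m) ℂ :=
  MonoidHom.mk' (fun g => ⟨Matrix.kroneckerMap (· * ·) (U g).1 (V g).1,
      Matrix.kronecker_mem_unitary (U g).2 (V g).2⟩) fun g h => Subtype.ext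
    ((congrArg₂ _ (coe_map_mul U g h) (coe_map_mul V g h)).trans
      (Matrix.mul_kronecker_mul _ _ _ _))

theorem kroneckerHom_apply (U : G →* Matrix.unitaryGroup n ℂ) (V : G →* Matrix.unitaryGroup m ℂ)
    (g : G) (i j : n × m) :
    (kroneckerHom U V g).1 i j = (U g).1 i.1 j.1 * (V g).1 i.2 j.2 := rfl

variable [TopologicalSpace G] {U : G →* Matrix.unitaryGroup n ℂ} {V : G →* Matrix.unitaryGroup m ℂ}

theorem continuous_kroneckerHom (hU : Continuous U) (hV : Continuous V) :
    Continuous (kroneckerHom U V) :=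
  Continuous.subtype_mk (continuous_matrix fun _ _ =>
    (continuous_coe_apply hU _ _).mul (continuous_coe_apply hV _ _)) _

theorem coeffFun_mul_coeffFun (hU : Continuous U) (hV : Continuous V)
    (ξ η : EuclideanSpace ℂ n) (ξ' η' : EuclideanSpace ℂ m) :
    coeffFun hU ξ η * coeffFun hV ξ' η' =
      coeffFun (continuous_kroneckerHom hU hV) (WithLp.toLp 2 fun p => ξ p.1 * ξ' p.2)
        (WithLp.toLp 2 fun p => η p.1 * η' p.2) := by
  ext t
  simp only [ContinuousMap.mul_apply, coeffFun_apply, Finset.sum_mul_sum, Fintype.sum_prod_type,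
    kroneckerHom_apply]
  refine Finset.sum_congr rfl fun k _ => Finset.sum_congr rfl fun k' _ => ?_
  refine Finset.sum_congr rfl fun l _ => Finset.sum_congr rfl fun l' _ => ?_
  rw [star_mul]
  ring

omit [DecidableEq n] [DecidableEq m] in
theorem norm_toLp_mul (ξ : EuclideanSpace ℂ n) (ξ' : EuclideanSpace ℂ m) :
    ‖(WithLp.toLp 2 fun p => ξ p.1 * ξ' p.2 : EuclideanSpace ℂ (n × m))‖ = ‖ξ‖ * ‖ξ'‖ := by
  rw [EuclideanSpace.norm_eq, EuclideanSpace.norm_eq, EuclideanSpace.norm_eq,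
    ← Real.sqrt_mul (Finset.sum_nonneg fun _ _ => sq_nonneg _), Finset.sum_mul_sum,
    Fintype.sum_prod_type]
  simp only [norm_mul, mul_pow]

/-- A matrix intertwining with a Kronecker product shows that `σ` occurs in a tensor product. -/
theorem inSupport_tprod_of_matrix {σ : UnitaryDual G} {π ρ : Irrep G}
    (X : Matrix (Fin π.dim × Fin ρ.dim) (Fin σ.repr.dim) ℂ) (hX : X ≠ 0)
    (h : ∀ g, X * σ.repr.mat g = (kroneckerHom π.toHom ρ.toHom g).1 * X) :
    σ.InSupport (π.rep.tprod ρ.rep) := by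
  set e := ((Pi.basisFun ℂ (Fin π.dim)).tensorProduct (Pi.basisFun ℂ (Fin ρ.dim))).equivFun with he
  have he1 : ∀ v w p, e (v ⊗ₜ[ℂ] w) p = v p.1 * w p.2 := by
    intro v w p
    rw [he, Module.Basis.equivFun_apply, Module.Basis.tensorProduct_repr_tmul_apply]
    simp [mul_comm]
  have hint : ∀ g z, e (π.rep.tprod ρ.rep g z) = (kroneckerHom π.toHom ρ.toHom g).1 *ᵥ e z := by
    intro g z
    induction z using TensorProduct.induction_on with
    | zero => simp
    | add x y hx hy => rw [map_add, map_add, hx, hy, map_add, Matrix.mulVec_add]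
    | tmul v w =>
      ext p
      rw [Representation.tprod_apply, TensorProduct.map_tmul, he1, Irrep.rep_apply, Irrep.rep_apply]
      simp only [Matrix.mulVec, dotProduct, he1, kroneckerHom_apply, Fintype.sum_prod_type,
        Finset.sum_mul_sum, Irrep.mat]
      exact Finset.sum_congr rfl fun _ _ => Finset.sum_congr rfl fun _ _ => by ring
  let T : Representation.IntertwiningMap σ.repr.rep (π.rep.tprod ρ.rep) :=
    { toLinearMap := e.symm.toLinearMap ∘ₗ X.mulVecLin
      isIntertwining' := fun g => LinearMap.ext fun v => e.injective (by
        rw [LinearMap.comp_apply, LinearMap.comp_apply, LinearMap.comp_apply, hint]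
        simp only [LinearEquiv.coe_coe, LinearEquiv.apply_symm_apply, LinearMap.comp_apply,
          Matrix.mulVecLin_apply, Irrep.rep_apply, Matrix.mulVec_mulVec, h]) }
  refine ⟨T, (Representation.IsIrreducible.injective_or_eq_zero T).resolve_right fun h0 => hX ?_⟩
  refine Matrix.ext_of_mulVec_single fun j => ?_
  have h1 : e.symm (X *ᵥ Pi.single j 1) = 0 := congrArg (fun S : Representation.IntertwiningMap
    σ.repr.rep (π.rep.tprod ρ.rep) => S (Pi.single j 1)) h0
  rw [LinearEquiv.map_eq_zero_iff] at h1
  rw [h1, Matrix.zero_mulVec]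

end Kronecker

/-! ### The trivial class -/

section Trivial

variable (G : Type u) [Group G] [TopologicalSpace G]

/-- The trivial representation. -/
def trivialIrrep : Irrep G where
  dim := 1
  toHom := 1
  continuous_toHom := continuous_const
  irreducible := by
    refine { exists_pair_ne := ⟨⊥, ⊤, fun h => ?_⟩, eq_bot_or_eq_top := fun a => ?_ }
    · have h1 : (1 : Fin 1 → ℂ) ∈ (⊥ : Subrepresentation (matRep (1 : G →* _))) := by
        rw [h]; trivial
      have h2 : (1 : Fin 1 → ℂ) = 0 := h1
      simpa using congrFun h2 0
    · rw [or_iff_not_imp_left]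
      intro ha
      have h0 : a.toSubmodule ≠ ⊥ := fun h => ha (Subrepresentation.toSubmodule_injective h)
      obtain ⟨v, hv, hv0⟩ := Submodule.exists_mem_ne_zero_of_ne_bot h0
      refine Subrepresentation.toSubmodule_injective (eq_top_iff.mpr fun w _ => ?_)
      have hv1 : v 0 ≠ 0 := fun h => hv0 (funext fun i => by rwa [Subsingleton.elim i 0])
      have hw : w = (w 0 / v 0) • v := funext fun i => by
        rw [Subsingleton.elim i 0, Pi.smul_apply, smul_eq_mul, div_mul_cancel₀ _ hv1]
      rw [hw]
      exact a.toSubmodule.smul_mem _ hv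

/-- The trivial class. -/
def trivialClass : UnitaryDual G := Quotient.mk (irrepSetoid G) (trivialIrrep G)

end Trivial

/-! ### Submultiplicativity of the weighted Fourier norm -/

section Algebra

variable {G : Type u} [Group G] [TopologicalSpace G]

/-- The class of an irreducible representation. -/
def Irrep.toClass (π : Irrep G) : UnitaryDual G := Quotient.mk (irrepSetoid G) π

theorem Irrep.toClass_eq_iff {π ρ : Irrep G} :
    π.toClass = ρ.toClass ↔ Nonempty (Representation.Equiv π.rep ρ.rep) :=
  Quotient.eq (r := irrepSetoid G)

theorem UnitaryDual.toClass_repr (π : UnitaryDual G) : π.repr.toClass = π :=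
  Quotient.out_eq (s := irrepSetoid G) π

variable [IsTopologicalGroup G] [CompactSpace G]

theorem eq_toClass_of_fourierCoeff_coeffFun_ne_zero {ρ : Irrep G}
    {ξ η : EuclideanSpace ℂ (Fin ρ.dim)} {π : UnitaryDual G}
    (h : fourierCoeff (coeffFun ρ.continuous_toHom ξ η) π ≠ 0) : π = ρ.toClass := by
  obtain ⟨X, hX, hcomm⟩ := exists_intertwining_of_fourierCoeff_ne_zero _ h
  rw [← π.toClass_repr, Irrep.toClass_eq_iff]
  exact Irrep.nonempty_equiv_of_intertwining _ _ X hcomm hX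

theorem fourierNorm_coeffFun_irrep_le {ω : UnitaryDual G → ℝ} (hω : ∀ π, 0 ≤ ω π) (ρ : Irrep G)
    (ξ η : EuclideanSpace ℂ (Fin ρ.dim)) :
    fourierNorm ω (coeffFun ρ.continuous_toHom ξ η) ≤
      ENNReal.ofReal (ω ρ.toClass * (‖ξ‖ * ‖η‖)) :=
  fourierNorm_coeffFun_le _ ω ξ η (hω _) fun π h => by
    rw [eq_toClass_of_fourierCoeff_coeffFun_ne_zero h]

theorem fourierNorm_one_lt_top {ω : UnitaryDual G → ℝ} (hω : ∀ π, 0 ≤ ω π) :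
    fourierNorm ω (1 : C(G, ℂ)) < ∞ := by
  have h := fourierNorm_coeffFun_irrep_le hω (trivialIrrep G)
    (EuclideanSpace.single 0 1 : EuclideanSpace ℂ (Fin 1)) (EuclideanSpace.single 0 1 : EuclideanSpace ℂ (Fin 1))
  have h1 : coeffFun (trivialIrrep G).continuous_toHom
      (EuclideanSpace.single 0 1 : EuclideanSpace ℂ (Fin 1))
      (EuclideanSpace.single 0 1 : EuclideanSpace ℂ (Fin 1)) = 1 := by
    ext t
    change ∑ k : Fin 1, ∑ l : Fin 1, star ((EuclideanSpace.single 0 1 : EuclideanSpace ℂ (Fin 1)) k) *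
      (1 : Matrix (Fin 1) (Fin 1) ℂ) k l * (EuclideanSpace.single 0 1 : EuclideanSpace ℂ (Fin 1)) l = 1
    simp
  rw [h1] at h
  exact h.trans_lt ENNReal.ofReal_lt_top

/-- Both pieces split into coefficient functions, whose products are coefficient functions of the
Kronecker product. Only classes occurring in `π ⊗ ρ` contribute to these, and there the central
inequality bounds the weight by `ω π * ω ρ`. -/
theorem fourierNorm_mul_piece_le {ω : UnitaryDual G → ℝ} (hω : IsCentralWeight ω) (f g : C(G, ℂ))
    (π ρ : UnitaryDual G) :
    fourierNorm ω (fourierPiece f π * fourierPiece g ρ) ≤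
      ENNReal.ofReal (π.repr.dim * ω π * traceNorm (fourierCoeff f π)) *
      ENNReal.ofReal (ρ.repr.dim * ω ρ * traceNorm (fourierCoeff g ρ)) := by
  obtain ⟨δ, hδ, hδω⟩ := hω.exists_lt
  have hω0 : ∀ π, 0 ≤ ω π := fun π => (hδ.trans (hδω π)).le
  obtain ⟨ξ, η, h1, h2⟩ := fourierPiece_eq_sum f π
  obtain ⟨ξ', η', h1', h2'⟩ := fourierPiece_eq_sum g ρ
  have hmul : fourierPiece f π * fourierPiece g ρ = ∑ p : Fin π.repr.dim × Fin ρ.repr.dim,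
      (π.repr.dim * ρ.repr.dim : ℂ) • (coeffFun π.repr.continuous_toHom (ξ p.1) (η p.1) *
        coeffFun ρ.repr.continuous_toHom (ξ' p.2) (η' p.2)) := by
    rw [h1, h1', Finset.sum_mul_sum, Fintype.sum_prod_type]
    simp only [smul_mul_smul_comm]
  have hterm : ∀ k l, fourierNorm ω (coeffFun π.repr.continuous_toHom (ξ k) (η k) *
      coeffFun ρ.repr.continuous_toHom (ξ' l) (η' l)) ≤
      ENNReal.ofReal (ω π * ω ρ * ((‖ξ k‖ * ‖η k‖) * (‖ξ' l‖ * ‖η' l‖))) := by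
    intro k l
    rw [coeffFun_mul_coeffFun]
    refine (fourierNorm_coeffFun_le _ ω _ _ (mul_nonneg (hω0 π) (hω0 ρ)) fun σ hσ => ?_).trans ?_
    · obtain ⟨X, hX, hcomm⟩ := exists_intertwining_of_fourierCoeff_ne_zero _ hσ
      exact hω.le_mul σ π ρ (inSupport_tprod_of_matrix X hX hcomm)
    · rw [norm_toLp_mul, norm_toLp_mul]
      exact le_of_eq (congrArg _ (by ring))
  rw [hmul, ← ENNReal.ofReal_mul (mul_nonneg (mul_nonneg (Nat.cast_nonneg _) (hω0 π))
    (traceNorm_nonneg _))]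
  refine (fourierNorm_sum_le hω0 _).trans ?_
  calc _ ≤ ∑ p : Fin π.repr.dim × Fin ρ.repr.dim, ENNReal.ofReal (π.repr.dim * ρ.repr.dim *
        (ω π * ω ρ * ((‖ξ p.1‖ * ‖η p.1‖) * (‖ξ' p.2‖ * ‖η' p.2‖)))) := by
        refine Finset.sum_le_sum fun p _ => ?_
        rw [fourierNorm_smul, ENNReal.ofReal_mul (by positivity)]
        refine mul_le_mul' (le_of_eq (congrArg _ (by simp))) (hterm _ _)
    _ = ENNReal.ofReal (∑ p : Fin π.repr.dim × Fin ρ.repr.dim, π.repr.dim * ρ.repr.dim *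
        (ω π * ω ρ * ((‖ξ p.1‖ * ‖η p.1‖) * (‖ξ' p.2‖ * ‖η' p.2‖)))) := by
        refine (ENNReal.ofReal_sum_of_nonneg fun p _ => ?_).symm
        have := hω0 π
        have := hω0 ρ
        positivity
    _ = _ := by
        congr 1
        rw [← Finset.mul_sum, ← Finset.mul_sum, Fintype.sum_prod_type, ← h2, ← h2']
        dsimp only
        rw [← Finset.sum_mul_sum]
        ring

variable [T2Space G]

/-- Multiply the two absolutely convergent Fourier series and apply countable subadditivity to the
double series. -/
theorem fourierNorm_mul_le {ω : UnitaryDual G → ℝ} (hω : IsCentralWeight ω) {f g : C(G, ℂ)}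
    (hf : fourierNorm ω f < ∞) (hg : fourierNorm ω g < ∞) :
    fourierNorm ω (f * g) ≤ fourierNorm ω f * fourierNorm ω g := by
  obtain ⟨δ, hδ, hδω⟩ := hω.exists_lt
  have hω0 : ∀ π, 0 ≤ ω π := fun π => (hδ.trans (hδω π)).le
  have hω1 : ∀ π, δ ≤ ω π := fun π => (hδω π).le
  have hfs := summable_norm_fourierPiece hδ hω1 hf
  have hgs := summable_norm_fourierPiece hδ hω1 hg
  have h1 := tsum_mul_tsum_of_summable_norm hfs hgs
  rw [(hasSum_fourierPiece hδ hω1 hf).tsum_eq, (hasSum_fourierPiece hδ hω1 hg).tsum_eq] at h1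
  have h2 : Summable fun p : UnitaryDual G × UnitaryDual G =>
      fourierPiece f p.1 * fourierPiece g p.2 :=
    summable_mul_of_summable_norm hfs hgs
  have hsum : HasSum (fun p : UnitaryDual G × UnitaryDual G =>
      fourierPiece f p.1 * fourierPiece g p.2) (f * g) := by
    rw [h1]
    exact h2.hasSum
  refine (fourierNorm_le_tsum hω0 hsum).trans ?_
  calc ∑' p : UnitaryDual G × UnitaryDual G, fourierNorm ω (fourierPiece f p.1 * fourierPiece g p.2)
      ≤ ∑' p : UnitaryDual G × UnitaryDual G,
        ENNReal.ofReal (p.1.repr.dim * ω p.1 * traceNorm (fourierCoeff f p.1)) *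
        ENNReal.ofReal (p.2.repr.dim * ω p.2 * traceNorm (fourierCoeff g p.2)) :=
        ENNReal.tsum_le_tsum fun p => fourierNorm_mul_piece_le hω f g p.1 p.2
    _ = fourierNorm ω f * fourierNorm ω g := by
        rw [ENNReal.tsum_prod', fourierNorm, fourierNorm, ← ENNReal.tsum_mul_right]
        exact tsum_congr fun π => by dsimp only; exact ENNReal.tsum_mul_left

end Algebra

/-! ### The Beurling–Fourier algebra as a Banach algebra -/

section BanachAlgebra

variable {G : Type u} [Group G] [TopologicalSpace G] {ω : UnitaryDual G → ℝ}

theorem IsCentralWeight.nonneg (hω : IsCentralWeight ω) (π : UnitaryDual G) : 0 ≤ ω π := by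
  obtain ⟨δ, hδ, h⟩ := hω.exists_lt
  exact (hδ.trans (h π)).le

variable [IsTopologicalGroup G] [CompactSpace G] [T2Space G]

/-- The continuous functions of finite Fourier norm. -/
def beurlingFourierSubalgebra (hω : IsCentralWeight ω) : Subalgebra ℂ C(G, ℂ) where
  carrier := {f | fourierNorm ω f < ∞}
  mul_mem' hf hg := (fourierNorm_mul_le hω hf hg).trans_lt (ENNReal.mul_lt_top hf hg)
  add_mem' hf hg := (fourierNorm_add_le hω.nonneg _ _).trans_lt (ENNReal.add_lt_top.mpr ⟨hf, hg⟩)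
  algebraMap_mem' c := by
    rw [Algebra.algebraMap_eq_smul_one]
    change fourierNorm ω _ < ∞
    rw [fourierNorm_smul]
    exact ENNReal.mul_lt_top ENNReal.ofReal_lt_top (fourierNorm_one_lt_top hω.nonneg)

/-- The Beurling-Fourier algebra of a central weight. -/
def BeurlingFourierAlgebra (hω : IsCentralWeight ω) : Type u := beurlingFourierSubalgebra hω

namespace BeurlingFourierAlgebra

variable (hω : IsCentralWeight ω)

instance : CommRing (BeurlingFourierAlgebra hω) :=
  inferInstanceAs (CommRing (beurlingFourierSubalgebra hω))

instance instAlgebra : Algebra ℂ (BeurlingFourierAlgebra hω) :=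
  inferInstanceAs (Algebra ℂ (beurlingFourierSubalgebra hω))

/-- The inclusion into the continuous functions. -/
def incl : BeurlingFourierAlgebra hω →ₐ[ℂ] C(G, ℂ) := (beurlingFourierSubalgebra hω).val

theorem incl_injective : Function.Injective (incl hω) := Subtype.val_injective

theorem fourierNorm_incl_lt_top (a : BeurlingFourierAlgebra hω) :
    fourierNorm ω (incl hω a) < ∞ := a.2

/-- The norm, as a ring norm. -/
def ringNorm : RingNorm (BeurlingFourierAlgebra hω) where
  toFun a := (fourierNorm ω (incl hω a)).toReal
  map_zero' := by
    have := fourierNorm_smul ω 0 (0 : C(G, ℂ))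
    rw [zero_smul, norm_zero, ENNReal.ofReal_zero, zero_mul] at this
    rw [map_zero, this, ENNReal.toReal_zero]
  add_le' a b := by
    have ha := fourierNorm_incl_lt_top hω a
    have hb := fourierNorm_incl_lt_top hω b
    rw [map_add, ← ENNReal.toReal_add ha.ne hb.ne]
    exact ENNReal.toReal_mono (ENNReal.add_lt_top.mpr ⟨ha, hb⟩).ne
      (fourierNorm_add_le hω.nonneg _ _)
  neg' a := by
    have := fourierNorm_smul ω (-1) (incl hω a)
    rw [neg_one_smul, norm_neg, norm_one, ENNReal.ofReal_one, one_mul] at this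
    rw [map_neg, this]
  mul_le' a b := by
    have ha := fourierNorm_incl_lt_top hω a
    have hb := fourierNorm_incl_lt_top hω b
    rw [map_mul, ← ENNReal.toReal_mul]
    exact ENNReal.toReal_mono (ENNReal.mul_lt_top ha hb).ne (fourierNorm_mul_le hω ha hb)
  eq_zero_of_map_eq_zero' a h := by
    obtain ⟨δ, hδ, hδω⟩ := hω.exists_lt
    have h1 := (ENNReal.toReal_eq_zero_iff _).mp h
    have h2 := ofReal_norm_le_fourierNorm hδ (fun π => (hδω π).le) (incl hω a)
    rw [h1.resolve_right (fourierNorm_incl_lt_top hω a).ne, nonpos_iff_eq_zero,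
      ENNReal.ofReal_eq_zero] at h2
    have h3 : ‖incl hω a‖ ≤ 0 := by
      by_contra h0
      push Not at h0
      exact (mul_pos hδ h0).not_ge h2
    exact incl_injective hω ((norm_le_zero_iff.mp h3).trans (map_zero _).symm)

instance : NormedCommRing (BeurlingFourierAlgebra hω) :=
  { (ringNorm hω).toNormedRing with mul_comm := mul_comm }

theorem norm_def (a : BeurlingFourierAlgebra hω) : ‖a‖ = (fourierNorm ω (incl hω a)).toReal := rfl

theorem ofReal_norm (a : BeurlingFourierAlgebra hω) :
    ENNReal.ofReal ‖a‖ = fourierNorm ω (incl hω a) :=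
  ENNReal.ofReal_toReal (fourierNorm_incl_lt_top hω a).ne

instance : NormedAlgebra ℂ (BeurlingFourierAlgebra hω) :=
  { instAlgebra hω with
    norm_smul_le := fun c a => by
      rw [norm_def, norm_def]
      have h : incl hω (c • a) = c • incl hω a := map_smul (incl hω) c a
      rw [h, fourierNorm_smul, ENNReal.toReal_mul, ENNReal.toReal_ofReal (norm_nonneg _)] }

theorem isBeurlingFourierAlgebra : IsBeurlingFourierAlgebra ω (incl hω) where
  injective := incl_injective hω
  range_eq := Subtype.range_val
  norm_eq := ofReal_norm hω

/-- An absolutely summable series converges uniformly, because the norm dominates a multiple of the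
sup norm. Countable subadditivity bounds the Fourier norm of every tail by the tail of the norms, so
the uniform limit lies in the algebra and is the limit in its norm. -/
instance : CompleteSpace (BeurlingFourierAlgebra hω) := by
  refine NormedAddCommGroup.completeSpace_of_summable_imp_tendsto fun u hu => ?_
  obtain ⟨δ, hδ, hδω⟩ := hω.exists_lt
  have hbound : ∀ a : BeurlingFourierAlgebra hω, ‖incl hω a‖ ≤ δ⁻¹ * ‖a‖ := by
    intro a
    have h := ofReal_norm_le_fourierNorm hδ (fun π => (hδω π).le) (incl hω a)
    rw [← ofReal_norm, ENNReal.ofReal_le_ofReal_iff (norm_nonneg _)] at h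
    rwa [le_inv_mul_iff₀ hδ]
  have hs : Summable fun k => incl hω (u k) :=
    Summable.of_norm_bounded (hu.mul_left δ⁻¹) fun k => hbound (u k)
  have htail : ∀ n, fourierNorm ω (∑' k, incl hω (u (k + n))) ≤
      ENNReal.ofReal (∑' k, ‖u (k + n)‖) := by
    intro n
    refine (fourierNorm_le_tsum hω.nonneg ((summable_nat_add_iff n).mpr hs).hasSum).trans ?_
    rw [ENNReal.ofReal_tsum_of_nonneg (fun _ => norm_nonneg _) ((summable_nat_add_iff n).mpr hu)]
    simp only [ofReal_norm, le_refl]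
  obtain ⟨a, ha⟩ : ∃ a, incl hω a = ∑' k, incl hω (u k) :=
    ⟨⟨∑' k, incl hω (u k), (htail 0).trans_lt ENNReal.ofReal_lt_top⟩, rfl⟩
  refine ⟨a, ?_⟩
  rw [tendsto_iff_norm_sub_tendsto_zero]
  refine squeeze_zero (fun _ => norm_nonneg _) (fun n => ?_) (tendsto_sum_nat_add fun k => ‖u k‖)
  rw [norm_sub_rev, norm_def, map_sub, map_sum]
  have h1 : (∑' k, incl hω (u k)) - ∑ k ∈ Finset.range n, incl hω (u k) =
      ∑' k, incl hω (u (k + n)) := by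
    rw [← hs.sum_add_tsum_nat_add n, add_sub_cancel_left]
  refine ENNReal.toReal_le_of_le_ofReal (tsum_nonneg fun _ => norm_nonneg _) ?_
  refine le_trans (le_of_eq ?_) (htail n)
  rw [← h1, ← ha]

end BeurlingFourierAlgebra

end BanachAlgebra

/-! ### Irreducible matrix representations with arbitrary finite index type -/

section MatrixModels

variable {G : Type u} [Group G] {n : Type*} [Fintype n] [DecidableEq n]

/-- The linear representation given by a unitary matrix representation with any index type. -/
def unitaryRep (U : G →* Matrix.unitaryGroup n ℂ) : Representation ℂ G (n → ℂ) :=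
  ((Matrix.toLinAlgEquiv' (R := ℂ) (n := n)).toAlgHom.toMonoidHom.comp
    (Matrix.unitaryGroup n ℂ).subtype).comp U

theorem unitaryRep_apply (U : G →* Matrix.unitaryGroup n ℂ) (g : G) (v : n → ℂ) :
    unitaryRep U g v = (U g).1 *ᵥ v := rfl

/-- Renaming the indices of a unitary matrix representation. -/
def reindexHom {m : Type*} [Fintype m] [DecidableEq m] (e : n ≃ m)
    (U : G →* Matrix.unitaryGroup n ℂ) : G →* Matrix.unitaryGroup m ℂ :=
  MonoidHom.mk' (fun g => ⟨(U g).1.submatrix e.symm e.symm, by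
    rw [Matrix.mem_unitaryGroup_iff, Matrix.star_eq_conjTranspose, Matrix.conjTranspose_submatrix,
      Matrix.submatrix_mul_equiv, ← Matrix.star_eq_conjTranspose, Matrix.mem_unitaryGroup_iff.mp (U g).2,
      Matrix.submatrix_one_equiv]⟩) fun g h => Subtype.ext (by
    change (U (g * h)).1.submatrix _ _ = (U g).1.submatrix _ _ * (U h).1.submatrix _ _
    rw [Matrix.submatrix_mul_equiv, coe_map_mul])

theorem reindexHom_apply {m : Type*} [Fintype m] [DecidableEq m] (e : n ≃ m)
    (U : G →* Matrix.unitaryGroup n ℂ) (g : G) (i j : m) :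
    (reindexHom e U g).1 i j = (U g).1 (e.symm i) (e.symm j) := rfl

theorem reindexHom_mulVec {m : Type*} [Fintype m] [DecidableEq m] (e : n ≃ m)
    (U : G →* Matrix.unitaryGroup n ℂ) (g : G) (v : m → ℂ) :
    ((reindexHom e U g).1 *ᵥ v) ∘ e = (U g).1 *ᵥ (v ∘ e) := by
  ext i
  simp only [Function.comp_apply, Matrix.mulVec, dotProduct, reindexHom_apply,
    Equiv.symm_apply_apply]
  exact Fintype.sum_equiv e.symm _ _ fun j => by simp

variable [TopologicalSpace G] [Nonempty n]

/-- An irreducible unitary matrix representation with any index type. -/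
def irrepOfUnitary (U : G →* Matrix.unitaryGroup n ℂ) (hU : Continuous U)
    (hirr : ∀ W : Submodule ℂ (n → ℂ), (∀ g, ∀ v ∈ W, (U g).1 *ᵥ v ∈ W) → W ≠ ⊥ → W = ⊤) :
    Irrep G where
  dim := Fintype.card n
  toHom := reindexHom (Fintype.equivFin n) U
  continuous_toHom := Continuous.subtype_mk
    (continuous_matrix fun _ _ => continuous_coe_apply hU _ _) _
  irreducible := by
    set e := Fintype.equivFin n
    refine { exists_pair_ne := ⟨⊥, ⊤, fun h => ?_⟩, eq_bot_or_eq_top := fun a => ?_ }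
    · have h1 : (1 : Fin (Fintype.card n) → ℂ) ∈ (⊥ : Subrepresentation (matRep (reindexHom e U))) := by
        rw [h]; trivial
      have h2 : (1 : Fin (Fintype.card n) → ℂ) = 0 := h1
      simpa using congrFun h2 (e (Classical.arbitrary n))
    · rw [or_iff_not_imp_left]
      intro ha
      have h0 : a.toSubmodule ≠ ⊥ := fun h => ha (Subrepresentation.toSubmodule_injective h)
      set φ := (LinearEquiv.funCongrLeft ℂ ℂ e)
      have hφ : ∀ v, φ v = v ∘ e := fun _ => rfl
      have h1 : a.toSubmodule.map φ.toLinearMap = ⊤ := by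
        refine hirr _ ?_ ?_
        · rintro g _ ⟨v, hv, rfl⟩
          refine ⟨_, a.apply_mem_toSubmodule g hv, ?_⟩
          exact reindexHom_mulVec e U g v
        · intro h
          exact h0 (Submodule.map_injective_of_injective φ.injective (h.trans (Submodule.map_bot _).symm))
      refine Subrepresentation.toSubmodule_injective ?_
      refine Submodule.map_injective_of_injective φ.injective (h1.trans ?_)
      exact (LinearMap.range_eq_map _).symm.trans (LinearEquiv.range φ) |>.symm

/-- The irreducible representation with renamed indices is equivalent to the original one. -/
def irrepOfUnitaryEquiv (U : G →* Matrix.unitaryGroup n ℂ) (hU : Continuous U)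
    (hirr : ∀ W : Submodule ℂ (n → ℂ), (∀ g, ∀ v ∈ W, (U g).1 *ᵥ v ∈ W) → W ≠ ⊥ → W = ⊤) :
    Representation.Equiv (irrepOfUnitary U hU hirr).rep (unitaryRep U) :=
  Representation.Equiv.mk (LinearEquiv.funCongrLeft ℂ ℂ (Fintype.equivFin n)) fun g =>
    LinearMap.ext fun v => reindexHom_mulVec (Fintype.equivFin n) U g v

end MatrixModels

/-! ### Outer tensor products and their irreducibility -/

section OuterTensor

variable {I : Type v} {G : I → Type u} [∀ i, Group (G i)] [∀ i, TopologicalSpace (G i)]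
  (F : Finset I) (π : ∀ i : F, Irrep (G i))

/-- The matrices of an outer tensor product. -/
def outerMatrix (x : ∀ i, G i) :
    Matrix (∀ i : F, Fin (π i).dim) (∀ i : F, Fin (π i).dim) ℂ :=
  Matrix.of fun a b => ∏ i : F, (π i).mat (x i) (a i) (b i)

theorem outerMatrix_apply (x : ∀ i, G i) (a b : ∀ i : F, Fin (π i).dim) :
    outerMatrix F π x a b = ∏ i : F, (π i).mat (x i) (a i) (b i) := rfl

theorem outerMatrix_one : outerMatrix F π 1 = 1 := by
  ext a b
  simp only [outerMatrix_apply, Irrep.mat, Pi.one_apply, map_one, OneMemClass.coe_one,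
    Matrix.one_apply, Finset.prod_ite_zero, Finset.prod_const_one, Finset.mem_univ, forall_const,
    ← funext_iff]

theorem conjTranspose_outerMatrix (x : ∀ i, G i) : (outerMatrix F π x)ᴴ = outerMatrix F π x⁻¹ := by
  ext a b
  simp only [outerMatrix_apply, Matrix.conjTranspose_apply, star_prod, Irrep.mat, Pi.inv_apply,
    coe_map_inv_apply]

variable [DecidableEq I]

theorem outerMatrix_mul (x y : ∀ i, G i) :
    outerMatrix F π (x * y) = outerMatrix F π x * outerMatrix F π y := by
  ext a b
  simp only [outerMatrix_apply, Matrix.mul_apply, Irrep.mat, Pi.mul_apply, coe_map_mul_apply,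
    Finset.prod_univ_sum, Fintype.piFinset_univ, Finset.prod_mul_distrib]

/-- The unitary matrix representation on an outer tensor product. -/
def outerHom : (∀ i, G i) →* Matrix.unitaryGroup (∀ i : F, Fin (π i).dim) ℂ :=
  MonoidHom.mk' (fun x => ⟨outerMatrix F π x, by
    rw [Matrix.mem_unitaryGroup_iff, Matrix.star_eq_conjTranspose, conjTranspose_outerMatrix,
      ← outerMatrix_mul, mul_inv_cancel, outerMatrix_one]⟩)
    fun x y => Subtype.ext (outerMatrix_mul F π x y)

theorem coe_outerHom (x : ∀ i, G i) : (outerHom F π x).1 = outerMatrix F π x := rfl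

theorem continuous_outerHom : Continuous (outerHom F π) := by
  refine Continuous.subtype_mk (continuous_matrix fun a b => ?_) _
  exact continuous_finsetProd _ fun i _ =>
    ((π i).continuous_mat_apply _ _).comp (continuous_apply (i : I))

/-- The outer tensor product in coordinates. -/
def outerTensorEquiv : Representation.Equiv (outerTensor F π) (unitaryRep (outerHom F π)) :=
  Representation.Equiv.mk
    (Basis.piTensorProduct fun i : F => Pi.basisFun ℂ (Fin (π i).dim)).equivFun fun x => by
      refine PiTensorProduct.ext (MultilinearMap.ext fun v => ?_)
      have he : ∀ v c, (Basis.piTensorProduct fun i : F => Pi.basisFun ℂ (Fin (π i).dim)).equivFun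
          (PiTensorProduct.tprod ℂ v) c = ∏ i, v i (c i) := fun v c => by
        rw [Module.Basis.equivFun_apply, Basis.piTensorProduct_repr_tprod_apply]
        simp
      ext a
      simp only [LinearMap.compMultilinearMap_apply, LinearMap.comp_apply, LinearEquiv.coe_coe,
        outerTensor, MonoidHom.coe_mk, OneHom.coe_mk, PiTensorProduct.map_tprod, he,
        unitaryRep_apply, Matrix.mulVec, dotProduct, coe_outerHom, outerMatrix_apply,
        Irrep.rep_apply, Finset.prod_univ_sum, Fintype.piFinset_univ, Finset.prod_mul_distrib]

/-- The factors other than `i` are identity matrices, so only multi-indices agreeing with `a` away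
from `i` contribute. -/
theorem outerMatrix_mulSingle_mulVec (i : F) (t : G i) (f : (∀ i : F, Fin (π i).dim) → ℂ)
    (a : ∀ i : F, Fin (π i).dim) :
    (outerMatrix F π (Pi.mulSingle (i : I) t) *ᵥ f) a =
      ∑ j, (π i).mat t (a i) j * f (Function.update a i j) := by
  have hone : ∀ (k : F), k ≠ i → (π k).mat ((Pi.mulSingle (i : I) t : ∀ i, G i) k) = 1 := by
    intro k hk
    rw [Pi.mulSingle_eq_of_ne (fun h => hk (Subtype.ext h)), Irrep.mat, map_one]
    rfl
  symm
  rw [Matrix.mulVec, dotProduct]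
  refine Finset.sum_of_injOn (Function.update a i) ?_ ?_ ?_ ?_
  · exact (Function.update_injective a i).injOn
  · simp
  · intro c _ hc
    have : ∃ k, k ≠ i ∧ a k ≠ c k := by
      by_contra! h
      refine hc ⟨c i, by simp, ?_⟩
      ext k
      by_cases hk : k = i
      · subst hk; simp
      · rw [Function.update_of_ne hk, h k hk]
    obtain ⟨k, hk, hak⟩ := this
    rw [outerMatrix_apply, Finset.prod_eq_zero (Finset.mem_univ k), zero_mul]
    rw [hone k hk, Matrix.one_apply_ne hak]
  · intro j _
    rw [outerMatrix_apply, Finset.prod_eq_single i]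
    · rw [Pi.mulSingle_eq_same, Function.update_self]
    · intro k _ hk
      rw [hone k hk, Function.update_of_ne hk, Matrix.one_apply_eq]
    · simp

theorem outerMatrix_mulSingle_of_notMem {i : I} (hi : i ∉ F) (t : G i) :
    outerMatrix F π (Pi.mulSingle i t) = 1 := by
  rw [← outerMatrix_one F π]
  ext a b
  rw [outerMatrix_apply, outerMatrix_apply]
  refine Finset.prod_congr rfl fun k _ => ?_
  rw [Pi.mulSingle_eq_of_ne (fun h : (k : I) = i => hi (h ▸ k.2)), Pi.one_apply]

variable [∀ i, IsTopologicalGroup (G i)] [∀ i, CompactSpace (G i)]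

/-- An invariant subspace of an outer tensor product is stable under the matrix units in every
coordinate. -/
theorem matrixUnit_mem_of_invariant (W : Submodule ℂ ((∀ i : F, Fin (π i).dim) → ℂ))
    (hW : ∀ x, ∀ f ∈ W, outerMatrix F π x *ᵥ f ∈ W) (i : F) (p q : Fin (π i).dim)
    {f : (∀ i : F, Fin (π i).dim) → ℂ} (hf : f ∈ W) :
    (fun a => if a i = p then f (Function.update a i q) else 0) ∈ W := by
  -- Otherwise a functional `ℓ` vanishes on `W` but not on this vector. It annihilates all
  -- translates of `f` by `G i`; integrating this identity against `star (π i)_{p q}` leaves, by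
  -- orthogonality, a nonzero multiple of `ℓ` at the vector.
  by_contra hmem
  obtain ⟨ℓ, hℓ, hℓW⟩ := Submodule.exists_le_ker_of_notMem hmem
  refine hℓ ?_
  have hc := (π i).continuous_mat_apply
  have hd : ((π i).dim : ℂ) ≠ 0 := Nat.cast_ne_zero.mpr (NeZero.ne _)
  have hexp : ∀ g, ℓ g = ∑ a, g a * ℓ (Pi.single a 1) := by
    intro g
    conv_lhs => rw [pi_eq_sum_univ' g, map_sum]
    simp
  have h0 : ∀ t, ∑ a, ∑ j, (f (Function.update a i j) * ℓ (Pi.single a 1)) *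
      ((π i).mat t (a i) j * star ((π i).mat t p q)) = 0 := by
    intro t
    have h1 := hℓW (hW (Pi.mulSingle (i : I) t) f hf)
    rw [LinearMap.mem_ker, hexp] at h1
    simp only [outerMatrix_mulSingle_mulVec, Finset.sum_mul] at h1
    rw [← zero_mul (star ((π i).mat t p q)), ← h1, Finset.sum_mul]
    refine Finset.sum_congr rfl fun a _ => ?_
    rw [Finset.sum_mul]
    exact Finset.sum_congr rfl fun j _ => by ring
  have h2 : ∀ (a : ∀ i : F, Fin (π i).dim) j, haarIntegral (fun t => (π i).mat t (a i) j * star ((π i).mat t p q)) =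
      if a i = p ∧ j = q then ((π i).dim : ℂ)⁻¹ else 0 := fun a j =>
    coeffMatrix_self (π i) p q (a i) j
  have h3 : ∑ a, ∑ j, (f (Function.update a i j) * ℓ (Pi.single a 1)) *
      (if a i = p ∧ j = q then ((π i).dim : ℂ)⁻¹ else 0) = 0 := by
    have h4 : haarIntegral (fun t : G i => ∑ a, ∑ j,
        (f (Function.update a i j) * ℓ (Pi.single a 1)) *
          ((π i).mat t (a i) j * star ((π i).mat t p q))) = 0 := by
      simp only [h0, haarIntegral_const]
    rw [haarIntegral_sum _ fun a _ => by fun_prop] at h4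
    refine Eq.trans (Eq.symm ?_) h4
    refine Finset.sum_congr rfl fun a _ => ?_
    rw [haarIntegral_sum _ fun a _ => by fun_prop]
    refine Finset.sum_congr rfl fun j _ => ?_
    rw [haarIntegral_const_mul, h2]
  rw [hexp]
  have h5 : ∑ a, ((if a i = p then f (Function.update a i q) else 0) * ℓ (Pi.single a 1) *
      ((π i).dim : ℂ)⁻¹) = 0 := by
    refine Eq.trans ?_ h3
    refine Finset.sum_congr rfl fun a _ => ?_
    simp only [ite_and, mul_ite, mul_zero]
    split_ifs <;> simp
  rw [← Finset.sum_mul] at h5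
  exact (mul_eq_zero.mp h5).resolve_right (inv_ne_zero hd)

/-- Matrix units applied in one coordinate after another isolate a nonzero entry `f q` and move it
to any position `p`, so `W` contains every unit vector. -/
theorem outerMatrix_irreducible (W : Submodule ℂ ((∀ i : F, Fin (π i).dim) → ℂ))
    (hW : ∀ x, ∀ f ∈ W, outerMatrix F π x *ᵥ f ∈ W) (hW0 : W ≠ ⊥) : W = ⊤ := by
  obtain ⟨f, hf, hf0⟩ := Submodule.exists_mem_ne_zero_of_ne_bot hW0
  obtain ⟨q, hq⟩ := Function.ne_iff.mp hf0
  have key : ∀ (p : ∀ i : F, Fin (π i).dim) (S : Finset F),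
      (fun a => if ∀ i ∈ S, a i = p i then f fun i => if i ∈ S then q i else a i else 0) ∈ W := by
    intro p S
    induction S using Finset.induction_on with
    | empty => simpa using hf
    | insert i S hi ih =>
      convert matrixUnit_mem_of_invariant F π W hW i (p i) (q i) ih using 1
      ext a
      have h1 : (fun k => if k ∈ insert i S then q k else a k) =
          fun k => if k ∈ S then q k else Function.update a i (q i) k := by
        ext k
        by_cases hk : k = i
        · subst hk; simp [hi]
        · simp [hk]
      have h2 : (∀ k ∈ S, Function.update a i (q i) k = p k) ↔ ∀ k ∈ S, a k = p k := by
        refine forall₂_congr fun k hk => ?_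
        rw [Function.update_of_ne (fun h => hi (by rwa [← h]))]
      simp only [h1, h2, Finset.forall_mem_insert, ite_and]
  rw [eq_top_iff]
  intro g _
  rw [pi_eq_sum_univ' g]
  refine Submodule.sum_mem _ fun p _ => W.smul_mem _ ?_
  have h := W.smul_mem (f q)⁻¹ (key p Finset.univ)
  convert h using 1
  ext a
  have hq' : f q ≠ 0 := hq
  simp only [Pi.smul_apply, smul_eq_mul, Finset.mem_univ, forall_const, if_true, ← funext_iff,
    Pi.single_apply, mul_ite, mul_zero]
  rw [inv_mul_cancel₀ hq']

/-- The irreducible representation of the product of groups on an outer tensor product. -/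
def outerIrrep : Irrep (∀ i, G i) :=
  irrepOfUnitary (outerHom F π) (continuous_outerHom F π) (outerMatrix_irreducible F π)

/-- The irreducible representation `outerIrrep` is the outer tensor product. -/
def outerIrrepEquiv : Representation.Equiv (outerIrrep F π).rep (outerTensor F π) :=
  (irrepOfUnitaryEquiv (outerHom F π) (continuous_outerHom F π)
    (outerMatrix_irreducible F π)).trans (outerTensorEquiv F π).symm

end OuterTensor

/-! ### Contraction of tensors with functionals -/

section Contraction

variable {V W V' W' : Type*} [AddCommGroup V] [Module ℂ V] [AddCommGroup W] [Module ℂ W]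
  [AddCommGroup V'] [Module ℂ V'] [AddCommGroup W'] [Module ℂ W']

/-- Contraction of the right factor of a tensor product with a linear functional. -/
def contractRight (ℓ : W →ₗ[ℂ] ℂ) : V ⊗[ℂ] W →ₗ[ℂ] V :=
  (TensorProduct.rid ℂ V).toLinearMap ∘ₗ LinearMap.lTensor V ℓ

/-- Contraction of the left factor of a tensor product with a linear functional. -/
def contractLeft (ℓ : V →ₗ[ℂ] ℂ) : V ⊗[ℂ] W →ₗ[ℂ] W :=
  (TensorProduct.lid ℂ W).toLinearMap ∘ₗ LinearMap.rTensor W ℓ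

theorem contractRight_tmul (ℓ : W →ₗ[ℂ] ℂ) (v : V) (w : W) :
    contractRight ℓ (v ⊗ₜ[ℂ] w) = ℓ w • v := by
  simp [contractRight]

theorem contractLeft_tmul (ℓ : V →ₗ[ℂ] ℂ) (v : V) (w : W) :
    contractLeft ℓ (v ⊗ₜ[ℂ] w) = ℓ v • w := by
  simp [contractLeft]

theorem contractRight_map (ℓ : W →ₗ[ℂ] ℂ) (P : V →ₗ[ℂ] V') (z : V ⊗[ℂ] W) :
    contractRight ℓ (TensorProduct.map P LinearMap.id z) = P (contractRight ℓ z) := by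
  induction z using TensorProduct.induction_on with
  | zero => simp
  | add x y hx hy => rw [map_add, map_add, hx, hy, map_add, map_add]
  | tmul v w => rw [TensorProduct.map_tmul, contractRight_tmul, contractRight_tmul, map_smul]; rfl

theorem contractLeft_map (ℓ : V →ₗ[ℂ] ℂ) (P : W →ₗ[ℂ] W') (z : V ⊗[ℂ] W) :
    contractLeft ℓ (TensorProduct.map LinearMap.id P z) = P (contractLeft ℓ z) := by
  induction z using TensorProduct.induction_on with
  | zero => simp
  | add x y hx hy => rw [map_add, map_add, hx, hy, map_add, map_add]
  | tmul v w => rw [TensorProduct.map_tmul, contractLeft_tmul, contractLeft_tmul, map_smul]; rfl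

/-- The coordinate functionals of a basis of `W` already separate the tensors. -/
theorem exists_contractRight_ne_zero {z : V ⊗[ℂ] W} (hz : z ≠ 0) :
    ∃ ℓ : W →ₗ[ℂ] ℂ, contractRight ℓ z ≠ 0 := by
  by_contra! h
  classical
  let b := Module.Basis.ofVectorSpace ℂ W
  refine hz ((TensorProduct.equivFinsuppOfBasisRight (M := V) b).injective ?_)
  rw [map_zero]
  ext i
  rw [Finsupp.zero_apply, ← h (b.coord i)]
  generalize z = x
  induction x using TensorProduct.induction_on with
  | zero => simp
  | add x y hx hy => rw [map_add, map_add, Finsupp.add_apply, hx, hy]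
  | tmul v w =>
    rw [TensorProduct.equivFinsuppOfBasisRight_apply_tmul_apply, contractRight_tmul]; rfl

theorem exists_contractLeft_ne_zero {z : V ⊗[ℂ] W} (hz : z ≠ 0) :
    ∃ ℓ : V →ₗ[ℂ] ℂ, contractLeft ℓ z ≠ 0 := by
  obtain ⟨ℓ, hℓ⟩ := exists_contractRight_ne_zero
    ((LinearEquiv.map_ne_zero_iff (TensorProduct.comm ℂ V W)).mpr hz)
  refine ⟨ℓ, fun h => hℓ ?_⟩
  rw [← h]
  generalize z = x
  induction x using TensorProduct.induction_on with
  | zero => simp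
  | add x y hx hy => rw [map_add, map_add, hx, hy, map_add]
  | tmul v w => rw [TensorProduct.comm_tmul, contractRight_tmul, contractLeft_tmul]

end Contraction

/-! ### Trivial classes and central weights on one group -/

section SingleGroup

variable {G : Type u} [Group G] [TopologicalSpace G]

theorem UnitaryDual.eq_of_intertwining {ρ ρ' : UnitaryDual G}
    {S : Representation.IntertwiningMap ρ.repr.rep ρ'.repr.rep} {v : Fin ρ.repr.dim → ℂ}
    (h : S v ≠ 0) : ρ = ρ' := by
  rw [← UnitaryDual.nonempty_equiv_iff]
  rcases Representation.IsIrreducible.bijective_or_eq_zero S with hS | hS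
  · exact ⟨S.ofBijective hS⟩
  · exact absurd (by rw [hS]; rfl) h

theorem UnitaryDual.inSupport_of_intertwining {ρ : UnitaryDual G} {V : Type*} [AddCommGroup V]
    [Module ℂ V] {τ : Representation ℂ G V} {S : Representation.IntertwiningMap ρ.repr.rep τ}
    {v : Fin ρ.repr.dim → ℂ} (h : S v ≠ 0) : ρ.InSupport τ :=
  ⟨S, (Representation.IsIrreducible.injective_or_eq_zero S).resolve_right fun h0 =>
    h (by rw [h0]; rfl)⟩

/-- A linear map between trivial representations, as an intertwining map. -/
def intertwiningOfIsTrivial {V W : Type*} [AddCommGroup V] [Module ℂ V] [AddCommGroup W]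
    [Module ℂ W] (τ : Representation ℂ G V) (τ' : Representation ℂ G W) [τ.IsTrivial]
    [τ'.IsTrivial] (f : V →ₗ[ℂ] W) : Representation.IntertwiningMap τ τ' where
  toLinearMap := f
  isIntertwining' g := by rw [τ.isTrivial_def, τ'.isTrivial_def]; rfl

instance isTrivial_tprod {V W : Type*} [AddCommGroup V] [Module ℂ V] [AddCommGroup W]
    [Module ℂ W] (τ : Representation ℂ G V) (τ' : Representation ℂ G W) [τ.IsTrivial]
    [τ'.IsTrivial] : (τ.tprod τ').IsTrivial where
  out g := by rw [Representation.tprod_apply, τ.isTrivial_def, τ'.isTrivial_def, TensorProduct.map_id]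

omit [TopologicalSpace G] in
theorem isTrivial_of_injective {V W : Type*} [AddCommGroup V] [Module ℂ V] [AddCommGroup W]
    [Module ℂ W] {τ : Representation ℂ G V} {τ' : Representation ℂ G W} [τ'.IsTrivial]
    (T : Representation.IntertwiningMap τ τ') (hT : Function.Injective T) : τ.IsTrivial where
  out g := LinearMap.ext fun v => hT (by
    rw [T.isIntertwining, τ'.isTrivial_apply]; rfl)

instance isTrivial_trivialClass : (trivialClass G).repr.rep.IsTrivial := by
  have h : (trivialClass G).repr.toClass = (trivialIrrep G).toClass := UnitaryDual.toClass_repr _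
  obtain ⟨e⟩ := Irrep.toClass_eq_iff.mp h
  have : (trivialIrrep G).rep.IsTrivial :=
    ⟨fun g => LinearMap.ext fun v => by
      rw [Irrep.rep_apply]
      exact Matrix.one_mulVec v⟩
  exact isTrivial_of_injective e.toIntertwiningMap e.toLinearEquiv.injective

theorem UnitaryDual.isTrivial_iff {ρ : UnitaryDual G} :
    ρ.repr.rep.IsTrivial ↔ ρ = trivialClass G := by
  refine ⟨fun h => ?_, fun h => by rw [h]; infer_instance⟩
  let S := intertwiningOfIsTrivial ρ.repr.rep (trivialClass G).repr.rep
    ((LinearMap.proj 0).smulRight (Pi.single 0 1))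
  refine UnitaryDual.eq_of_intertwining (S := S) (v := Pi.single 0 1) ?_
  change (Pi.single 0 1 : Fin ρ.repr.dim → ℂ) 0 • (Pi.single 0 1 : Fin _ → ℂ) ≠ 0
  rw [Pi.single_eq_same, one_smul]
  exact fun h => one_ne_zero (Pi.single_eq_zero_iff.mp h)

/-- Contracting a trivial factor with a functional is an intertwining map onto the other factor, and
a suitable functional does not annihilate the image of `κ`. -/
theorem eq_of_inSupport_tprod_left {κ ρ ρ' : UnitaryDual G} [hρ : ρ.repr.rep.IsTrivial]
    (h : κ.InSupport (ρ.repr.rep.tprod ρ'.repr.rep)) : κ = ρ' := by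
  obtain ⟨T, hT⟩ := h
  have hv : T (Pi.single 0 1) ≠ 0 := fun h =>
    one_ne_zero (Pi.single_eq_zero_iff.mp (hT (h.trans (map_zero T).symm)))
  obtain ⟨ℓ, hℓ⟩ := exists_contractLeft_ne_zero hv
  let C : Representation.IntertwiningMap (ρ.repr.rep.tprod ρ'.repr.rep) ρ'.repr.rep :=
    { toLinearMap := contractLeft ℓ
      isIntertwining' := fun g => LinearMap.ext fun z => by
        rw [LinearMap.comp_apply, Representation.tprod_apply, Representation.isTrivial_def]
        exact contractLeft_map ℓ _ z }
  exact UnitaryDual.eq_of_intertwining (S := C.comp T) hℓ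

theorem eq_of_inSupport_tprod_right {κ ρ ρ' : UnitaryDual G} [hρ : ρ'.repr.rep.IsTrivial]
    (h : κ.InSupport (ρ.repr.rep.tprod ρ'.repr.rep)) : κ = ρ := by
  obtain ⟨T, hT⟩ := h
  have hv : T (Pi.single 0 1) ≠ 0 := fun h =>
    one_ne_zero (Pi.single_eq_zero_iff.mp (hT (h.trans (map_zero T).symm)))
  obtain ⟨ℓ, hℓ⟩ := exists_contractRight_ne_zero hv
  let C : Representation.IntertwiningMap (ρ.repr.rep.tprod ρ'.repr.rep) ρ.repr.rep :=
    { toLinearMap := contractRight ℓ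
      isIntertwining' := fun g => LinearMap.ext fun z => by
        rw [LinearMap.comp_apply, Representation.tprod_apply,
          Representation.isTrivial_def ρ'.repr.rep]
        exact contractRight_map ℓ _ z }
  exact UnitaryDual.eq_of_intertwining (S := C.comp T) hℓ

/-- The trivial class occurs in its own tensor square, so its weight is at most the square of that
weight. -/
theorem IsCentralWeight.one_le_trivialClass {ω : UnitaryDual G → ℝ} (hω : IsCentralWeight ω) :
    1 ≤ ω (trivialClass G) := by
  obtain ⟨δ, hδ, hlt⟩ := hω.exists_lt
  set τ := (trivialClass G).repr.rep
  let v : Fin (trivialClass G).repr.dim → ℂ := Pi.single 0 1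
  let S := intertwiningOfIsTrivial τ (τ.tprod τ) ((TensorProduct.mk ℂ _ _).flip v)
  have hv : S v ≠ 0 := fun h => by
    have h1 : contractRight (LinearMap.proj 0) (v ⊗ₜ[ℂ] v) = 0 :=
      (congrArg _ h).trans (map_zero _)
    rw [contractRight_tmul] at h1
    simpa [v] using congrFun h1 0
  have h := hω.le_mul _ _ _ (UnitaryDual.inSupport_of_intertwining hv)
  exact le_of_mul_le_mul_left (by rwa [mul_one]) (hδ.trans (hlt _))

open Classical in
/-- The weight `ω` with the value at the trivial class replaced by one. -/
def unitalWeight (ω : UnitaryDual G → ℝ) (ρ : UnitaryDual G) : ℝ :=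
  if ρ = trivialClass G then 1 else ω ρ

theorem unitalWeight_trivialClass (ω : UnitaryDual G → ℝ) :
    unitalWeight ω (trivialClass G) = 1 := if_pos rfl

theorem unitalWeight_of_ne (ω : UnitaryDual G → ℝ) {ρ : UnitaryDual G} (h : ρ ≠ trivialClass G) :
    unitalWeight ω ρ = ω ρ := if_neg h

theorem IsCentralWeight.unitalWeight_nonneg {ω : UnitaryDual G → ℝ} (hω : IsCentralWeight ω)
    (ρ : UnitaryDual G) : 0 ≤ unitalWeight ω ρ := by
  unfold unitalWeight
  split_ifs
  · exact zero_le_one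
  · exact hω.nonneg ρ

/-- In the product weight a trivial component counts as `1`, though `ω` may exceed `1` there.
Lowering that value keeps the inequality: tensoring with the trivial class changes nothing, and for
two non-trivial factors only the left side can decrease. -/
theorem IsCentralWeight.unitalWeight_le_mul {ω : UnitaryDual G → ℝ} (hω : IsCentralWeight ω)
    {κ ρ ρ' : UnitaryDual G} (h : κ.InSupport (ρ.repr.rep.tprod ρ'.repr.rep)) :
    unitalWeight ω κ ≤ unitalWeight ω ρ * unitalWeight ω ρ' := by
  by_cases hρ : ρ = trivialClass G
  · have := UnitaryDual.isTrivial_iff.mpr hρ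
    rw [eq_of_inSupport_tprod_left h, hρ, unitalWeight_trivialClass, one_mul]
  by_cases hρ' : ρ' = trivialClass G
  · have := UnitaryDual.isTrivial_iff.mpr hρ'
    rw [eq_of_inSupport_tprod_right h, hρ', unitalWeight_trivialClass, mul_one]
  rw [unitalWeight_of_ne ω hρ, unitalWeight_of_ne ω hρ']
  refine le_trans ?_ (hω.le_mul κ ρ ρ' h)
  by_cases hκ : κ = trivialClass G
  · rw [hκ, unitalWeight_trivialClass]
    exact hω.one_le_trivialClass
  · rw [unitalWeight_of_ne ω hκ]

/-- If only the trivial class existed, every continuous function minus its mean would have vanishing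
Fourier coefficients, hence be zero, against Urysohn's lemma for two distinct points. -/
theorem exists_ne_trivialClass [IsTopologicalGroup G] [CompactSpace G] [T2Space G] [Nontrivial G] :
    ∃ ρ : UnitaryDual G, ρ ≠ trivialClass G := by
  by_contra! h
  have hconst : ∀ f : C(G, ℂ), f = ContinuousMap.const G (haarIntegral f) := by
    intro f
    rw [← sub_eq_zero]
    refine eq_zero_of_fourierCoeff_eq_zero fun π => ?_
    have hπ := UnitaryDual.isTrivial_iff.mpr (h π)
    have hmat : ∀ g, π.repr.mat g = 1 := fun g => Matrix.ext_of_mulVec_single fun j => by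
      rw [← Irrep.rep_apply, Representation.isTrivial_apply, Matrix.one_mulVec]
    ext i j
    simp only [fourierCoeff, Matrix.of_apply, hmat, Matrix.zero_apply]
    rw [haarIntegral_mul_const]
    change haarIntegral (fun t => f t - haarIntegral f) * _ = 0
    rw [haarIntegral_sub f.continuous continuous_const, haarIntegral_const, sub_self, zero_mul]
  obtain ⟨a, b, hab⟩ := exists_pair_ne G
  obtain ⟨f, hfa, hfb, -⟩ := exists_continuous_zero_one_of_isClosed (isClosed_singleton (x := a))
    (isClosed_singleton (x := b)) (by simpa using hab)
  let F : C(G, ℂ) := ⟨fun x => (f x : ℂ), Complex.continuous_ofReal.comp f.continuous⟩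
  have h1 : F a = F b := by rw [hconst F]; rfl
  have h2 : f a = f b := Complex.ofReal_injective h1
  rw [hfa rfl, hfb rfl] at h2
  exact zero_ne_one h2

end SingleGroup

/-! ### Components of a representation of a product on one factor -/

section Components

variable {I : Type v} [DecidableEq I] {G : I → Type u} [∀ i, Group (G i)]
  {V V' : Type*} [AddCommGroup V] [Module ℂ V] [AddCommGroup V'] [Module ℂ V']

/-- The restriction of a representation of a product of groups to one factor. -/
def restrictFactor (τ : Representation ℂ (∀ i, G i) V) (i : I) : Representation ℂ (G i) V :=
  τ.comp (MonoidHom.mulSingle G i)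

theorem restrictFactor_apply (τ : Representation ℂ (∀ i, G i) V) (i : I) (t : G i) :
    restrictFactor τ i t = τ (Pi.mulSingle i t) := rfl

/-- The restriction of an intertwining map to one factor. -/
def restrictFactorMap {τ : Representation ℂ (∀ i, G i) V} {τ' : Representation ℂ (∀ i, G i) V'}
    (T : Representation.IntertwiningMap τ τ') (i : I) :
    Representation.IntertwiningMap (restrictFactor τ i) (restrictFactor τ' i) where
  toLinearMap := T.toLinearMap
  isIntertwining' t := T.isIntertwining' (Pi.mulSingle i t)

variable [∀ i, TopologicalSpace (G i)]

/-- The restriction of `τ` to the factor `G i` is a nonzero multiple of `ρ`. -/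
structure IsComponent (τ : Representation ℂ (∀ i, G i) V) (i : I) (ρ : UnitaryDual (G i)) :
    Prop where
  separating : ∀ v ≠ 0,
    ∃ P : Representation.IntertwiningMap (restrictFactor τ i) ρ.repr.rep, P v ≠ 0
  exists_apply_ne_zero :
    ∃ (Q : Representation.IntertwiningMap ρ.repr.rep (restrictFactor τ i)) (w : _), Q w ≠ 0

variable {τ : Representation ℂ (∀ i, G i) V} {τ' : Representation ℂ (∀ i, G i) V'} {i : I}

theorem IsComponent.unique {ρ ρ' : UnitaryDual (G i)} (h : IsComponent τ i ρ)
    (h' : IsComponent τ i ρ') : ρ = ρ' := by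
  obtain ⟨Q, w, hw⟩ := h.exists_apply_ne_zero
  obtain ⟨P, hP⟩ := h'.separating _ hw
  exact UnitaryDual.eq_of_intertwining (S := P.comp Q) hP

theorem IsComponent.congr {ρ : UnitaryDual (G i)} (h : IsComponent τ i ρ)
    (e : Representation.Equiv τ τ') : IsComponent τ' i ρ where
  separating v hv := by
    obtain ⟨P, hP⟩ := h.separating (e.symm v) ((LinearEquiv.map_ne_zero_iff e.symm.toLinearEquiv).mpr hv)
    exact ⟨P.comp (restrictFactorMap e.symm.toIntertwiningMap i), hP⟩
  exists_apply_ne_zero := by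
    obtain ⟨Q, w, hw⟩ := h.exists_apply_ne_zero
    exact ⟨(restrictFactorMap e.toIntertwiningMap i).comp Q, w,
      (LinearEquiv.map_ne_zero_iff e.toLinearEquiv).mpr hw⟩

theorem IsComponent.of_isTrivial {n : Type*} [DecidableEq n] [Nonempty n]
    {τ : Representation ℂ (∀ i, G i) (n → ℂ)} [(restrictFactor τ i).IsTrivial] :
    IsComponent τ i (trivialClass (G i)) where
  separating v hv := by
    obtain ⟨b, hb⟩ := Function.ne_iff.mp hv
    refine ⟨intertwiningOfIsTrivial _ _
      ((LinearMap.proj b).smulRight (Pi.single 0 1 : Fin _ → ℂ)), fun h => hb ?_⟩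
    have h1 : v b • (Pi.single 0 1 : Fin _ → ℂ) = 0 := h
    simpa using congrFun h1 0
  exists_apply_ne_zero := by
    obtain ⟨b⟩ := ‹Nonempty n›
    refine ⟨intertwiningOfIsTrivial _ _
      ((LinearMap.proj 0).smulRight (Pi.single b 1 : n → ℂ)), Pi.single 0 1, fun h => ?_⟩
    have h1 : (Pi.single 0 1 : Fin (trivialClass (G i)).repr.dim → ℂ) 0 •
        (Pi.single b 1 : n → ℂ) = 0 := h
    simpa using congrFun h1 b

/-- Follow one nonzero vector of `κ` into the tensor product. Contractions allow intertwining maps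
onto `ρ` and `ρ'` to be chosen, one factor at a time, so that the tensor product of the two does not
annihilate it; the composite is a nonzero map from `κ` to `ρ ⊗ ρ'`. -/
theorem IsComponent.inSupport_tprod {ω : UnitaryDual (∀ i, G i)}
    {σ : Representation ℂ (∀ i, G i) V} {σ' : Representation ℂ (∀ i, G i) V'}
    (h : ω.InSupport (σ.tprod σ')) {κ ρ ρ' : UnitaryDual (G i)}
    (hκ : IsComponent ω.repr.rep i κ) (hρ : IsComponent σ i ρ) (hρ' : IsComponent σ' i ρ') :
    κ.InSupport (ρ.repr.rep.tprod ρ'.repr.rep) := by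
  obtain ⟨T, hT⟩ := h
  obtain ⟨Q, w, hw⟩ := hκ.exists_apply_ne_zero
  have hz : T (Q w) ≠ 0 := fun h0 => hw (hT (h0.trans (map_zero T).symm))
  set z := T (Q w) with hzdef
  obtain ⟨ℓ, hℓ⟩ := exists_contractRight_ne_zero hz
  obtain ⟨P, hP⟩ := hρ.separating _ hℓ
  have hz1 : TensorProduct.map P.toLinearMap LinearMap.id z ≠ 0 := fun h0 => hP (by
    have h1 := contractRight_map ℓ P.toLinearMap z
    rw [h0, map_zero] at h1
    exact h1.symm)
  obtain ⟨ℓ', hℓ'⟩ := exists_contractLeft_ne_zero hz1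
  obtain ⟨P', hP'⟩ := hρ'.separating _ hℓ'
  refine UnitaryDual.inSupport_of_intertwining (v := w)
    (S := (Representation.IntertwiningMap.tensor P P').comp
      (Representation.IntertwiningMap.comp (σ := restrictFactor ω.repr.rep i)
        (restrictFactorMap T i) Q)) fun h0 => hP' ?_
  have h1 := contractLeft_map ℓ' P'.toLinearMap (TensorProduct.map P.toLinearMap LinearMap.id z)
  have h2 : TensorProduct.map LinearMap.id P'.toLinearMap
      (TensorProduct.map P.toLinearMap LinearMap.id z) = 0 := by
    rw [← LinearMap.comp_apply, ← TensorProduct.map_comp]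
    exact h0
  rw [h2, map_zero] at h1
  exact h1.symm

variable (F : Finset I) (π : ∀ i : F, UnitaryDual (G i))

/-- In coordinates the factor `G i` acts along the lines in direction `i`. Restriction to the line
through a nonzero entry separates vectors, and placing a vector on the line with all other indices
`0` embeds `π i`. -/
theorem isComponent_outerHom_of_mem (i : F) :
    IsComponent (unitaryRep (outerHom F fun i => (π i).repr)) i (π i) where
  separating v hv := by
    obtain ⟨b, hb⟩ := Function.ne_iff.mp hv
    refine ⟨{ toLinearMap := LinearMap.funLeft ℂ ℂ (Function.update b i),
              isIntertwining' := fun t => LinearMap.ext fun f => funext fun j => ?_ }, fun h => hb ?_⟩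
    · have h1 := outerMatrix_mulSingle_mulVec F (fun i => (π i).repr) i t f (Function.update b i j)
      simp only [Function.update_self, Function.update_idem] at h1
      exact h1
    · have h1 : v (Function.update b i (b i)) = 0 := congrFun h (b i)
      rwa [Function.update_eq_self] at h1
  exists_apply_ne_zero := by
    refine ⟨{ toLinearMap := LinearMap.pi fun c =>
                if ∀ k ≠ i, c k = 0 then LinearMap.proj (c i) else 0,
              isIntertwining' := fun t => LinearMap.ext fun f => funext fun c => ?_ },
              Pi.single 0 1, fun h => ?_⟩
    · refine Eq.trans ?_ (outerMatrix_mulSingle_mulVec F (fun i => (π i).repr) i t _ c).symm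
      have h1 : ∀ j, (∀ k ≠ i, Function.update c i j k = 0) ↔ ∀ k ≠ i, c k = 0 := fun j =>
        forall₂_congr fun k hk => by rw [Function.update_of_ne hk]
      simp only [LinearMap.comp_apply, LinearMap.pi_apply, h1, Function.update_self]
      split_ifs
      · rfl
      · simp
    · have h1 := congrFun h fun _ => 0
      simp at h1

theorem isComponent_outerHom_of_notMem {i : I} (hi : i ∉ F) :
    IsComponent (unitaryRep (outerHom F fun i => (π i).repr)) i (trivialClass (G i)) := by
  have : (restrictFactor (unitaryRep (outerHom F fun i => (π i).repr)) i).IsTrivial :=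
    ⟨fun t => LinearMap.ext fun v => by
      rw [restrictFactor_apply, unitaryRep_apply, coe_outerHom,
        outerMatrix_mulSingle_of_notMem F _ hi, Matrix.one_mulVec]
      rfl⟩
  exact IsComponent.of_isTrivial

/-- The components of an outer tensor product. -/
def outerComponent (i : I) : UnitaryDual (G i) :=
  if h : i ∈ F then π ⟨i, h⟩ else trivialClass (G i)

theorem outerComponent_of_mem (i : F) : outerComponent F π i = π i := dif_pos i.2

theorem outerComponent_of_notMem {i : I} (hi : i ∉ F) :
    outerComponent F π i = trivialClass (G i) := dif_neg hi

theorem isComponent_outerHom (i : I) :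
    IsComponent (unitaryRep (outerHom F fun i => (π i).repr)) i (outerComponent F π i) := by
  by_cases h : i ∈ F
  · rw [outerComponent_of_mem F π ⟨i, h⟩]
    exact isComponent_outerHom_of_mem F π ⟨i, h⟩
  · rw [outerComponent_of_notMem F π h]
    exact isComponent_outerHom_of_notMem F π h

variable {F π} in
theorem IsOuterTensor.isComponent {σ : UnitaryDual (∀ i, G i)} (h : IsOuterTensor σ F π) (i : I) :
    IsComponent σ.repr.rep i (outerComponent F π i) := by
  obtain ⟨-, ⟨e⟩⟩ := h
  exact (isComponent_outerHom F π i).congr (e.trans (outerTensorEquiv F fun i => (π i).repr)).symm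

/-- Components are unique, so the choice in `productWeight` does not matter. The unital weights
allow `S` to be larger than the support, which lets several classes share one index set. -/
theorem productWeight_eq_prod (w : ∀ i, UnitaryDual (G i) → ℝ) {σ : UnitaryDual (∀ i, G i)}
    (hσ : ∃ p : (Σ F : Finset I, ∀ i : F, UnitaryDual (G i)), IsOuterTensor σ p.1 p.2)
    {c : ∀ i, UnitaryDual (G i)} (hc : ∀ i, IsComponent σ.repr.rep i (c i)) {S : Finset I}
    (hS : ∀ i ∉ S, c i = trivialClass (G i)) :
    productWeight w σ = ∏ i ∈ S, unitalWeight (w i) (c i) := by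
  rw [productWeight, dif_pos hσ]
  have hp := hσ.choose_spec
  set p := hσ.choose
  have hcp : ∀ i, outerComponent p.1 p.2 i = c i := fun i => (hp.isComponent i).unique (hc i)
  have hne : ∀ i : p.1, p.2 i ≠ trivialClass _ := fun i h =>
    hp.1 i (UnitaryDual.isTrivial_iff.mpr h)
  have h1 : ∀ i : p.1, w i (p.2 i) = unitalWeight (w i) (c i) := fun i => by
    rw [← hcp, outerComponent_of_mem, unitalWeight_of_ne _ (hne i)]
  rw [Finset.prod_congr rfl fun i _ => h1 i,
    Finset.prod_coe_sort p.1 fun i => unitalWeight (w i) (c i)]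
  refine Finset.prod_subset (fun i hi => ?_) fun i _ hi => ?_
  · by_contra hiS
    refine hne ⟨i, hi⟩ ?_
    rw [← outerComponent_of_mem p.1 p.2 ⟨i, hi⟩, hcp, hS i hiS]
  · rw [← hcp, outerComponent_of_notMem _ _ hi, unitalWeight_trivialClass]

end Components

/-! ### Centrality of the product weight -/

section ProductWeight

variable {I : Type v} {G : I → Type u} [∀ i, Group (G i)] [∀ i, TopologicalSpace (G i)]
  {w : ∀ i, UnitaryDual (G i) → ℝ}

/-- The positive lower bound rules out the default value `0` of `productWeight`, so the
classification of the dual of the product is not invoked. -/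
theorem exists_isOuterTensor (hw : ∃ δ : ℝ, 0 < δ ∧ ∀ σ, δ ≤ productWeight w σ)
    (σ : UnitaryDual (∀ i, G i)) :
    ∃ p : (Σ F : Finset I, ∀ i : F, UnitaryDual (G i)), IsOuterTensor σ p.1 p.2 := by
  obtain ⟨δ, hδ, h⟩ := hw
  by_contra hσ
  have h1 := h σ
  rw [productWeight, dif_neg hσ] at h1
  exact h1.not_gt hδ

theorem isCentralWeight_productWeight (hw : ∀ i, IsCentralWeight (w i))
    (hbdd : ∃ δ : ℝ, 0 < δ ∧ ∀ σ, δ ≤ productWeight w σ) :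
    IsCentralWeight (productWeight w) where
  exists_lt := by
    obtain ⟨δ, hδ, h⟩ := hbdd
    -- Halving turns the weak lower bound into the strict one required of a central weight.
    exact ⟨δ / 2, half_pos hδ, fun σ => (half_lt_self hδ).trans_le (h σ)⟩
  le_mul κ ρ ρ' h := by
    classical
    have hex := exists_isOuterTensor hbdd
    obtain ⟨⟨A, a⟩, ha⟩ := hex κ
    obtain ⟨⟨B, b⟩, hb⟩ := hex ρ
    obtain ⟨⟨C, c⟩, hc⟩ := hex ρ'
    have hA : ∀ i ∉ A ∪ B ∪ C, outerComponent A a i = trivialClass (G i) := fun i hi =>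
      outerComponent_of_notMem A a fun h => hi (by simp [h])
    have hB : ∀ i ∉ A ∪ B ∪ C, outerComponent B b i = trivialClass (G i) := fun i hi =>
      outerComponent_of_notMem B b fun h => hi (by simp [h])
    have hC : ∀ i ∉ A ∪ B ∪ C, outerComponent C c i = trivialClass (G i) := fun i hi =>
      outerComponent_of_notMem C c fun h => hi (by simp [h])
    rw [productWeight_eq_prod w (hex κ) ha.isComponent hA,
      productWeight_eq_prod w (hex ρ) hb.isComponent hB,
      productWeight_eq_prod w (hex ρ') hc.isComponent hC, ← Finset.prod_mul_distrib]
    exact Finset.prod_le_prod (fun i _ => (hw i).unitalWeight_nonneg _) fun i _ =>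
      (hw i).unitalWeight_le_mul
        (IsComponent.inSupport_tprod h (ha.isComponent i) (hb.isComponent i) (hc.isComponent i))

end ProductWeight

/-! ### The double limit criterion -/

section ArensCriterion

open Filter Topology

/-- A bounded sequence in a normed space has a weak* limit in the bidual along any ultrafilter. -/
theorem exists_bidual_tendsto {E : Type*} [NormedAddCommGroup E] [NormedSpace ℂ E] {f : ℕ → E}
    {K : ℝ} (hf : ∀ n, ‖f n‖ ≤ K) (𝒰 : Ultrafilter ℕ) :
    ∃ Φ : StrongDual ℂ (StrongDual ℂ E), ∀ φ : StrongDual ℂ E,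
      Tendsto (fun n => φ (f n)) 𝒰 (𝓝 (Φ φ)) := by
  have hc := WeakDual.isCompact_closedBall (𝕜 := ℂ) (E := StrongDual ℂ E) 0 K
  let T : ℕ → WeakDual ℂ (StrongDual ℂ E) := fun n =>
    StrongDual.toWeakDual (NormedSpace.inclusionInDoubleDual ℂ E (f n))
  have hT : ∀ n, T n ∈ WeakDual.toStrongDual ⁻¹'
      Metric.closedBall (0 : StrongDual ℂ (StrongDual ℂ E)) K := fun n => by
    rw [Set.mem_preimage, Metric.mem_closedBall]
    exact (dist_zero_right (E := StrongDual ℂ (StrongDual ℂ E)) _).trans_le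
      ((NormedSpace.double_dual_bound ℂ E (f n)).trans (hf n))
  obtain ⟨Φ, -, hΦ⟩ := hc.ultrafilter_le_nhds (𝒰.map T)
    (le_principal_iff.mpr (mem_map.mpr (univ_mem' hT)))
  refine ⟨WeakDual.toStrongDual Φ, fun φ => ?_⟩
  exact ((WeakDual.eval_continuous φ).tendsto Φ).comp (show Tendsto T 𝒰 (𝓝 Φ) from hΦ)

/-- The double limit criterion: bounded sequences whose products are separated by a functional
according to the order of their indices show that a normed algebra is not Arens regular. -/
theorem not_isArensRegular_of_ite {A : Type*} [NormedRing A] [NormedAlgebra ℂ A] {f g : ℕ → A}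
    {K : ℝ} (hf : ∀ n, ‖f n‖ ≤ K) (hg : ∀ n, ‖g n‖ ≤ K) (φ : StrongDual ℂ A)
    (hφ : ∀ n m, φ (f n * g m) = if n < m then 1 else 0) : ¬ IsArensRegular A := by
  intro hreg
  obtain ⟨Φ, hΦ⟩ := exists_bidual_tendsto hf (hyperfilter ℕ)
  obtain ⟨Ψ, hΨ⟩ := exists_bidual_tendsto hg (hyperfilter ℕ)
  have hle : (hyperfilter ℕ : Filter ℕ) ≤ atTop := by
    rw [← Nat.cofinite_eq_atTop]
    exact hyperfilter_le_cofinite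
  have h1 : firstArensProduct A Φ Ψ φ = 1 := by
    set χ : StrongDual ℂ A := arensAdjoint (arensAdjoint (ContinuousLinearMap.mul ℂ A)) Ψ φ
    -- For fixed `n` almost all `m` satisfy `n < m`, so the inner limit is `1`. In the other
    -- product, for fixed `m`, almost all `n` fail it.
    have hχ : ∀ n, χ (f n) = 1 := fun n => by
      refine tendsto_nhds_unique (hΨ (arensAdjoint (ContinuousLinearMap.mul ℂ A) φ (f n))) ?_
      refine tendsto_const_nhds.congr' ?_
      filter_upwards [hle (eventually_gt_atTop n)] with m hm
      exact ((hφ n m).trans (if_pos hm)).symm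
    refine tendsto_nhds_unique (hΦ χ) ?_
    simp only [hχ]
    exact tendsto_const_nhds
  have h2 : secondArensProduct A Φ Ψ φ = 0 := by
    set χ : StrongDual ℂ A := arensAdjoint (arensAdjoint (ContinuousLinearMap.mul ℂ A).flip) Φ φ
    have hχ : ∀ m, χ (g m) = 0 := fun m => by
      refine tendsto_nhds_unique
        (hΦ (arensAdjoint (ContinuousLinearMap.mul ℂ A).flip φ (g m))) ?_
      refine tendsto_const_nhds.congr' ?_
      filter_upwards [hle (eventually_ge_atTop m)] with n hn
      exact ((hφ n m).trans (if_neg hn.not_gt)).symm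
    refine tendsto_nhds_unique (hΨ χ) ?_
    simp only [hχ]
    exact tendsto_const_nhds
  rw [hreg, h2] at h1
  exact zero_ne_one h1

end ArensCriterion

/-! ### Diagonal coefficients and the separating functional -/

section DiagonalCoefficients

variable {G : Type u} [Group G] [TopologicalSpace G]

/-- The diagonal coefficient functions of an irreducible representation. -/
def Irrep.diagCoeff (ρ : Irrep G) (i : Fin ρ.dim) : C(G, ℂ) :=
  ⟨fun t => ρ.mat t i i, ρ.continuous_mat_apply i i⟩

theorem Irrep.diagCoeff_apply (ρ : Irrep G) (i : Fin ρ.dim) (t : G) :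
    ρ.diagCoeff i t = ρ.mat t i i := rfl

theorem Irrep.dim_repr_toClass (ρ : Irrep G) : ρ.toClass.repr.dim = ρ.dim := by
  obtain ⟨e⟩ := Irrep.toClass_eq_iff.mp (UnitaryDual.toClass_repr ρ.toClass)
  simpa using e.toLinearEquiv.finrank_eq

variable [IsTopologicalGroup G] [CompactSpace G]

theorem Irrep.fourierNorm_diagCoeff_le {ω : UnitaryDual G → ℝ} (hω : ∀ π, 0 ≤ ω π) (ρ : Irrep G)
    (i : Fin ρ.dim) : fourierNorm ω (ρ.diagCoeff i) ≤ ENNReal.ofReal (ω ρ.toClass) := by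
  have h := fourierNorm_coeffFun_irrep_le hω ρ (EuclideanSpace.single i 1)
    (EuclideanSpace.single i 1)
  have h1 : coeffFun ρ.continuous_toHom (EuclideanSpace.single i 1) (EuclideanSpace.single i 1) =
      ρ.diagCoeff i := by
    ext t
    simp [coeffFun_apply, Irrep.diagCoeff_apply, Irrep.mat, apply_ite]
  simpa [h1] using h

theorem isContractive_vecMulVec {n : ℕ} {v : EuclideanSpace ℂ (Fin n)} (hv : ‖v‖ ≤ 1) :
    IsContractive (Matrix.of fun i j => star (v i) * v j) := by
  intro x y
  have h : ∑ i, ∑ j, x i * star (y j) * (Matrix.of fun i j => star (v i) * v j) i j =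
      inner ℂ v x * inner ℂ y v := by
    simp only [PiLp.inner_apply, RCLike.inner_apply, Finset.sum_mul_sum, Matrix.of_apply]
    exact Finset.sum_congr rfl fun _ _ => Finset.sum_congr rfl fun _ _ => by
      simp only [RCLike.star_def]; ring
  rw [h, norm_mul]
  have h1 := norm_inner_le_norm (𝕜 := ℂ) v x
  have h2 := norm_inner_le_norm (𝕜 := ℂ) y v
  refine (mul_le_mul h1 h2 (norm_nonneg _) (by positivity)).trans ?_
  nlinarith [mul_nonneg (norm_nonneg x) (norm_nonneg y), norm_nonneg v,
    mul_le_one₀ hv (norm_nonneg v) hv]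

/-- A unitary matrix `A` carries the chosen representative of the class to `ρ`. The integral is then
the pairing of the Fourier coefficient with the contractive matrix of rank one made from the unit
vector in row `i` of `A`. -/
theorem norm_haarIntegral_mul_star_diagCoeff_le (f : C(G, ℂ)) (ρ : Irrep G) (i : Fin ρ.dim) :
    ‖haarIntegral fun t => f t * star (ρ.diagCoeff i t)‖ ≤
      traceNorm (fourierCoeff f ρ.toClass) := by
  obtain ⟨A, -, hA, hρ⟩ := Irrep.exists_unitary_of_equiv
    (Irrep.toClass_eq_iff.mp (UnitaryDual.toClass_repr ρ.toClass))
  let v : EuclideanSpace ℂ (Fin ρ.toClass.repr.dim) := WithLp.toLp 2 (A i)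
  have hv : ‖v‖ ≤ 1 := by
    have h1 := congrFun (congrFun hA i) i
    rw [Matrix.mul_apply, Matrix.one_apply_eq] at h1
    have h2 : ((‖v‖ ^ 2 : ℝ) : ℂ) = 1 := by
      rw [EuclideanSpace.norm_sq_eq, ← h1]
      push_cast
      refine Finset.sum_congr rfl fun k _ => ?_
      rw [Matrix.conjTranspose_apply, RCLike.star_def, RCLike.mul_conj]
      rfl
    have h3 : ‖v‖ ^ 2 = 1 := by exact_mod_cast h2
    nlinarith [norm_nonneg v]
  have h := (isContractive_vecMulVec hv).norm_le_traceNorm (fourierCoeff f ρ.toClass)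
  convert h using 2
  have hc := ρ.toClass.repr.continuous_mat_apply
  have h1 : ∀ t, f t * star (ρ.diagCoeff i t) =
      ∑ k, ∑ l, (f t * star (ρ.toClass.repr.mat t k l)) * (star (v k) * v l) := by
    intro t
    rw [Irrep.diagCoeff_apply, hρ, Matrix.mul_apply]
    simp only [Matrix.mul_apply, Finset.sum_mul, star_sum, Finset.mul_sum, star_mul']
    rw [Finset.sum_comm]
    refine Finset.sum_congr rfl fun k _ => Finset.sum_congr rfl fun l _ => ?_
    rw [Matrix.conjTranspose_apply, star_star]
    simp only [v]
    ring
  simp only [h1]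
  rw [haarIntegral_sum _ fun k _ => by fun_prop]
  refine Finset.sum_congr rfl fun k _ => ?_
  rw [haarIntegral_sum _ fun l _ => by fun_prop]
  refine Finset.sum_congr rfl fun l _ => ?_
  rw [haarIntegral_mul_const]
  rfl

theorem haarIntegral_diagCoeff_mul_star {J : Type*} [DecidableEq J] {γ : J → Irrep G}
    (hγ : Function.Injective fun p => (γ p).toClass) (c : ∀ p, Fin (γ p).dim) (p q : J) :
    haarIntegral (fun t => (γ p).diagCoeff (c p) t * star ((γ q).diagCoeff (c q) t)) =
      if p = q then ((γ p).dim : ℂ)⁻¹ else 0 := by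
  by_cases h : p = q
  · subst h
    rw [if_pos rfl]
    exact (coeffMatrix_self (γ p) (c p) (c p) (c p) (c p)).trans (if_pos ⟨rfl, rfl⟩)
  · rw [if_neg h]
    exact coeffMatrix_of_not_equiv (γ q) (γ p)
      (fun he => h (hγ (Irrep.toClass_eq_iff.mpr he)).symm) _ _ _ _

section Functional

variable {ω : UnitaryDual G → ℝ} (hω : IsCentralWeight ω) {A : Type*}
  [NormedCommRing A] [NormedAlgebra ℂ A] {ι : A →ₐ[ℂ] C(G, ℂ)} (hA : IsBeurlingFourierAlgebra ω ι)

include hA in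
theorem IsBeurlingFourierAlgebra.fourierNorm_lt_top (a : A) : fourierNorm ω (ι a) < ∞ := by
  rw [← hA.norm_eq]
  exact ENNReal.ofReal_lt_top

include hω hA

theorem IsBeurlingFourierAlgebra.hasSum_norm (a : A) :
    HasSum (fun π : UnitaryDual G => π.repr.dim * ω π * traceNorm (fourierCoeff (ι a) π)) ‖a‖ := by
  obtain ⟨δ, hδ, hlt⟩ := hω.exists_lt
  have hs := summable_dim_mul_traceNorm hδ (fun π => (hlt π).le) (hA.fourierNorm_lt_top a)
  convert hs.hasSum
  have h0 : ∀ π : UnitaryDual G, 0 ≤ π.repr.dim * ω π * traceNorm (fourierCoeff (ι a) π) := fun π =>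
    mul_nonneg (mul_nonneg (Nat.cast_nonneg _) (hω.nonneg π)) (traceNorm_nonneg _)
  rw [← ENNReal.ofReal_eq_ofReal_iff (norm_nonneg a) (tsum_nonneg h0), hA.norm_eq,
    ENNReal.ofReal_tsum_of_nonneg h0 hs]
  rfl

/-- The functional `∑_p d_p ω_p ⟨·, u_p⟩` for diagonal coefficients `u_p` of a family of mutually
inequivalent irreducible representations. -/
theorem IsBeurlingFourierAlgebra.exists_functional {J : Type*} {γ : J → Irrep G}
    (hγ : Function.Injective fun p => (γ p).toClass) (c : ∀ p, Fin (γ p).dim) :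
    ∃ φ : StrongDual ℂ A, ∀ a, φ a = ∑' p, ((γ p).dim * ω (γ p).toClass : ℂ) *
      haarIntegral fun t => ι a t * star ((γ p).diagCoeff (c p) t) := by
  -- Each term is dominated by the term of the norm series at the same class. Since the classes are
  -- distinct, the functional is defined everywhere and has norm at most `1`.
  have hle : ∀ a p, ‖((γ p).dim * ω (γ p).toClass : ℂ) *
      haarIntegral fun t => ι a t * star ((γ p).diagCoeff (c p) t)‖ ≤
      (γ p).toClass.repr.dim * ω (γ p).toClass * traceNorm (fourierCoeff (ι a) (γ p).toClass) := by
    intro a p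
    have hd : ((γ p).toClass.repr.dim : ℝ) = (γ p).dim := by rw [(γ p).dim_repr_toClass]
    rw [norm_mul, norm_mul, Complex.norm_natCast, Complex.norm_of_nonneg (hω.nonneg _), hd]
    exact mul_le_mul_of_nonneg_left (norm_haarIntegral_mul_star_diagCoeff_le _ _ _)
      (mul_nonneg (Nat.cast_nonneg _) (hω.nonneg _))
  have hs : ∀ a, Summable fun p => (γ p).toClass.repr.dim * ω (γ p).toClass *
      traceNorm (fourierCoeff (ι a) (γ p).toClass) := fun a =>
    (hA.hasSum_norm hω a).summable.comp_injective hγ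
  have hs' : ∀ a, Summable fun p => ((γ p).dim * ω (γ p).toClass : ℂ) *
      haarIntegral fun t => ι a t * star ((γ p).diagCoeff (c p) t) := fun a =>
    Summable.of_norm_bounded (hs a) (hle a)
  refine ⟨LinearMap.mkContinuous
    { toFun := fun a => ∑' p, ((γ p).dim * ω (γ p).toClass : ℂ) *
        haarIntegral fun t => ι a t * star ((γ p).diagCoeff (c p) t)
      map_add' := fun a b => ?_
      map_smul' := fun z a => ?_ } 1 fun a => ?_, fun a => rfl⟩
  · rw [← (hs' a).tsum_add (hs' b)]
    refine tsum_congr fun p => ?_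
    rw [← mul_add, ← haarIntegral_add (by fun_prop) (by fun_prop)]
    simp only [map_add, ContinuousMap.add_apply, add_mul]
  · rw [RingHom.id_apply, smul_eq_mul, ← tsum_mul_left]
    refine tsum_congr fun p => ?_
    rw [mul_left_comm z, ← haarIntegral_const_mul z]
    simp only [map_smul, ContinuousMap.smul_apply, smul_eq_mul, mul_assoc]
  · rw [one_mul]
    refine (tsum_of_norm_bounded (hs a).hasSum (hle a)).trans ?_
    refine (tsum_comp_le_tsum_of_inj (hA.hasSum_norm hω a).summable (fun π =>
      mul_nonneg (mul_nonneg (Nat.cast_nonneg _) (hω.nonneg π)) (traceNorm_nonneg _)) hγ).trans_eq ?_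
    exact (hA.hasSum_norm hω a).tsum_eq

theorem IsBeurlingFourierAlgebra.exists_normalized_diagCoeff (ρ : Irrep G) (i : Fin ρ.dim) :
    ∃ a : A, ‖a‖ ≤ 1 ∧ ι a = (ω ρ.toClass : ℂ)⁻¹ • ρ.diagCoeff i := by
  obtain ⟨δ, hδ, hlt⟩ := hω.exists_lt
  have hpos := hδ.trans (hlt ρ.toClass)
  have h1 : fourierNorm ω ((ω ρ.toClass : ℂ)⁻¹ • ρ.diagCoeff i) ≤ 1 := by
    rw [fourierNorm_smul, norm_inv, Complex.norm_of_nonneg hpos.le]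
    refine (mul_le_mul_right (ρ.fourierNorm_diagCoeff_le hω.nonneg i) _).trans ?_
    rw [← ENNReal.ofReal_mul (inv_nonneg.mpr hpos.le), inv_mul_cancel₀ hpos.ne', ENNReal.ofReal_one]
  obtain ⟨a, ha⟩ : (ω ρ.toClass : ℂ)⁻¹ • ρ.diagCoeff i ∈ Set.range ι := by
    rw [hA.range_eq]
    exact h1.trans_lt ENNReal.one_lt_top
  refine ⟨a, ?_, ha⟩
  rw [← ha, ← hA.norm_eq, ENNReal.ofReal_le_one] at h1
  exact h1

/-- Equality of the weights makes the product of two normalized coefficients the normalized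
coefficient of `γ (n, m)`, on which the term of the functional at `(n, m)` is `1` and all others are
`0`. -/
theorem IsBeurlingFourierAlgebra.not_isArensRegular_of_diagCoeff_mul {α β : ℕ → Irrep G} {γ : ℕ × ℕ → Irrep G}
    (a : ∀ n, Fin (α n).dim) (b : ∀ n, Fin (β n).dim) (c : ∀ p, Fin (γ p).dim)
    (hγ : Function.Injective fun p => (γ p).toClass)
    (hmul : ∀ n m, (α n).diagCoeff (a n) * (β m).diagCoeff (b m) = (γ (n, m)).diagCoeff (c (n, m)))
    (hweight : ∀ n m, ω (γ (n, m)).toClass = ω (α n).toClass * ω (β m).toClass) :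
    ¬ IsArensRegular A := by
  classical
  obtain ⟨δ, hδ, hlt⟩ := hω.exists_lt
  choose f hf hf' using fun n => hA.exists_normalized_diagCoeff hω (α n) (a n)
  choose g hg hg' using fun n => hA.exists_normalized_diagCoeff hω (β n) (b n)
  -- Only the pairs with `n < m` enter the functional, which makes the iterated limits differ.
  obtain ⟨φ, hφ⟩ := hA.exists_functional hω (J := {p : ℕ × ℕ // p.1 < p.2}) (γ := fun p => γ p)
    (hγ.comp Subtype.val_injective) fun p => c p
  refine not_isArensRegular_of_ite hf hg φ fun n m => ?_
  have hfg : ι (f n * g m) = (ω (γ (n, m)).toClass : ℂ)⁻¹ • (γ (n, m)).diagCoeff (c (n, m)) := by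
    rw [map_mul, hf', hg', smul_mul_smul_comm, hmul, hweight, Complex.ofReal_mul, mul_inv]
  have hterm : ∀ p : {p : ℕ × ℕ // p.1 < p.2}, ((γ p).dim * ω (γ p).toClass : ℂ) *
      haarIntegral (fun t => ι (f n * g m) t * star ((γ p).diagCoeff (c p) t)) =
      if (n, m) = (p : ℕ × ℕ) then 1 else 0 := by
    intro p
    have h1 : haarIntegral (fun t => ι (f n * g m) t * star ((γ p).diagCoeff (c p) t)) =
        (ω (γ (n, m)).toClass : ℂ)⁻¹ * if (n, m) = (p : ℕ × ℕ) then ((γ (n, m)).dim : ℂ)⁻¹ else 0 := by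
      rw [← haarIntegral_diagCoeff_mul_star hγ c, ← haarIntegral_const_mul, hfg]
      simp only [ContinuousMap.smul_apply, smul_eq_mul, mul_assoc]
    rw [h1]
    split_ifs with h
    · have h2 : (ω (γ p).toClass : ℂ) ≠ 0 := Complex.ofReal_ne_zero.mpr (hδ.trans (hlt _)).ne'
      have h3 : ((γ p).dim : ℂ) ≠ 0 := Nat.cast_ne_zero.mpr (NeZero.ne _)
      rw [h]
      field_simp
    · simp
  rw [hφ, tsum_congr hterm]
  by_cases h : n < m
  · rw [if_pos h, tsum_eq_single ⟨(n, m), h⟩]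
    · simp
    · intro q hq
      exact if_neg fun h1 => hq (Subtype.ext h1.symm)
  · rw [if_neg h]
    refine (tsum_congr fun p => if_neg fun h1 => h ?_).trans tsum_zero
    have h2 := p.2
    rwa [← h1] at h2

end Functional

end DiagonalCoefficients

/-! ### Outer tensor products of one fixed family of classes -/

section OuterFamily

variable {I : Type v} [DecidableEq I] {G : I → Type u} [∀ i, Group (G i)]
  [∀ i, TopologicalSpace (G i)] [∀ i, IsTopologicalGroup (G i)] [∀ i, CompactSpace (G i)]
  (p : ∀ i, UnitaryDual (G i))

/-- The outer tensor products of a fixed family of classes over finite sets of indices. -/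
def outerFamily (F : Finset I) : Irrep (∀ i, G i) := outerIrrep F fun i => (p i).repr

/-- The index of the first basis vector. -/
def outerFamilyIndex (F : Finset I) : Fin (outerFamily p F).dim :=
  Fintype.equivFin (∀ i : F, Fin (p i).repr.dim) fun _ => 0

theorem outerFamily_diagCoeff_apply (F : Finset I) (x : ∀ i, G i) :
    (outerFamily p F).diagCoeff (outerFamilyIndex p F) x = ∏ i ∈ F, (p i).repr.mat (x i) 0 0 := by
  rw [← Finset.prod_coe_sort F fun i => (p i).repr.mat (x i) 0 0]
  change outerMatrix F (fun i => (p i).repr) x ((Fintype.equivFin _).symm _)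
    ((Fintype.equivFin _).symm _) = _
  rw [outerFamilyIndex, Equiv.symm_apply_apply]
  rfl

theorem outerFamily_diagCoeff_mul {F F' : Finset I} (h : Disjoint F F') :
    (outerFamily p F).diagCoeff (outerFamilyIndex p F) *
      (outerFamily p F').diagCoeff (outerFamilyIndex p F') =
      (outerFamily p (F ∪ F')).diagCoeff (outerFamilyIndex p (F ∪ F')) := by
  ext x
  rw [ContinuousMap.mul_apply, outerFamily_diagCoeff_apply, outerFamily_diagCoeff_apply,
    outerFamily_diagCoeff_apply, Finset.prod_union h]

variable {p} (hp : ∀ i, p i ≠ trivialClass (G i))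

include hp

theorem isOuterTensor_outerFamily (F : Finset I) :
    IsOuterTensor (outerFamily p F).toClass F fun i => p i := by
  refine ⟨fun i h => hp i (UnitaryDual.isTrivial_iff.mp h), ?_⟩
  obtain ⟨e⟩ := Irrep.toClass_eq_iff.mp (UnitaryDual.toClass_repr (outerFamily p F).toClass)
  exact ⟨e.trans (outerIrrepEquiv F fun i => (p i).repr)⟩

/-- The class determines `F` as the set of indices at which its component is non-trivial. -/
theorem outerFamily_toClass_injective :
    Function.Injective fun F : Finset I => (outerFamily p F).toClass := by
  have key : ∀ F F' : Finset I, (outerFamily p F).toClass = (outerFamily p F').toClass → F ⊆ F' := by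
    intro F F' h i hi
    by_contra hi'
    have h1 := (isOuterTensor_outerFamily hp F).isComponent i
    rw [h] at h1
    have h2 := h1.unique ((isOuterTensor_outerFamily hp F').isComponent i)
    rw [outerComponent_of_mem F _ ⟨i, hi⟩, outerComponent_of_notMem F' _ hi'] at h2
    exact hp i h2
  exact fun F F' h => (key F F' h).antisymm (key F' F h.symm)

theorem productWeight_outerFamily (w : ∀ i, UnitaryDual (G i) → ℝ) (F : Finset I) :
    productWeight w (outerFamily p F).toClass = ∏ i ∈ F, w i (p i) := by
  have h := isOuterTensor_outerFamily hp F
  rw [productWeight_eq_prod w ⟨⟨F, _⟩, h⟩ h.isComponent fun i hi => outerComponent_of_notMem F _ hi]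
  refine Finset.prod_congr rfl fun i hi => ?_
  rw [outerComponent_of_mem F _ ⟨i, hi⟩, unitalWeight_of_ne _ (hp i)]

end OuterFamily

/-! ### Conclusion for infinite products -/

theorem not_isArensRegular_productWeight {I : Type v} [Infinite I] {G : I → Type u}
    [∀ i, Group (G i)] [∀ i, TopologicalSpace (G i)] [∀ i, IsTopologicalGroup (G i)]
    [∀ i, CompactSpace (G i)] [∀ i, T2Space (G i)] [∀ i, Nontrivial (G i)]
    {w : ∀ i, UnitaryDual (G i) → ℝ} (hω : IsCentralWeight (productWeight w)) {A : Type*}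
    [NormedCommRing A] [NormedAlgebra ℂ A] {ι : A →ₐ[ℂ] C(∀ i, G i, ℂ)}
    (hA : IsBeurlingFourierAlgebra (productWeight w) ι) : ¬ IsArensRegular A := by
  classical
  choose p hp using fun i => exists_ne_trivialClass (G := G i)
  -- Even positions serve the first sequence and odd ones the second, so the singletons are disjoint
  -- and `(n, m)` can be recovered from their union.
  let e := Infinite.natEmbedding I
  have hne : ∀ n m, e (2 * n) ≠ e (2 * m + 1) := fun n m h => by
    have := e.injective h
    omega
  have hdisj : ∀ n m, Disjoint ({e (2 * n)} : Finset I) {e (2 * m + 1)} := fun n m =>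
    Finset.disjoint_singleton.mpr (hne n m)
  refine hA.not_isArensRegular_of_diagCoeff_mul hω
    (α := fun n => outerFamily p {e (2 * n)}) (β := fun m => outerFamily p {e (2 * m + 1)})
    (γ := fun q => outerFamily p ({e (2 * q.1)} ∪ {e (2 * q.2 + 1)}))
    (fun _ => outerFamilyIndex p _) (fun _ => outerFamilyIndex p _)
    (fun _ => outerFamilyIndex p _) ?_ (fun n m => outerFamily_diagCoeff_mul p (hdisj n m)) ?_
  · intro q q' h
    have h1 := outerFamily_toClass_injective hp h
    have h2 : e (2 * q.1) ∈ ({e (2 * q'.1)} ∪ {e (2 * q'.2 + 1)} : Finset I) := by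
      rw [← h1]; simp
    have h3 : e (2 * q.2 + 1) ∈ ({e (2 * q'.1)} ∪ {e (2 * q'.2 + 1)} : Finset I) := by
      rw [← h1]; simp
    simp only [Finset.mem_union, Finset.mem_singleton, e.injective.eq_iff] at h2 h3
    exact Prod.ext (by omega) (by omega)
  · intro n m
    simp only [productWeight_outerFamily hp]
    exact Finset.prod_union (hdisj n m)

end BeurlingFourier

end

theorem mainTheorem9 {I : Type v} [Infinite I] (G : I → Type u)
    [∀ i, Group (G i)] [∀ i, TopologicalSpace (G i)] [∀ i, IsTopologicalGroup (G i)]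
    [∀ i, CompactSpace (G i)] [∀ i, T2Space (G i)] [∀ i, Nontrivial (G i)]
    (w : ∀ i, BeurlingFourier.UnitaryDual (G i) → ℝ)
    (hw : ∀ i, BeurlingFourier.IsCentralWeight (w i))
    (hbdd : ∃ δ : ℝ, 0 < δ ∧ ∀ σ : BeurlingFourier.UnitaryDual (∀ i, G i),
      δ ≤ BeurlingFourier.productWeight w σ) :
    (∃ (A : Type (max u v)) (_ : NormedCommRing A) (_ : NormedAlgebra ℂ A)
        (ι : A →ₐ[ℂ] C(∀ i, G i, ℂ)),
      CompleteSpace A ∧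
        BeurlingFourier.IsBeurlingFourierAlgebra (BeurlingFourier.productWeight w) ι) ∧
    ∀ (A : Type (max u v)) [NormedCommRing A] [NormedAlgebra ℂ A]
      (ι : A →ₐ[ℂ] C(∀ i, G i, ℂ)),
      BeurlingFourier.IsBeurlingFourierAlgebra (BeurlingFourier.productWeight w) ι →
        ¬ BeurlingFourier.IsArensRegular A := by
  have hω := BeurlingFourier.isCentralWeight_productWeight hw hbdd
  exact ⟨⟨BeurlingFourier.BeurlingFourierAlgebra hω, inferInstance, inferInstance,
      BeurlingFourier.BeurlingFourierAlgebra.incl hω, inferInstance,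
      BeurlingFourier.BeurlingFourierAlgebra.isBeurlingFourierAlgebra hω⟩,
    fun _ _ _ _ hA => BeurlingFourier.not_isArensRegular_productWeight hω hA⟩
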